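/- **Setting.** Let $\mathbb C[x,\xi]$ be the superalgebra with $x$ even, $\xi$ odd, $\xi^2=0$, and put $D=\partial_\xi+\xi\partial_x$, $\overline D=\partial_\xi-\xi\partial_x$. Let $\mathcal K$ be the Lie superalgebra of contact vector fields on $\mathbb R^{1|1}$, that is, the stabilizer of $\mathbb C[x,\xi]\overline D$ in the Lie superalgebra $\mathbb C[x,\xi]\partial_x\oplus\mathbb C[x,\xi]\partial_\xi$ of polynomial vector fields. Let $\mathbb X:\mathbb C[x,\xi]\to\mathcal K$ be the even linear bijection $\mathbb X(f)=f\partial_x+\tfrac12f'\xi\partial_\xi$, $\mathbb X(\xi f)=\tfrac12fD$ for $f\in\mathbb C[x]$. For $n\in\mathbb N=\{0,1,2,\dots\}$ put $e_{n-1}=\mathbb X(x^n)$ and $e_{n-1/2}=2\,\mathbb X(\xi x^n)$, and let $$\mathfrak u=\langle e_{-1},e_{-1/2}\rangle\subset\mathfrak t=\langle e_{-1},e_{-1/2},e_0\rangle\subset\mathfrak s=\langle e_{-1},e_{-1/2},e_0,e_{1/2},e_1\rangle .$$ For $\lambda\in\mathbb C$ let $\mathbb F(\lambda)=\omega^\lambda\mathbb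 C[x,\xi]$ be the tensor density module of $\mathcal K$, in which $\mathbb X(F)$ acts by $\omega^\lambda G\mapsto\omega^\lambda(\mathbb X(F)G+\lambda F'G)$, where $F'=\partial_xF$ and $\omega$ is even. For a subalgebra $\mathfrak h$ let $C^n(\mathcal K,\mathfrak h,\mathbb F(\lambda))$ be the superspace of all (even and odd) linear maps $\Lambda^n_s\mathcal K\to\mathbb F(\lambda)$ on the superexterior power which are $\mathfrak h$-relative, that is, vanish when an argument is in $\mathfrak h$ and are $\mathfrak h$-invariant. Let $H^n(\mathcal K,\mathfrak h,\mathbb F(\lambda))$ be its cohomology for the Chevalley–Eilenberg differential $\partial$ of Lie superalgebras, and $H^n(\mathcal K,\mathbb F(\lambda))=H^n(\mathcal K,0,\mathbb F(\lambda))$; dimensions are total (even plus odd). A class in $H^n(\mathcal K,\mathbb F(\lambda))$ is called $\mathfrak h$-relative if it contains an $\mathfrak h$-relative cocycle. Define 1-cochains with values in $\mathbb F(0)$, $\mathbb F(1/2)$, $\mathbb F(3/2)$ by $$\theta(\mathbb X(F))=\overline D^{2}F,\qquad \alpha(\mathbb X(F))=\omega^{1/2}\overline D^{3}F,\qquad \beta(\mathbb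 X(F))=\omega^{3/2}\overline D^{5}F .$$ The cup product of 1-cochains $\phi$, $\psi$ with values in $\mathbb F(\lambda)$, $\mathbb F(\mu)$ is the $\mathbb F(\lambda+\mu)$-valued 2-cochain $$(\phi\cup\psi)(X\wedge Y)=(-1)^{|X||\psi|}\phi(X)\psi(Y)-(-1)^{|Y|(|X|+|\psi|)}\phi(Y)\psi(X),$$ with densities multiplied by $\omega^\lambda F\cdot\omega^\mu G=\omega^{\lambda+\mu}FG$. A cocycle is trivial if it is a coboundary. **Proposition.** (a) $H^0(\mathcal K,\mathbb F(\lambda))$ is $\mathbb C1$ for $\lambda=0$, and $0$ otherwise. (b) The 1-cochains $\theta$, $\alpha$ and $\beta$ are non-trivial 1-cocycles: $\theta$ is even, $\mathfrak u$-relative and $\mathfrak t$-invariant; $\alpha$ is odd and $\mathfrak t$-relative; $\beta$ is odd and $\mathfrak s$-relative. Moreover, $[\theta]$ is not $\mathfrak t$-relative and $[\alpha]$ is not $\mathfrak s$-relative. (c) $H^1(\mathcal K,\mathbb F(\lambda))$ is spanned by $[\theta]$ for $\lambda=0$, by $[\alpha]$ for $\lambda=1/2$, by $[\beta]$ for $\lambda=3/2$,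 and is $0$ otherwise. (d) The 2-cochains $\theta\cup\alpha$, $\theta\cup\beta$, $\beta\cup\beta$, $\theta\cup\theta$, $\alpha\cup\alpha$ and $\alpha\cup\beta$ are cocycles; the first three are non-trivial and the last three are trivial. Neither $[\theta\cup\alpha]$ nor $[\theta\cup\beta]$ is $\mathfrak t$-relative. (e) $H^2(\mathcal K,\mathbb F(\lambda))$ is spanned by $[\theta\cup\alpha]$ for $\lambda=1/2$, by $[\theta\cup\beta]$ for $\lambda=3/2$, and by $[\beta\cup\beta]$ for $\lambda=3$. It is at least 1-dimensional for $\lambda=5$. Otherwise it is $0$, except possibly for $2\lambda\in7+\mathbb N$. (f) $\beta\cup\beta$ is $\mathfrak s$-relative, and $\dim H^2(\mathcal K,\mathfrak s,\mathbb F(\lambda))=1$ for $\lambda=3$ and $\lambda=5$; at $\lambda=3$ it is spanned by $[\beta\cup\beta]$. Otherwise it is $0$, except possibly for $\lambda\in\{13/2,7\}+2\mathbb N$. -/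

import Mathlib

open Polynomial

noncomputable section

namespace ContactSuperline

/-! ### Signs and superspaces -/

/-- The sign `(-1)^p` of a parity `p`. -/
def sgn (p : ZMod 2) : ℂ := if p = 0 then 1 else -1

@[simp] theorem sgn_zero : sgn 0 = 1 := by simp [sgn]

@[simp] theorem sgn_one : sgn 1 = -1 := by simp [sgn]

/-- A complex superspace, given by its parity endomorphism `v ↦ (-1)^{|v|} v`, an involution
whose eigenspaces for `1` and `-1` are the even and the odd part. -/
class Superspace (V : Type) [AddCommGroup V] [Module ℂ V] where
  /-- the parity endomorphism -/
  par : V →ₗ[ℂ] V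
  par_par : ∀ v, par (par v) = v

/-- The vector `v` is homogeneous of parity `p`. -/
def HasParity {V : Type} [AddCommGroup V] [Module ℂ V] [Superspace V] (p : ZMod 2) (v : V) :
    Prop :=
  Superspace.par v = sgn p • v

/-- The component of parity `p`: the projection to the even (`p = 0`) or odd (`p = 1`) part. -/
def part {V : Type} [AddCommGroup V] [Module ℂ V] [Superspace V] (p : ZMod 2) : V →ₗ[ℂ] V :=
  (1 / 2 : ℂ) • (LinearMap.id + sgn p • Superspace.par)

/-! ### Polynomials and vector fields on the superline -/

/-- The superalgebra `ℂ[x, ξ]` with `x` even, `ξ` odd and `ξ ^ 2 = 0`, that is, the dual numbers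
over `ℂ[x]`. It is supercommutative: odd elements multiply to zero and all elements commute. -/
def SPoly : Type := DualNumber ℂ[X]

instance : CommRing SPoly := inferInstanceAs (CommRing (DualNumber ℂ[X]))

instance : Algebra ℂ SPoly := inferInstanceAs (Algebra ℂ (DualNumber ℂ[X]))

instance : AddCommGroup SPoly := inferInstance

instance : AddCommMonoid SPoly := AddCommGroup.toAddCommMonoid

instance : Module ℂ SPoly := Algebra.toModule

namespace SPoly

/-- The element `f + ξ g`. -/
def mk (f g : ℂ[X]) : SPoly := (TrivSqZeroExt.inl f + TrivSqZeroExt.inr g : DualNumber ℂ[X])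

/-- The coefficient `f` of `f + ξ g`. -/
def fst (F : SPoly) : ℂ[X] := TrivSqZeroExt.fst F

/-- The coefficient `g` of `f + ξ g`. -/
def snd (F : SPoly) : ℂ[X] := TrivSqZeroExt.snd F

theorem ext {F G : SPoly} (h1 : F.fst = G.fst) (h2 : F.snd = G.snd) : F = G :=
  TrivSqZeroExt.ext h1 h2

@[simp] theorem fst_mk (f g : ℂ[X]) : (mk f g).fst = f := by
  simp [mk, fst]

@[simp] theorem snd_mk (f g : ℂ[X]) : (mk f g).snd = g := by
  simp [mk, snd]

@[simp] theorem fst_zero : (0 : SPoly).fst = 0 := rfl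

@[simp] theorem snd_zero : (0 : SPoly).snd = 0 := rfl

@[simp] theorem fst_one : (1 : SPoly).fst = 1 := rfl

@[simp] theorem snd_one : (1 : SPoly).snd = 0 := rfl

@[simp] theorem fst_add (F G : SPoly) : (F + G).fst = F.fst + G.fst := rfl

@[simp] theorem snd_add (F G : SPoly) : (F + G).snd = F.snd + G.snd := rfl

@[simp] theorem fst_neg (F : SPoly) : (-F).fst = -F.fst := rfl

@[simp] theorem snd_neg (F : SPoly) : (-F).snd = -F.snd := rfl

@[simp] theorem fst_sub (F G : SPoly) : (F - G).fst = F.fst - G.fst := rfl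

@[simp] theorem snd_sub (F G : SPoly) : (F - G).snd = F.snd - G.snd := rfl

@[simp] theorem fst_smul (c : ℂ) (F : SPoly) : (c • F).fst = C c * F.fst :=
  smul_eq_C_mul c

@[simp] theorem snd_smul (c : ℂ) (F : SPoly) : (c • F).snd = C c * F.snd :=
  smul_eq_C_mul c

@[simp] theorem fst_mul (F G : SPoly) : (F * G).fst = F.fst * G.fst := rfl

@[simp] theorem snd_mul (F G : SPoly) : (F * G).snd = F.fst * G.snd + F.snd * G.fst := rfl

end SPoly

/-- The even coordinate. -/
def x : SPoly := SPoly.mk X 0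

/-- The odd coordinate. -/
def ξ : SPoly := SPoly.mk 0 1

instance : Superspace SPoly where
  par :=
    { toFun := fun F => SPoly.mk F.fst (-F.snd)
      map_add' := fun F G => by refine SPoly.ext ?_ ?_ <;> simp [add_comm]
      map_smul' := fun c F => by refine SPoly.ext ?_ ?_ <;> simp }
  par_par := fun F => by refine SPoly.ext ?_ ?_ <;> simp

/-- The superspace of endomorphisms of a superspace. -/
instance {V : Type} [AddCommGroup V] [Module ℂ V] [Superspace V] :
    Superspace (Module.End ℂ V) where
  par :=
    { toFun := fun T => Superspace.par * T * Superspace.par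
      map_add' := fun S T => by rw [mul_add, add_mul]
      map_smul' := fun c T => by simp }
  par_par := fun T => by ext v; simp [Superspace.par_par]

/-- The superbracket `[S, T] = S T - (-1)^{|S||T|} T S` of endomorphisms of a superspace,
extended bilinearly from homogeneous elements. -/
def superBracket {V : Type} [AddCommGroup V] [Module ℂ V] [Superspace V]
    (S T : Module.End ℂ V) : Module.End ℂ V :=
  S * T - ∑ p : ZMod 2, ∑ q : ZMod 2, sgn (p * q) • (part q T * part p S)

/-- The even derivation `∂_x`. -/
def dx : Module.End ℂ SPoly where
  toFun F := SPoly.mk (derivative F.fst) (derivative F.snd)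
  map_add' F G := by refine SPoly.ext ?_ ?_ <;> simp
  map_smul' c F := by refine SPoly.ext ?_ ?_ <;> simp

/-- The odd superderivation `∂_ξ`, sending `f + ξ g` to `g`. -/
def dξ : Module.End ℂ SPoly where
  toFun F := SPoly.mk F.snd 0
  map_add' F G := by refine SPoly.ext ?_ ?_ <;> simp
  map_smul' c F := by refine SPoly.ext ?_ ?_ <;> simp

/-- `D = ∂_ξ + ξ ∂_x`. -/
def D : Module.End ℂ SPoly := dξ + ξ • dx

/-- `D̄ = ∂_ξ - ξ ∂_x`. -/
def Dbar : Module.End ℂ SPoly := dξ - ξ • dx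

/-- The polynomial vector fields on the superline: the span of `∂_x` and `∂_ξ` over `ℂ[x, ξ]`. -/
def vectorFields : Submodule SPoly (Module.End ℂ SPoly) := Submodule.span SPoly {dx, dξ}

/-- The distribution `ℂ[x, ξ] D̄`, the vector fields annihilated by the contact form
`dx + ξ dξ`. -/
def distribution : Submodule SPoly (Module.End ℂ SPoly) := Submodule.span SPoly {Dbar}

/-! ### Contact vector fields -/

theorem superBracket_add_left {V : Type} [AddCommGroup V] [Module ℂ V] [Superspace V]
    (S S' T : Module.End ℂ V) :
    superBracket (S + S') T = superBracket S T + superBracket S' T := by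
  simp only [superBracket, map_add, mul_add, add_mul, smul_add, Finset.sum_add_distrib]
  abel

theorem superBracket_smul_left {V : Type} [AddCommGroup V] [Module ℂ V] [Superspace V]
    (c : ℂ) (S T : Module.End ℂ V) :
    superBracket (c • S) T = c • superBracket S T := by
  simp only [superBracket, map_smul, smul_mul_assoc, mul_smul_comm, smul_sub, Finset.smul_sum]
  simp only [smul_comm c]

/-- The Lie superalgebra of contact vector fields: the stabilizer of the distribution
`ℂ[x, ξ] D̄` in the Lie superalgebra of vector fields. -/
def contact : Submodule ℂ (Module.End ℂ SPoly) where
  carrier := {S | S ∈ vectorFields ∧ ∀ T ∈ distribution, superBracket S T ∈ distribution}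
  zero_mem' := ⟨zero_mem _, fun T _ => by
    have h := superBracket_smul_left (0 : ℂ) 0 T
    rw [zero_smul, zero_smul] at h
    rw [h]
    exact zero_mem _⟩
  add_mem' := fun hS hS' => ⟨add_mem hS.1 hS'.1, fun T hT => by
    rw [superBracket_add_left]
    exact add_mem (hS.2 T hT) (hS'.2 T hT)⟩
  smul_mem' := fun c S hS => ⟨by
    have h := vectorFields.smul_mem (algebraMap ℂ SPoly c) hS.1
    rwa [algebraMap_smul] at h, fun T hT => by
    rw [superBracket_smul_left]
    have h := distribution.smul_mem (algebraMap ℂ SPoly c) (hS.2 T hT)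
    rwa [algebraMap_smul] at h⟩

/-- The contact vector field with contact Hamiltonian `F`:
`𝕏(f) = f ∂_x + (1/2) f' ξ ∂_ξ` and `𝕏(ξ g) = (1/2) g D` for `f, g ∈ ℂ[x]`. -/
def ham : SPoly →ₗ[ℂ] Module.End ℂ SPoly where
  toFun F := SPoly.mk F.fst 0 • dx
    + ((1 / 2 : ℂ) • (SPoly.mk (derivative F.fst) 0 * ξ)) • dξ
    + ((1 / 2 : ℂ) • SPoly.mk F.snd 0) • D
  map_add' F G := by
    refine LinearMap.ext fun H => SPoly.ext ?_ ?_ <;> simp [ξ, D, dx, dξ] <;> ring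
  map_smul' c F := by
    refine LinearMap.ext fun G => SPoly.ext ?_ ?_ <;> simp [ξ, D, dx, dξ] <;> ring

theorem ham_apply_fst (F G : SPoly) : (ham F G).fst =
    F.fst * derivative G.fst + C 2⁻¹ * F.snd * G.snd := by
  simp [ham, ξ, D, dx, dξ, mul_assoc]

theorem ham_apply_snd (F G : SPoly) : (ham F G).snd =
    F.fst * derivative G.snd + C 2⁻¹ * derivative F.fst * G.snd
      + C 2⁻¹ * F.snd * derivative G.fst := by
  simp [ham, ξ, D, dx, dξ, mul_assoc]

@[simp] theorem par_fst (F : SPoly) : (Superspace.par F).fst = F.fst := by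
  simp [Superspace.par]

@[simp] theorem par_snd (F : SPoly) : (Superspace.par F).snd = -F.snd := by
  simp [Superspace.par]

theorem par_end_apply {V : Type} [AddCommGroup V] [Module ℂ V] [Superspace V]
    (T : Module.End ℂ V) (v : V) :
    Superspace.par T v = Superspace.par (T (Superspace.par v)) := rfl

theorem superBracket_eq {V : Type} [AddCommGroup V] [Module ℂ V] [Superspace V]
    (S T : Module.End ℂ V) :
    superBracket S T = S * T - (1 / 2 : ℂ) • (T * S + T * Superspace.par S
      + Superspace.par T * S - Superspace.par T * Superspace.par S) := by
  have h : ∀ f : ZMod 2 → Module.End ℂ V, ∑ p : ZMod 2, f p = f 0 + f 1 :=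
    fun f => Fin.sum_univ_two f
  simp only [superBracket, h, mul_zero, mul_one, sgn_zero, sgn_one, part,
    LinearMap.smul_apply, LinearMap.add_apply, LinearMap.id_apply, one_smul, neg_smul,
    smul_mul_assoc, mul_smul_comm, add_mul, mul_add, smul_add, smul_neg]
  module

theorem dx_fst (F : SPoly) : (dx F).fst = derivative F.fst := by simp [dx]

theorem dx_snd (F : SPoly) : (dx F).snd = derivative F.snd := by simp [dx]

theorem dξ_fst (F : SPoly) : (dξ F).fst = F.snd := by simp [dξ]

theorem dξ_snd (F : SPoly) : (dξ F).snd = 0 := by simp [dξ]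

theorem D_fst (F : SPoly) : (D F).fst = F.snd := by simp [D, dξ, ξ]

theorem D_snd (F : SPoly) : (D F).snd = derivative F.fst := by simp [D, dξ, dx, ξ]

theorem Dbar_fst (F : SPoly) : (Dbar F).fst = F.snd := by simp [Dbar, dξ, ξ]

theorem Dbar_snd (F : SPoly) : (Dbar F).snd = -derivative F.fst := by simp [Dbar, dξ, dx, ξ]

/-- The contact bracket `{F, G} = F G' - F' G - (1/2) (-1)^{|G|} D(F) D(G)`. -/
def contactBracket (F G : SPoly) : SPoly :=
  F * dx G - dx F * G - (1 / 2 : ℂ) • (D F * D (Superspace.par G))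

theorem half_mul_two : (C (2⁻¹ : ℂ) : ℂ[X]) * 2 = 1 := by
  have h : (2 : ℂ[X]) = C 2 := (map_ofNat C 2).symm
  rw [h, ← C_mul, inv_mul_cancel₀ two_ne_zero, C_1]

theorem superBracket_fst (S T : Module.End ℂ SPoly) (H : SPoly) :
    (superBracket S T H).fst = (S (T H)).fst - C (2⁻¹ : ℂ) * ((T (S H)).fst
      + (T (Superspace.par (S (Superspace.par H)))).fst + (T (Superspace.par (S H))).fst
      - (T (S (Superspace.par H))).fst) := by
  rw [superBracket_eq]
  simp [par_end_apply, Superspace.par_par, -map_add, -map_sub]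

theorem superBracket_snd (S T : Module.End ℂ SPoly) (H : SPoly) :
    (superBracket S T H).snd = (S (T H)).snd - C (2⁻¹ : ℂ) * ((T (S H)).snd
      + (T (Superspace.par (S (Superspace.par H)))).snd - (T (Superspace.par (S H))).snd
      + (T (S (Superspace.par H))).snd) := by
  rw [superBracket_eq]
  simp [par_end_apply, Superspace.par_par]
  ring

theorem superBracket_ham (F G : SPoly) :
    superBracket (ham F) (ham G) = ham (contactBracket F G) := by
  have h2 := half_mul_two
  refine LinearMap.ext fun H => SPoly.ext ?_ ?_
  · simp [superBracket_fst, ham_apply_fst, ham_apply_snd, contactBracket, dx_fst, dx_snd, D_fst,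
      D_snd]
    generalize (C (2⁻¹ : ℂ) : ℂ[X]) = c at *
    grind
  · simp [superBracket_snd, ham_apply_fst, ham_apply_snd, contactBracket, dx_fst, dx_snd, D_fst,
      D_snd]
    generalize (C (2⁻¹ : ℂ) : ℂ[X]) = c at *
    grind

theorem par_ham (F : SPoly) : Superspace.par (ham F) = ham (Superspace.par F) := by
  refine LinearMap.ext fun H => SPoly.ext ?_ ?_
  · simp [ham_apply_fst, par_end_apply]
  · simp [ham_apply_snd, par_end_apply]
    ring

theorem ham_mem_contact (F : SPoly) : ham F ∈ contact := by
  have h2 := half_mul_two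
  refine ⟨?_, fun T hT => ?_⟩
  · refine Submodule.mem_span_pair.2 ⟨SPoly.mk F.fst 0
      + (1 / 2 : ℂ) • (SPoly.mk F.snd 0 * ξ),
      (1 / 2 : ℂ) • (SPoly.mk (derivative F.fst) 0 * ξ)
      + (1 / 2 : ℂ) • SPoly.mk F.snd 0, ?_⟩
    refine LinearMap.ext fun H => SPoly.ext ?_ ?_
    · simp [ham_apply_fst, dx_fst, dξ_fst, ξ]
    · simp [ham_apply_snd, dx_fst, dx_snd, dξ_fst, dξ_snd, ξ]
      ring
  · obtain ⟨K, rfl⟩ := Submodule.mem_span_singleton.1 hT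
    refine Submodule.mem_span_singleton.2 ⟨superBracket (ham F) (K • Dbar) ξ, ?_⟩
    refine LinearMap.ext fun H => SPoly.ext ?_ ?_
    · simp [superBracket_fst, ham_apply_fst, ham_apply_snd, Dbar_fst, Dbar_snd, ξ]
      generalize (C (2⁻¹ : ℂ) : ℂ[X]) = c at *
      grind
    · simp [superBracket_fst, superBracket_snd, ham_apply_fst, ham_apply_snd, Dbar_fst, Dbar_snd,
        ξ]
      generalize (C (2⁻¹ : ℂ) : ℂ[X]) = c at *
      grind

theorem exists_ham_eq (S : Module.End ℂ SPoly) (hS : S ∈ contact) : ∃ F, ham F = S := by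
  have h2 := half_mul_two
  obtain ⟨G, H, rfl⟩ := Submodule.mem_span_pair.1 hS.1
  set F : SPoly := SPoly.mk G.fst (2 * G.snd) with hF
  refine ⟨F, ?_⟩
  have h1 := (sub_mem hS (ham_mem_contact F)).2 Dbar (Submodule.mem_span_singleton_self _)
  obtain ⟨K, hK⟩ := Submodule.mem_span_singleton.1 h1
  have e1 := congrArg SPoly.fst (LinearMap.congr_fun hK x)
  have e2 := congrArg SPoly.snd (LinearMap.congr_fun hK x)
  have e3 := congrArg SPoly.fst (LinearMap.congr_fun hK ξ)
  have e4 := congrArg SPoly.snd (LinearMap.congr_fun hK ξ)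
  simp [superBracket_fst, superBracket_snd, ham_apply_fst, ham_apply_snd,
       Dbar_fst, Dbar_snd, ξ, x, -one_div,
        dx_fst, dx_snd, dξ_fst, dξ_snd, hF] at e1 e2 e3 e4
  refine LinearMap.ext fun A => SPoly.ext ?_ ?_
  · simp [ham_apply_fst, dx_fst, dξ_fst, hF]
    generalize (C (2⁻¹ : ℂ) : ℂ[X]) = c at *
    grind
  · simp [ham_apply_snd, dx_fst, dx_snd, dξ_fst, dξ_snd, hF]
    generalize (C (2⁻¹ : ℂ) : ℂ[X]) = c at *
    grind

theorem ham_injective : Function.Injective ham := by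
  have h2 := half_mul_two
  intro F G h
  have e1 := congrArg SPoly.fst (LinearMap.congr_fun h x)
  have e2 := congrArg SPoly.snd (LinearMap.congr_fun h x)
  simp [ham_apply_fst, ham_apply_snd, x] at e1 e2
  refine SPoly.ext ?_ ?_
  · simp [e1]
  · simp [e2]

/-- The linear isomorphism `𝕏` from contact Hamiltonians to contact vector fields. -/
def hamEquiv : SPoly ≃ₗ[ℂ] contact :=
  LinearEquiv.ofBijective (ham.codRestrict contact ham_mem_contact)
    ⟨fun F G h => ham_injective (congrArg Subtype.val h), fun S => by
      obtain ⟨F, hF⟩ := exists_ham_eq S.1 S.2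
      exact ⟨F, Subtype.ext hF⟩⟩

@[simp] theorem coe_hamEquiv (F : SPoly) : (hamEquiv F : Module.End ℂ SPoly) = ham F := rfl

theorem par_mem_contact {S : Module.End ℂ SPoly} (hS : S ∈ contact) :
    Superspace.par S ∈ contact := by
  obtain ⟨F, rfl⟩ := exists_ham_eq S hS
  rw [par_ham]
  exact ham_mem_contact _

theorem superBracket_mem_contact {S T : Module.End ℂ SPoly} (hS : S ∈ contact)
    (hT : T ∈ contact) : superBracket S T ∈ contact := by
  obtain ⟨F, rfl⟩ := exists_ham_eq S hS
  obtain ⟨G, rfl⟩ := exists_ham_eq T hT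
  rw [superBracket_ham]
  exact ham_mem_contact _

instance : Superspace contact where
  par := Superspace.par.restrict fun _ hS => par_mem_contact hS
  par_par := fun S => Subtype.ext (Superspace.par_par S.1)

/-- The superbracket of contact vector fields. -/
def br (S T : contact) : contact := ⟨superBracket S.1 T.1, superBracket_mem_contact S.2 T.2⟩

/-- The basis vectors `e_{n-1} = 𝕏(x^n)`. -/
def eEven (n : ℕ) : contact := hamEquiv (x ^ n)

/-- The basis vectors `e_{n-1/2} = 2 𝕏(ξ x^n)`. -/
def eOdd (n : ℕ) : contact := (2 : ℂ) • hamEquiv (ξ * x ^ n)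

/-- The nilradical `𝔲 = span {e_{-1}, e_{-1/2}}` of the affine subalgebra. -/
def nilradical : Submodule ℂ contact := Submodule.span ℂ {eEven 0, eOdd 0}

/-- The affine subalgebra `𝔱 = span {e_{-1}, e_{-1/2}, e_0}`. -/
def affine : Submodule ℂ contact := Submodule.span ℂ {eEven 0, eOdd 0, eEven 1}

/-- The conformal subalgebra `𝔰 = span {e_{-1}, e_{-1/2}, e_0, e_{1/2}, e_1}`. -/
def conformal : Submodule ℂ contact :=
  Submodule.span ℂ {eEven 0, eOdd 0, eEven 1, eOdd 1, eEven 2}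

/-- The action of the contact vector fields on the tensor density module
`𝔽(lam) = ℂ[x, ξ] ω^lam`, where `ω^lam G` is written as `G`:
the field `𝕏(F)` sends `G` to `𝕏(F)(G) + lam F' G`. -/
def density (lam : ℂ) : contact →ₗ[ℂ] Module.End ℂ SPoly where
  toFun S := S.1 + lam • LinearMap.mulLeft ℂ (dx (hamEquiv.symm S))
  map_add' S T := by
    ext G : 1
    simp only [Submodule.coe_add, map_add, LinearMap.add_apply, LinearMap.smul_apply,
      LinearMap.mulLeft_apply, add_mul, smul_add]
    abel
  map_smul' c S := by
    ext G : 1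
    simp [smul_smul, mul_comm]

/-! ### Cohomology -/

/-- The `n`-linear maps from contact vector fields to the space of densities. -/
abbrev Cochain (n : ℕ) : Type := MultilinearMap ℂ (fun _ : Fin n => contact) SPoly

/-- The tuple `S` consists of homogeneous elements, `S i` of parity `p i`. -/
def IsHomogeneous {n : ℕ} (p : Fin n → ZMod 2) (S : Fin n → contact) : Prop :=
  ∀ i, HasParity (p i) (S i)

/-- The cochain `φ` has parity `a`. -/
def CochainParity {n : ℕ} (a : ZMod 2) (φ : Cochain n) : Prop :=
  ∀ p S, IsHomogeneous p S → HasParity (a + ∑ i, p i) (φ S)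

/-- The cochain `φ` is superalternating, that is, it factors through the `n`-th superexterior
power: exchanging neighbouring arguments of parities `p` and `q` multiplies it
by `-(-1)^{p q}`. -/
def IsSuperalternating {n : ℕ} (φ : Cochain n) : Prop :=
  ∀ p S, IsHomogeneous p S → ∀ (i : ℕ) (hi : i + 1 < n),
    φ (S ∘ Equiv.swap ⟨i, Nat.lt_of_succ_lt hi⟩ ⟨i + 1, hi⟩)
      = -sgn (p ⟨i, Nat.lt_of_succ_lt hi⟩ * p ⟨i + 1, hi⟩) • φ S

/-- The power `ε^p` of the parity endomorphism. -/
def parPow (p : ZMod 2) : SPoly →ₗ[ℂ] SPoly := if p = 0 then LinearMap.id else Superspace.par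

/-- The cochain `φ` is annihilated by the natural action of the elements of `h`: for homogeneous
`T ∈ h` and `S_1, …, S_n`,
`T φ(S_1, …, S_n) = ∑_j (-1)^{|T|(|φ| + |S_1| + ⋯ + |S_{j-1}|)} φ(S_1, …, [T, S_j], …, S_n)`.
As `φ(S_1, …, S_n)` has parity `|φ| + |S_1| + ⋯ + |S_n|`, the sign `(-1)^{|T||φ|}` is expressed
by the parity endomorphism of the values, which makes sense for inhomogeneous `φ` too. -/
def IsInvariant (lam : ℂ) (h : Submodule ℂ contact) {n : ℕ} (φ : Cochain n) : Prop :=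
  ∀ p S, IsHomogeneous p S → ∀ q, ∀ T ∈ h, HasParity q T →
    sgn (q * ∑ i, p i) • density lam T (parPow q (φ S))
      = ∑ j, sgn (q * ∑ k ∈ Finset.Iio j, p k) • φ (Function.update S j (br T (S j)))

/-- The value of the coboundary `∂φ` at the homogeneous elements `S_0, …, S_n` of parities
`p_0, …, p_n`:
`∑_i (-1)^{i + p_i (|φ| + p_0 + ⋯ + p_{i-1})} S_i φ(S_0, …, Ŝ_i, …, S_n)
  - ∑_{i<j} (-1)^{i + p_i (p_{i+1} + ⋯ + p_{j-1})} φ(S_0, …, Ŝ_i, …, [S_i, S_j], …, S_n)`.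
The first sign is written without `|φ|` as in the definition of invariance; see the theorem
`coboundary_of_parity`. -/
def coboundary (lam : ℂ) {n : ℕ} (φ : Cochain n) (p : Fin (n + 1) → ZMod 2)
    (S : Fin (n + 1) → contact) : SPoly :=
  ∑ i : Fin (n + 1), ((-1) ^ (i : ℕ) * sgn (p i * ∑ k ∈ Finset.Ioi i, p k)) •
      density lam (S i) (parPow (p i) (φ fun k => S (i.succAbove k)))
    - ∑ i : Fin (n + 1), ∑ j ∈ Finset.Ioi i, ((-1) ^ (i : ℕ) * sgn (p i * ∑ k ∈ Finset.Ioo i j, p k)) •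
      φ fun k => Function.update S j (br (S i) (S j)) (i.succAbove k)

theorem coboundary_add (lam : ℂ) {n : ℕ} (φ ψ : Cochain n) (p : Fin (n + 1) → ZMod 2)
    (S : Fin (n + 1) → contact) :
    coboundary lam (φ + ψ) p S = coboundary lam φ p S + coboundary lam ψ p S := by
  simp only [coboundary, add_apply, map_add, smul_add, Finset.sum_add_distrib]
  abel

theorem coboundary_smul (lam : ℂ) {n : ℕ} (c : ℂ) (φ : Cochain n) (p : Fin (n + 1) → ZMod 2)
    (S : Fin (n + 1) → contact) :
    coboundary lam (c • φ) p S = c • coboundary lam φ p S := by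
  simp only [coboundary, smul_apply, map_smul, smul_sub, Finset.smul_sum,
    smul_comm c]

theorem sgn_add (a b : ZMod 2) : sgn (a + b) = sgn a * sgn b := by
  have h : (1 : ZMod 2) + 1 = 0 := by decide
  have h' : ∀ c : ZMod 2, c = 0 ∨ c = 1 := by decide
  obtain rfl | rfl := h' a <;> obtain rfl | rfl := h' b <;> simp [h]

theorem parPow_eq {a : ZMod 2} {F : SPoly} (hF : HasParity a F) (p : ZMod 2) :
    parPow p F = sgn (p * a) • F := by
  have h' : ∀ c : ZMod 2, c = 0 ∨ c = 1 := by decide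
  obtain rfl | rfl := h' p
  · simp [parPow]
  · simpa [parPow, HasParity] using hF

/-- For a cochain of parity `a` the coboundary is given by the formula with the sign
`(-1)^{i + p_i (a + p_0 + ⋯ + p_{i-1})}`. -/
theorem coboundary_of_parity (lam : ℂ) {n : ℕ} {a : ZMod 2} {φ : Cochain n}
    (hφ : CochainParity a φ) {p : Fin (n + 1) → ZMod 2} {S : Fin (n + 1) → contact}
    (hS : IsHomogeneous p S) :
    coboundary lam φ p S =
      ∑ i : Fin (n + 1), ((-1) ^ (i : ℕ) * sgn (p i * (a + ∑ k ∈ Finset.Iio i, p k))) •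
        density lam (S i) (φ fun k => S (i.succAbove k))
      - ∑ i : Fin (n + 1), ∑ j ∈ Finset.Ioi i, ((-1) ^ (i : ℕ) * sgn (p i * ∑ k ∈ Finset.Ioo i j, p k)) •
        φ fun k => Function.update S j (br (S i) (S j)) (i.succAbove k) := by
  unfold coboundary
  refine congrArg₂ (· - ·) (Finset.sum_congr rfl fun i _ => ?_) rfl
  have h1 := hφ (fun k => p (i.succAbove k)) (fun k => S (i.succAbove k)) fun k => hS _
  rw [parPow_eq h1, map_smul, smul_smul, mul_assoc, ← sgn_add]
  congr 3
  have h2 := Fin.sum_univ_succAbove p i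
  have h3 : ∑ k, p k = ∑ k ∈ Finset.Iio i, p k + p i + ∑ k ∈ Finset.Ioi i, p k := by
    rw [← Finset.sum_filter_add_sum_filter_not Finset.univ (fun k => k ≤ i) p]
    congr 1
    · have h4 : Finset.univ.filter (fun k => k ≤ i) = insert i (Finset.Iio i) := by
        ext k; simp [le_iff_eq_or_lt]
      rw [h4, Finset.sum_insert (by simp), add_comm]
    · congr 1; ext k; simp
  have h5 : ∑ k, p (i.succAbove k) = ∑ k ∈ Finset.Iio i, p k + ∑ k ∈ Finset.Ioi i, p k :=
    add_left_cancel (a := p i) (by rw [← h2, h3]; ring)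
  have h6 : ∀ b c d : ZMod 2, b * d + b * (a + (c + d)) = b * (a + c) := by
    clear h1 hφ
    revert a
    decide
  rw [h5]
  exact h6 _ _ _

/-- The space `C^n(K, h, 𝔽(lam))` of `h`-relative cochains: the superalternating maps which
are annihilated by the contractions with elements of `h` and are `h`-invariant. For `h = ⊥` these
are all superalternating maps. -/
def relCochains (lam : ℂ) (h : Submodule ℂ contact) (n : ℕ) : Submodule ℂ (Cochain n) where
  carrier := {φ | IsSuperalternating φ ∧ (∀ S i, S i ∈ h → φ S = 0) ∧ IsInvariant lam h φ}
  zero_mem' := by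
    refine ⟨fun p S _ i hi => by simp, fun S i _ => rfl, fun p S _ q T _ _ => by simp⟩
  add_mem' := by
    rintro φ ψ ⟨h1, h2, h3⟩ ⟨k1, k2, k3⟩
    refine ⟨fun p S hS i hi => ?_, fun S i hi => ?_, fun p S hS q T hT hq => ?_⟩
    · simp only [add_apply, h1 p S hS i hi, k1 p S hS i hi, smul_add]
    · simp only [add_apply, h2 S i hi, k2 S i hi, add_zero]
    · simp only [add_apply, map_add, smul_add, Finset.sum_add_distrib,
        h3 p S hS q T hT hq, k3 p S hS q T hT hq]
  smul_mem' := by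
    rintro c φ ⟨h1, h2, h3⟩
    refine ⟨fun p S hS i hi => ?_, fun S i hi => ?_, fun p S hS q T hT hq => ?_⟩
    · simp only [smul_apply, h1 p S hS i hi]
      exact smul_comm _ _ _
    · simp only [smul_apply, h2 S i hi, smul_zero]
    · simp only [smul_apply, map_smul]
      rw [smul_comm _ c, h3 p S hS q T hT hq, Finset.smul_sum]
      exact Finset.sum_congr rfl fun j _ => smul_comm _ _ _

/-- The `h`-relative cocycles. -/
def cocycles (lam : ℂ) (h : Submodule ℂ contact) (n : ℕ) : Submodule ℂ (Cochain n) where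
  carrier := {φ | φ ∈ relCochains lam h n ∧
    ∀ p S, IsHomogeneous p S → coboundary lam φ p S = 0}
  zero_mem' := ⟨zero_mem _, fun p S _ => by
    simpa using coboundary_smul lam 0 (0 : Cochain n) p S⟩
  add_mem' := fun hφ hψ => ⟨add_mem hφ.1 hψ.1, fun p S hS => by
    rw [coboundary_add, hφ.2 p S hS, hψ.2 p S hS, add_zero]⟩
  smul_mem' := fun c φ hφ => ⟨Submodule.smul_mem _ c hφ.1, fun p S hS => by
    rw [coboundary_smul, hφ.2 p S hS, smul_zero]⟩

/-- The `h`-relative coboundaries: the coboundaries of the `h`-relative cochains of one degree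
less. -/
def coboundaries (lam : ℂ) (h : Submodule ℂ contact) : (n : ℕ) → Submodule ℂ (Cochain n)
  | 0 => ⊥
  | n + 1 =>
    { carrier := {ψ | ψ ∈ relCochains lam h (n + 1) ∧ ∃ φ ∈ relCochains lam h n,
        ∀ p S, IsHomogeneous p S → ψ S = coboundary lam φ p S}
      zero_mem' := ⟨zero_mem _, 0, zero_mem _, fun p S _ => by
        simpa using (coboundary_smul lam 0 (0 : Cochain n) p S).symm⟩
      add_mem' := by
        rintro ψ ψ' ⟨h1, φ, h2, h3⟩ ⟨k1, φ', k2, k3⟩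
        refine ⟨add_mem h1 k1, φ + φ', add_mem h2 k2, fun p S hS => ?_⟩
        rw [coboundary_add, add_apply, h3 p S hS, k3 p S hS]
      smul_mem' := by
        rintro c ψ ⟨h1, φ, h2, h3⟩
        refine ⟨Submodule.smul_mem _ c h1, c • φ, Submodule.smul_mem _ c h2, fun p S hS => ?_⟩
        rw [coboundary_smul, smul_apply, h3 p S hS] }

/-- The relative cohomology `H^n(K, h, 𝔽(lam))`, the quotient of the cocycles by the coboundaries.
The absolute cohomology `H^n(K, 𝔽(lam))` is the case `h = ⊥`. -/
abbrev Cohomology (lam : ℂ) (h : Submodule ℂ contact) (n : ℕ) : Type :=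
  cocycles lam h n ⧸ (coboundaries lam h n).submoduleOf (cocycles lam h n)

/-- The cohomology class of a cocycle. -/
def cls {lam : ℂ} {h : Submodule ℂ contact} {n : ℕ} {φ : Cochain n}
    (hφ : φ ∈ cocycles lam h n) : Cohomology lam h n :=
  Submodule.Quotient.mk ⟨φ, hφ⟩

/-- The absolute class of the cocycle `φ` is `h`-relative: it contains an `h`-relative cocycle. -/
def IsRelativeClass (lam : ℂ) (h : Submodule ℂ contact) {n : ℕ} (φ : Cochain n) : Prop :=
  ∃ ψ ∈ cocycles lam h n, φ - ψ ∈ coboundaries lam ⊥ n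

/-! ### The distinguished classes -/

/-- The constant `1` as a `0`-cochain. -/
def oneCochain : Cochain 0 := MultilinearMap.constOfIsEmpty ℂ _ 1

/-- The composition of `𝕏⁻¹`, with values in `𝔽(-1)`, with the affine super Bol operator
`ω^{k/2} D̄^k` from `𝔽(-1)` to `𝔽(k/2 - 1)`. -/
def bolMap (k : ℕ) : contact →ₗ[ℂ] SPoly := (Dbar ^ k) ∘ₗ hamEquiv.symm.toLinearMap

/-- A linear map as a `1`-cochain. -/
def oneForm (A : contact →ₗ[ℂ] SPoly) : Cochain 1 :=
  MultilinearMap.ofSubsingleton ℂ contact SPoly (0 : Fin 1) A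

/-- The map underlying the `𝔽(0)`-valued cochain `θ`, which is even. -/
def thetaMap : contact →ₗ[ℂ] SPoly := bolMap 2

/-- The map underlying the `𝔽(1/2)`-valued cochain `α`, which is odd. -/
def alphaMap : contact →ₗ[ℂ] SPoly := bolMap 3

/-- The map underlying the `𝔽(3/2)`-valued cochain `β`, which is odd. -/
def betaMap : contact →ₗ[ℂ] SPoly := bolMap 5

/-- The `𝔽(0)`-valued `1`-cochain `θ`. -/
def theta : Cochain 1 := oneForm thetaMap

/-- The `𝔽(1/2)`-valued `1`-cochain `α`. -/
def alpha : Cochain 1 := oneForm alphaMap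

/-- The `𝔽(3/2)`-valued `1`-cochain `β`. -/
def beta : Cochain 1 := oneForm betaMap

/-- The cup product of `1`-cochains `A` and `B`, where `B` has parity `b`, with respect to the
multiplication of densities: for homogeneous `S` and `T`,
`(A ∪ B)(S, T) = (-1)^{|S| b} A(S) B(T) - (-1)^{|T| (|S| + b)} A(T) B(S)`. -/
def cup (b : ZMod 2) (A B : contact →ₗ[ℂ] SPoly) : Cochain 2 where
  toFun S := ∑ p : ZMod 2, ∑ q : ZMod 2,
    (sgn (p * b) • (A (part p (S 0)) * B (part q (S 1)))
      - sgn (q * (p + b)) • (A (part q (S 1)) * B (part p (S 0))))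
  map_update_add' S i T U := by
    rw [← Finset.sum_add_distrib]
    refine Finset.sum_congr rfl fun p _ => ?_
    rw [← Finset.sum_add_distrib]
    refine Finset.sum_congr rfl fun q _ => ?_
    fin_cases i <;> simp [add_mul, mul_add] <;> abel
  map_update_smul' S i c T := by
    rw [Finset.smul_sum]
    refine Finset.sum_congr rfl fun p _ => ?_
    rw [Finset.smul_sum]
    refine Finset.sum_congr rfl fun q _ => ?_
    fin_cases i <;> simp [smul_sub, smul_comm c]

end ContactSuperline

namespace ContactSuperline

/-! The density module behaves as if coinduced from the subalgebra of fields vanishing at the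
origin, so its cohomology can be computed by a Shapiro-type reduction. The field e_{-1/2} acts on
densities by `D`, which is onto with kernel the constants (`exists_D_eq`, `eq_zero_of_D_eq_zero`).
Surjectivity lets a coboundary cancel the contraction of a cocycle with e_{-1/2}, and the constants
of integration remain free (`exists_oneCoboundary_contraction`). Injectivity modulo constants then
shows that a cocycle with vanishing contraction is determined by its values at the origin
(`cocycle_one_eq_zero`, `cocycle_two_eq_zero`).

In `fieldBasis` the bracket of the fields n and k is a multiple of the field n + k - 2. At the
origin the fields n ≥ 3 act by zero and the field 2, which is 2 e_0, acts by 2λ. The origin values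
therefore satisfy scalar cocycle equations, and the Euler field confines them to n = 2λ + 2 in
degree one and to k + l = 2λ + 4 in degree two. In degree one the brackets of fields n ≥ 3 reach
every index n ≥ 3 except 3 and 5; with the Euler field itself this leaves θ, α, β. In degree two, as
long as k + l ≤ 10, the scalar equations and the remaining constants of integration kill everything
except the pairs (2,3), (2,5) and (5,5) (`exists_normalized`, `originValue_eq_zero_of_le`,
`originValue_two_eq_zero`). At the origin the Bol map of order k is dual to the field k
(`evalOrigin_bolMap`), so θ∪α, θ∪β and β∪β realize these three pairs. The other cup products lie in
weights where the cohomology vanishes.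

Non-triviality is also read off at the origin. A coboundary vanishes on (2, 2λ + 2) and takes equal
values on two pairs of odd fields with the same index sum; the latter settles β∪β and `weightFive`.

For conformally relative cocycles, the cocycle equation with the field 3 is a two-term recursion
with nonzero coefficients (`conformal_step`). Hence at most one dimension survives for each λ.
Supersymmetry removes the index sums congruent to 0 and 3 modulo 4, one further equation removes 13,
and the sums 10 and 14 are realized by β∪β and `weightFive`. -/

theorem parity_cases (p : ZMod 2) : p = 0 ∨ p = 1 := by
  revert p; decide

theorem one_add_one_parity : (1 : ZMod 2) + 1 = 0 := by decide

theorem C_half_mul (f : ℂ[X]) : C (2⁻¹ : ℂ) * (2 * f) = f := by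
  rw [← mul_assoc, half_mul_two, one_mul]

theorem C_two : (C (2 : ℂ) : ℂ[X]) = 2 := map_ofNat C 2

theorem two_mul_C_half (f : ℂ[X]) : 2 * (C (2⁻¹ : ℂ) * f) = f := by
  rw [mul_left_comm, C_half_mul]

/-! ### Polynomial coordinates, brackets and the density action -/

/-- The linear isomorphism sending `(f, g)` to `𝕏(2 f + 2 ξ g)`. -/
def fieldEquiv : (ℂ[X] × ℂ[X]) ≃ₗ[ℂ] contact :=
  LinearEquiv.trans
    { toFun := fun u => SPoly.mk (2 * u.1) (2 * u.2)
      invFun := fun F => (C (2⁻¹ : ℂ) * F.fst, C (2⁻¹ : ℂ) * F.snd)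
      map_add' := fun u v => by refine SPoly.ext ?_ ?_ <;> simp [mul_add]
      map_smul' := fun c u => by refine SPoly.ext ?_ ?_ <;> simp [smul_eq_C_mul, mul_left_comm]
      left_inv := fun u => by simp [C_half_mul]
      right_inv := fun F => by refine SPoly.ext ?_ ?_ <;> simp [two_mul_C_half] }
    hamEquiv

/-- The even contact field `𝕏(2 f)`. -/
def evenField : ℂ[X] →ₗ[ℂ] contact := fieldEquiv.toLinearMap ∘ₗ LinearMap.inl ℂ ℂ[X] ℂ[X]

/-- The odd contact field `𝕏(2 ξ g)`. -/
def oddField : ℂ[X] →ₗ[ℂ] contact := fieldEquiv.toLinearMap ∘ₗ LinearMap.inr ℂ ℂ[X] ℂ[X]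

theorem evenField_eq (f : ℂ[X]) : evenField f = hamEquiv (SPoly.mk (2 * f) 0) := by
  simp [evenField, fieldEquiv]

theorem oddField_eq (f : ℂ[X]) : oddField f = hamEquiv (SPoly.mk 0 (2 * f)) := by
  simp [oddField, fieldEquiv]

theorem par_hamEquiv (F : SPoly) :
    Superspace.par (hamEquiv F) = hamEquiv (Superspace.par F) :=
  Subtype.ext (par_ham F)

theorem br_hamEquiv (F G : SPoly) :
    br (hamEquiv F) (hamEquiv G) = hamEquiv (contactBracket F G) :=
  Subtype.ext (superBracket_ham F G)

theorem hasParity_evenField (f : ℂ[X]) : HasParity 0 (evenField f) := by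
  rw [HasParity, evenField_eq, par_hamEquiv, sgn_zero, one_smul]
  congr 1
  refine SPoly.ext ?_ ?_ <;> simp

theorem hasParity_oddField (f : ℂ[X]) : HasParity 1 (oddField f) := by
  rw [HasParity, oddField_eq, par_hamEquiv, sgn_one, ← map_smul]
  congr 1
  refine SPoly.ext ?_ ?_ <;> simp

theorem eq_neg_self_poly {f : ℂ[X]} (h : f = -f) : f = 0 := self_eq_neg.1 h

theorem exists_evenField {S : contact} (hS : HasParity 0 S) : ∃ f, S = evenField f := by
  obtain ⟨F, rfl⟩ := hamEquiv.surjective S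
  rw [HasParity, par_hamEquiv, sgn_zero, one_smul] at hS
  have h := congrArg SPoly.snd (hamEquiv.injective hS)
  rw [par_snd] at h
  refine ⟨C (2⁻¹ : ℂ) * F.fst, ?_⟩
  rw [evenField_eq, two_mul_C_half]
  congr 1
  refine SPoly.ext ?_ ?_
  · simp
  · simpa using eq_neg_self_poly h.symm

theorem exists_oddField {S : contact} (hS : HasParity 1 S) : ∃ f, S = oddField f := by
  obtain ⟨F, rfl⟩ := hamEquiv.surjective S
  rw [HasParity, par_hamEquiv, sgn_one, ← map_smul] at hS
  have h := congrArg SPoly.fst (hamEquiv.injective hS)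
  rw [par_fst] at h
  refine ⟨C (2⁻¹ : ℂ) * F.snd, ?_⟩
  rw [oddField_eq, two_mul_C_half]
  congr 1
  refine SPoly.ext ?_ ?_
  · simpa using eq_neg_self_poly (by simpa using h)
  · simp

theorem contactBracket_fst (F G : SPoly) : (contactBracket F G).fst =
    F.fst * derivative G.fst - derivative F.fst * G.fst + C (2⁻¹ : ℂ) * (F.snd * G.snd) := by
  simp [contactBracket, dx_fst, D_fst]

theorem contactBracket_snd (F G : SPoly) : (contactBracket F G).snd =
    F.fst * derivative G.snd + F.snd * derivative G.fst - derivative F.fst * G.snd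
      - derivative F.snd * G.fst
      - C (2⁻¹ : ℂ) * (F.snd * derivative G.fst - derivative F.fst * G.snd) := by
  simp [contactBracket, dx_fst, dx_snd, D_fst, D_snd]
  ring

theorem br_even_even (f g : ℂ[X]) : br (evenField f) (evenField g) =
    evenField (2 * (f * derivative g - derivative f * g)) := by
  rw [evenField_eq, evenField_eq, evenField_eq, br_hamEquiv]
  congr 1
  refine SPoly.ext ?_ ?_
  · simp [contactBracket_fst]
    ring
  · simp [contactBracket_snd]

theorem br_even_odd (f g : ℂ[X]) : br (evenField f) (oddField g) =
    oddField (2 * (f * derivative g) - derivative f * g) := by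
  rw [evenField_eq, oddField_eq, oddField_eq, br_hamEquiv]
  congr 1
  have h := half_mul_two
  refine SPoly.ext ?_ ?_
  · simp [contactBracket_fst]
  · simp [contactBracket_snd]
    linear_combination (2 * derivative f * g) * h

theorem br_odd_even (f g : ℂ[X]) : br (oddField f) (evenField g) =
    oddField (f * derivative g - 2 * (derivative f * g)) := by
  rw [evenField_eq, oddField_eq, oddField_eq, br_hamEquiv]
  congr 1
  have h := half_mul_two
  refine SPoly.ext ?_ ?_
  · simp [contactBracket_fst]
  · simp [contactBracket_snd]
    linear_combination (-2 * derivative g * f) * h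

/-- The doubling in `fieldEquiv` is chosen so that this bracket is the bare product. All structure
constants between odd basis fields are then 1, which the later arguments use constantly. -/
theorem br_odd_odd (f g : ℂ[X]) : br (oddField f) (oddField g) = evenField (f * g) := by
  rw [evenField_eq, oddField_eq, oddField_eq, br_hamEquiv]
  congr 1
  have h := half_mul_two
  refine SPoly.ext ?_ ?_
  · simp [contactBracket_fst]
    linear_combination (2 * f * g) * h
  · simp [contactBracket_snd]

theorem density_hamEquiv (lam : ℂ) (F G : SPoly) :
    density lam (hamEquiv F) G = ham F G + lam • (dx F * G) := by
  simp [density]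

theorem density_even_fst (lam : ℂ) (f : ℂ[X]) (G : SPoly) :
    (density lam (evenField f) G).fst =
      2 * (f * derivative G.fst) + C (2 * lam) * (derivative f * G.fst) := by
  rw [evenField_eq, density_hamEquiv]
  simp [ham_apply_fst, dx_fst, C_two]
  ring

theorem density_even_snd (lam : ℂ) (f : ℂ[X]) (G : SPoly) :
    (density lam (evenField f) G).snd =
      2 * (f * derivative G.snd) + derivative f * G.snd
        + C (2 * lam) * (derivative f * G.snd) := by
  rw [evenField_eq, density_hamEquiv]
  simp [ham_apply_snd, dx_fst, dx_snd, C_two]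
  linear_combination (derivative f * G.snd) * half_mul_two

theorem density_odd_fst (lam : ℂ) (f : ℂ[X]) (G : SPoly) :
    (density lam (oddField f) G).fst = f * G.snd := by
  rw [oddField_eq, density_hamEquiv]
  simp [ham_apply_fst, dx_fst, C_half_mul]

theorem density_odd_snd (lam : ℂ) (f : ℂ[X]) (G : SPoly) :
    (density lam (oddField f) G).snd =
      f * derivative G.fst + C (2 * lam) * (derivative f * G.fst) := by
  rw [oddField_eq, density_hamEquiv]
  simp [ham_apply_snd, dx_fst, dx_snd, C_two]
  linear_combination (f * derivative G.fst) * half_mul_two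

theorem bolMap_hamEquiv (k : ℕ) (F : SPoly) : bolMap k (hamEquiv F) = (Dbar ^ k) F := by
  simp [bolMap]

theorem hasParity_br {p q : ZMod 2} {S T : contact} (hS : HasParity p S) (hT : HasParity q T) :
    HasParity (p + q) (br S T) := by
  obtain rfl | rfl := parity_cases p <;> obtain rfl | rfl := parity_cases q
  · obtain ⟨f, rfl⟩ := exists_evenField hS
    obtain ⟨g, rfl⟩ := exists_evenField hT
    rw [br_even_even]; exact hasParity_evenField _
  · obtain ⟨f, rfl⟩ := exists_evenField hS
    obtain ⟨g, rfl⟩ := exists_oddField hT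
    rw [br_even_odd]; exact hasParity_oddField _
  · obtain ⟨f, rfl⟩ := exists_oddField hS
    obtain ⟨g, rfl⟩ := exists_evenField hT
    rw [br_odd_even]; exact hasParity_oddField _
  · obtain ⟨f, rfl⟩ := exists_oddField hS
    obtain ⟨g, rfl⟩ := exists_oddField hT
    rw [br_odd_odd]; exact hasParity_evenField _

theorem br_comm {p q : ZMod 2} {S T : contact} (hS : HasParity p S) (hT : HasParity q T) :
    br T S = -sgn (p * q) • br S T := by
  obtain rfl | rfl := parity_cases p <;> obtain rfl | rfl := parity_cases q
  · obtain ⟨f, rfl⟩ := exists_evenField hS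
    obtain ⟨g, rfl⟩ := exists_evenField hT
    simp only [br_even_even, mul_zero, sgn_zero, ← map_smul]
    congr 1
    rw [neg_smul, one_smul]; ring
  · obtain ⟨f, rfl⟩ := exists_evenField hS
    obtain ⟨g, rfl⟩ := exists_oddField hT
    simp only [br_even_odd, br_odd_even, zero_mul, sgn_zero, ← map_smul]
    congr 1
    rw [neg_smul, one_smul]; ring
  · obtain ⟨f, rfl⟩ := exists_oddField hS
    obtain ⟨g, rfl⟩ := exists_evenField hT
    simp only [br_even_odd, br_odd_even, mul_zero, sgn_zero, ← map_smul]
    congr 1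
    rw [neg_smul, one_smul]; ring
  · obtain ⟨f, rfl⟩ := exists_oddField hS
    obtain ⟨g, rfl⟩ := exists_oddField hT
    simp only [br_odd_odd, mul_one, sgn_one, ← map_smul]
    congr 1
    rw [neg_neg, one_smul]; ring

theorem br_jacobi {p q r : ZMod 2} {S T U : contact} (hS : HasParity p S) (hT : HasParity q T)
    (hU : HasParity r U) :
    br S (br T U) = br (br S T) U + sgn (p * q) • br T (br S U) := by
  obtain rfl | rfl := parity_cases p <;> obtain rfl | rfl := parity_cases q <;>
    obtain rfl | rfl := parity_cases r <;>
    first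
      | obtain ⟨f, rfl⟩ := exists_evenField hS
      | obtain ⟨f, rfl⟩ := exists_oddField hS
  all_goals
    first
      | obtain ⟨g, rfl⟩ := exists_evenField hT
      | obtain ⟨g, rfl⟩ := exists_oddField hT
  all_goals
    first
      | obtain ⟨h, rfl⟩ := exists_evenField hU
      | obtain ⟨h, rfl⟩ := exists_oddField hU
  all_goals
    simp only [br_even_even, br_even_odd, br_odd_even, br_odd_odd, mul_zero, mul_one,
      sgn_zero, sgn_one, ← map_smul, ← map_add]
    congr 1
    simp only [one_smul, neg_smul, derivative_mul, derivative_sub, derivative_ofNat]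
    ring

theorem density_br (lam : ℂ) {p q : ZMod 2} {S T : contact} (hS : HasParity p S)
    (hT : HasParity q T) (G : SPoly) :
    density lam (br S T) G = density lam S (density lam T G)
      - sgn (p * q) • density lam T (density lam S G) := by
  obtain rfl | rfl := parity_cases p <;> obtain rfl | rfl := parity_cases q <;>
    first
      | obtain ⟨f, rfl⟩ := exists_evenField hS
      | obtain ⟨f, rfl⟩ := exists_oddField hS
  all_goals
    first
      | obtain ⟨g, rfl⟩ := exists_evenField hT
      | obtain ⟨g, rfl⟩ := exists_oddField hT
  all_goals
    simp only [br_even_even, br_even_odd, br_odd_even, br_odd_odd, mul_zero, mul_one,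
      sgn_zero, sgn_one, neg_smul, one_smul]
    refine SPoly.ext ?_ ?_ <;>
    simp only [SPoly.fst_sub, SPoly.snd_sub, SPoly.fst_neg, SPoly.snd_neg,
      density_even_fst, density_even_snd, density_odd_fst, density_odd_snd,
      derivative_mul, derivative_sub, derivative_add, derivative_ofNat, derivative_C]
    <;> ring

theorem parPow_zero (G : SPoly) : parPow 0 G = G := by simp [parPow]

theorem parPow_one (G : SPoly) : parPow 1 G = Superspace.par G := by simp [parPow]

/-- The action is an even map, so moving the parity operator past a field of parity q costs only the
sign. This replaces any assumption that cochains be homogeneous. -/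
theorem parPow_density (lam : ℂ) (p : ZMod 2) {q : ZMod 2} {S : contact} (hS : HasParity q S)
    (G : SPoly) :
    parPow p (density lam S G) = sgn (p * q) • density lam S (parPow p G) := by
  obtain rfl | rfl := parity_cases p <;> obtain rfl | rfl := parity_cases q <;>
    first
      | obtain ⟨f, rfl⟩ := exists_evenField hS
      | obtain ⟨f, rfl⟩ := exists_oddField hS
  all_goals
    simp only [parPow_zero, parPow_one, mul_zero, mul_one,
      sgn_zero, sgn_one, neg_smul, one_smul]
  all_goals
    refine SPoly.ext ?_ ?_ <;>
    simp only [SPoly.fst_neg, SPoly.snd_neg, par_fst, par_snd,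
      density_even_fst, density_even_snd, density_odd_fst, density_odd_snd,
      derivative_neg] <;>
    ring

theorem parPow_parPow (p : ZMod 2) (G : SPoly) : parPow p (parPow p G) = G := by
  obtain rfl | rfl := parity_cases p
  · simp only [parPow_zero]
  · simp only [parPow_one, Superspace.par_par]

theorem br_add_left (S S' T : contact) : br (S + S') T = br S T + br S' T :=
  Subtype.ext (superBracket_add_left S.1 S'.1 T.1)

theorem br_smul_left (c : ℂ) (S T : contact) : br (c • S) T = c • br S T :=
  Subtype.ext (superBracket_smul_left c S.1 T.1)

theorem br_add_right (S T T' : contact) : br S (T + T') = br S T + br S T' := by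
  refine Subtype.ext ?_
  simp only [br, superBracket, Submodule.coe_add, map_add, mul_add, add_mul, smul_add,
    Finset.sum_add_distrib]
  abel

theorem br_smul_right (c : ℂ) (S T : contact) : br S (c • T) = c • br S T := by
  refine Subtype.ext ?_
  simp only [br, superBracket, Submodule.coe_smul, map_smul, smul_mul_assoc, mul_smul_comm,
    smul_sub, Finset.smul_sum]
  simp only [smul_comm c]

theorem br_zero_left (T : contact) : br 0 T = 0 := by
  simpa using br_smul_left 0 0 T

theorem part_of_hasParity {p : ZMod 2} {S : contact} (hS : HasParity p S) (q : ZMod 2) :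
    part q S = if q = p then S else 0 := by
  rw [HasParity] at hS
  have h2 : (2⁻¹ : ℂ) • (S + S) = S := by rw [← two_smul ℂ S, smul_smul]; norm_num
  rw [smul_add] at h2
  obtain rfl | rfl := parity_cases p <;> obtain rfl | rfl := parity_cases q <;>
    simp [part, hS, h2]

/-! ### Cochains, cocycles and coboundaries in low degree -/

theorem relCochains_bot {lam : ℂ} {n : ℕ} {φ : Cochain n} :
    φ ∈ relCochains lam ⊥ n ↔ IsSuperalternating φ := by
  refine ⟨fun h => h.1, fun h => ⟨h, fun S i hi => ?_, fun p S _ q T hT _ => ?_⟩⟩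
  · exact φ.map_coord_zero i ((Submodule.mem_bot ℂ).1 hi)
  · rw [(Submodule.mem_bot ℂ).1 hT, map_zero]
    simp only [br_zero_left, LinearMap.zero_apply, smul_zero]
    refine (Finset.sum_eq_zero fun j _ => ?_).symm
    rw [φ.map_update_zero, smul_zero]

theorem superalternating_zero (φ : Cochain 0) : IsSuperalternating φ :=
  fun _ _ _ _ hi => absurd hi (by omega)

theorem superalternating_one (φ : Cochain 1) : IsSuperalternating φ :=
  fun _ _ _ _ hi => absurd hi (by omega)

theorem superalternating_two {φ : Cochain 2} : IsSuperalternating φ ↔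
    ∀ p q S T, HasParity p S → HasParity q T → φ ![T, S] = -sgn (p * q) • φ ![S, T] := by
  constructor
  · intro h p q S T hS hT
    have h1 := h ![p, q] ![S, T] (by intro i; fin_cases i <;> simpa) 0 (by omega)
    have h2 : ![S, T] ∘ Equiv.swap (⟨0, by omega⟩ : Fin 2) ⟨0 + 1, by omega⟩ = ![T, S] := by
      funext i; fin_cases i <;> simp
    rw [h2] at h1
    simpa using h1
  · intro h p S hS i hi
    obtain rfl : i = 0 := by omega
    have h1 := h (p 0) (p 1) (S 0) (S 1) (hS 0) (hS 1)
    have h2 : S ∘ Equiv.swap (⟨0, by omega⟩ : Fin 2) ⟨0 + 1, by omega⟩ = ![S 1, S 0] := by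
      funext i; fin_cases i <;> simp
    have h3 : S = ![S 0, S 1] := by funext i; fin_cases i <;> simp
    rw [h2, h1, ← h3]
    rfl

theorem coboundary_deg_zero (lam : ℂ) (φ : Cochain 0) (p : Fin 1 → ZMod 2)
    (S : Fin 1 → contact) :
    coboundary lam φ p S = density lam (S 0) (parPow (p 0) (φ ![])) := by
  have h : (fun k : Fin 0 => S k.succ) = ![] := Subsingleton.elim _ _
  simp [coboundary, h]

@[simp] theorem oneForm_apply (A : contact →ₗ[ℂ] SPoly) (S : Fin 1 → contact) :
    oneForm A S = A (S 0) := rfl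

theorem eq_oneForm (φ : Cochain 1) : ∃ A, φ = oneForm A :=
  ⟨(MultilinearMap.ofSubsingleton ℂ contact SPoly (0 : Fin 1)).symm φ, by simp [oneForm]⟩

theorem coboundary_deg_one (lam : ℂ) (A : contact →ₗ[ℂ] SPoly) (p : Fin 2 → ZMod 2)
    (S : Fin 2 → contact) :
    coboundary lam (oneForm A) p S =
      sgn (p 0 * p 1) • density lam (S 0) (parPow (p 0) (A (S 1)))
        - density lam (S 1) (parPow (p 1) (A (S 0))) - A (br (S 0) (S 1)) := by
  have h0 : Finset.Ioi (0 : Fin 2) = {1} := by decide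
  have h1 : Finset.Ioi (1 : Fin 2) = ∅ := by decide
  have h2 : Finset.Ioo (0 : Fin 2) 1 = ∅ := by decide
  simp [coboundary, Fin.sum_univ_two, h0, h1, h2]
  abel

theorem coboundary_deg_two (lam : ℂ) (φ : Cochain 2) (p : Fin 3 → ZMod 2)
    (S : Fin 3 → contact) :
    coboundary lam φ p S =
      sgn (p 0 * (p 1 + p 2)) • density lam (S 0) (parPow (p 0) (φ ![S 1, S 2]))
        - sgn (p 1 * p 2) • density lam (S 1) (parPow (p 1) (φ ![S 0, S 2]))
        + density lam (S 2) (parPow (p 2) (φ ![S 0, S 1]))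
        - φ ![br (S 0) (S 1), S 2] - sgn (p 0 * p 1) • φ ![S 1, br (S 0) (S 2)]
        + φ ![S 0, br (S 1) (S 2)] := by
  have h0 : Finset.Ioi (0 : Fin 3) = {1, 2} := by decide
  have h1 : Finset.Ioi (1 : Fin 3) = {2} := by decide
  have h2 : Finset.Ioi (2 : Fin 3) = ∅ := by decide
  have h3 : Finset.Ioo (0 : Fin 3) 1 = ∅ := by decide
  have h4 : Finset.Ioo (0 : Fin 3) 2 = {1} := by decide
  have h5 : Finset.Ioo (1 : Fin 3) 2 = ∅ := by decide
  have e1 : (fun k => S ((0 : Fin 3).succAbove k)) = ![S 1, S 2] := by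
    funext i; fin_cases i <;> rfl
  have e2 : (fun k => S ((1 : Fin 3).succAbove k)) = ![S 0, S 2] := by
    funext i; fin_cases i <;> rfl
  have e3 : (fun k => S ((2 : Fin 3).succAbove k)) = ![S 0, S 1] := by
    funext i; fin_cases i <;> rfl
  have e4 : (fun k => Function.update S 1 (br (S 0) (S 1)) ((0 : Fin 3).succAbove k))
      = ![br (S 0) (S 1), S 2] := by
    funext i; fin_cases i <;> rfl
  have e5 : (fun k => Function.update S 2 (br (S 0) (S 2)) ((0 : Fin 3).succAbove k))
      = ![S 1, br (S 0) (S 2)] := by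
    funext i; fin_cases i <;> rfl
  have e6 : (fun k => Function.update S 2 (br (S 1) (S 2)) ((1 : Fin 3).succAbove k))
      = ![S 0, br (S 1) (S 2)] := by
    funext i; fin_cases i <;> rfl
  unfold coboundary
  rw [Fin.sum_univ_three, Fin.sum_univ_three]
  simp only [h0, h1, h2, h3, h4, h5, e1, e2, e3, e4, e5, e6,
    Finset.sum_pair (show (1 : Fin 3) ≠ 2 by decide), Finset.sum_singleton, Finset.sum_empty]
  simp
  abel

theorem mem_cocycles_zero {lam : ℂ} {φ : Cochain 0} : φ ∈ cocycles lam ⊥ 0 ↔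
    ∀ p S, HasParity p S → density lam S (parPow p (φ ![])) = 0 := by
  constructor
  · intro h p S hS
    simpa [coboundary_deg_zero] using h.2 (fun _ => p) (fun _ => S) fun _ => hS
  · intro h
    refine ⟨relCochains_bot.2 (superalternating_zero φ), fun p S hS => ?_⟩
    rw [coboundary_deg_zero, h _ _ (hS 0)]

theorem mem_cocycles_one {lam : ℂ} {A : contact →ₗ[ℂ] SPoly} : oneForm A ∈ cocycles lam ⊥ 1 ↔
    ∀ p q S T, HasParity p S → HasParity q T →
      sgn (p * q) • density lam S (parPow p (A T)) - density lam T (parPow q (A S))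
        - A (br S T) = 0 := by
  constructor
  · intro h p q S T hS hT
    simpa [coboundary_deg_one] using h.2 ![p, q] ![S, T] (by intro i; fin_cases i <;> simpa)
  · intro h
    refine ⟨relCochains_bot.2 (superalternating_one _), fun p S hS => ?_⟩
    rw [coboundary_deg_one, h _ _ _ _ (hS 0) (hS 1)]

theorem cocycle_two {lam : ℂ} {h : Submodule ℂ contact} {φ : Cochain 2}
    (hφ : φ ∈ cocycles lam h 2) {p q r : ZMod 2} {S T U : contact} (hS : HasParity p S)
    (hT : HasParity q T) (hU : HasParity r U) :
      sgn (p * (q + r)) • density lam S (parPow p (φ ![T, U]))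
        - sgn (q * r) • density lam T (parPow q (φ ![S, U]))
        + density lam U (parPow r (φ ![S, T]))
        - φ ![br S T, U] - sgn (p * q) • φ ![T, br S U] + φ ![S, br T U] = 0 := by
  have h1 := hφ.2 ![p, q, r] ![S, T, U] (by intro i; fin_cases i <;> simpa)
  rw [coboundary_deg_two] at h1
  simpa using h1

theorem mem_cocycles_two {lam : ℂ} {φ : Cochain 2} : φ ∈ cocycles lam ⊥ 2 ↔
    IsSuperalternating φ ∧ ∀ p q r S T U, HasParity p S → HasParity q T → HasParity r U →
      sgn (p * (q + r)) • density lam S (parPow p (φ ![T, U]))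
        - sgn (q * r) • density lam T (parPow q (φ ![S, U]))
        + density lam U (parPow r (φ ![S, T]))
        - φ ![br S T, U] - sgn (p * q) • φ ![T, br S U] + φ ![S, br T U] = 0 := by
  constructor
  · exact fun h => ⟨h.1.1, fun p q r S T U hS hT hU => cocycle_two h hS hT hU⟩
  · intro h
    refine ⟨relCochains_bot.2 h.1, fun p S hS => ?_⟩
    rw [coboundary_deg_two, h.2 _ _ _ _ _ _ (hS 0) (hS 1) (hS 2)]

theorem cocycles_le_bot (lam : ℂ) (h : Submodule ℂ contact) (n : ℕ) :
    cocycles lam h n ≤ cocycles lam ⊥ n :=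
  fun _ hφ => ⟨relCochains_bot.2 hφ.1.1, hφ.2⟩

theorem coboundaries_le_bot (lam : ℂ) (h : Submodule ℂ contact) :
    ∀ n, coboundaries lam h n ≤ coboundaries lam ⊥ n
  | 0 => le_rfl
  | _ + 1 => fun _ ⟨h1, χ, h2, h3⟩ =>
    ⟨relCochains_bot.2 h1.1, χ, relCochains_bot.2 h2.1, h3⟩

/-- The coboundary of the `0`-cochain `f`. -/
def zeroCoboundary (lam : ℂ) (f : SPoly) : contact →ₗ[ℂ] SPoly :=
  ∑ p : ZMod 2, (density lam).flip (parPow p f) ∘ₗ part p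

theorem zeroCoboundary_apply (lam : ℂ) (f : SPoly) {p : ZMod 2} {S : contact}
    (hS : HasParity p S) : zeroCoboundary lam f S = density lam S (parPow p f) := by
  simp only [zeroCoboundary, LinearMap.sum_apply, LinearMap.comp_apply, LinearMap.flip_apply,
    part_of_hasParity hS]
  rw [Finset.sum_eq_single p]
  · simp
  · intro q _ hq
    simp [hq]
  · simp

/-- The coboundary of the `1`-cochain given by `A`. -/
def oneCoboundary (lam : ℂ) (A : contact →ₗ[ℂ] SPoly) : Cochain 2 where
  toFun S := ∑ p : ZMod 2, ∑ q : ZMod 2,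
    (sgn (p * q) • density lam (part p (S 0)) (parPow p (A (part q (S 1))))
      - density lam (part q (S 1)) (parPow q (A (part p (S 0))))
      - A (br (part p (S 0)) (part q (S 1))))
  map_update_add' S i T U := by
    rw [← Finset.sum_add_distrib]
    refine Finset.sum_congr rfl fun p _ => ?_
    rw [← Finset.sum_add_distrib]
    refine Finset.sum_congr rfl fun q _ => ?_
    fin_cases i <;> simp [br_add_left, br_add_right] <;> abel
  map_update_smul' S i c T := by
    rw [Finset.smul_sum]
    refine Finset.sum_congr rfl fun p _ => ?_
    rw [Finset.smul_sum]
    refine Finset.sum_congr rfl fun q _ => ?_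
    fin_cases i <;> simp [br_smul_left, br_smul_right, smul_sub, smul_comm c]

theorem oneCoboundary_apply (lam : ℂ) (A : contact →ₗ[ℂ] SPoly) {p q : ZMod 2} {S T : contact}
    (hS : HasParity p S) (hT : HasParity q T) :
    oneCoboundary lam A ![S, T] = sgn (p * q) • density lam S (parPow p (A T))
      - density lam T (parPow q (A S)) - A (br S T) := by
  have h0 : br 0 0 = 0 := br_zero_left 0
  have h1 : ∀ S, br S 0 = 0 := fun S => by simpa using br_smul_right 0 S 0
  simp only [oneCoboundary, MultilinearMap.coe_mk, Matrix.cons_val_zero, Matrix.cons_val_one,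
    part_of_hasParity hS, part_of_hasParity hT]
  rw [Finset.sum_eq_single p, Finset.sum_eq_single q]
  · simp
  · intro r _ hr
    simp [hr, h1]
  · simp
  · intro r _ hr
    simp [hr, br_zero_left]
  · simp

/-- The identity ∂² = 0 in degree zero is the module axiom `density_br`. -/
theorem zeroCoboundary_mem (lam : ℂ) (f : SPoly) :
    oneForm (zeroCoboundary lam f) ∈ cocycles lam ⊥ 1 := by
  refine mem_cocycles_one.2 fun p q S T hS hT => ?_
  rw [zeroCoboundary_apply lam f hS, zeroCoboundary_apply lam f hT,
    zeroCoboundary_apply lam f (hasParity_br hS hT), density_br lam hS hT,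
    parPow_density lam p hT, parPow_density lam q hS]
  obtain rfl | rfl := parity_cases p <;> obtain rfl | rfl := parity_cases q <;>
    simp [parPow_zero, parPow_one, Superspace.par_par, one_add_one_parity]

theorem zeroCoboundary_mem_coboundaries (lam : ℂ) (f : SPoly) :
    oneForm (zeroCoboundary lam f) ∈ coboundaries lam ⊥ 1 := by
  refine ⟨(zeroCoboundary_mem lam f).1, MultilinearMap.constOfIsEmpty ℂ _ f,
    relCochains_bot.2 (superalternating_zero _), fun p S hS => ?_⟩
  rw [coboundary_deg_zero, oneForm_apply, zeroCoboundary_apply lam f (hS 0)]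
  rfl

/-- The identity ∂² = 0 in degree one: the module axiom cancels the terms with two actions, and the
Jacobi identity cancels those where `A` meets a double bracket. -/
theorem oneCoboundary_mem (lam : ℂ) (A : contact →ₗ[ℂ] SPoly) :
    oneCoboundary lam A ∈ cocycles lam ⊥ 2 := by
  refine mem_cocycles_two.2 ⟨superalternating_two.2 fun p q S T hS hT => ?_,
    fun p q r S T U hS hT hU => ?_⟩
  · rw [oneCoboundary_apply lam A hS hT, oneCoboundary_apply lam A hT hS, br_comm hS hT]
    obtain rfl | rfl := parity_cases p <;> obtain rfl | rfl := parity_cases q <;>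
      simp
    all_goals abel
  · rw [oneCoboundary_apply lam A hT hU, oneCoboundary_apply lam A hS hU,
      oneCoboundary_apply lam A hS hT, oneCoboundary_apply lam A (hasParity_br hS hT) hU,
      oneCoboundary_apply lam A hT (hasParity_br hS hU),
      oneCoboundary_apply lam A hS (hasParity_br hT hU), br_jacobi hS hT hU,
      density_br lam hS hT, density_br lam hS hU, density_br lam hT hU]
    simp only [map_sub, map_add, map_smul, parPow_density lam _ hS, parPow_density lam _ hT,
      parPow_density lam _ hU]
    obtain rfl | rfl := parity_cases p <;> obtain rfl | rfl := parity_cases q <;>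
      obtain rfl | rfl := parity_cases r <;>
      simp only [parPow_zero, parPow_one, Superspace.par_par, one_add_one_parity, mul_zero,
        mul_one, add_zero, zero_add, sgn_zero, sgn_one, neg_smul, one_smul, neg_neg,
        smul_neg] <;> abel

theorem oneCoboundary_mem_coboundaries (lam : ℂ) (A : contact →ₗ[ℂ] SPoly) :
    oneCoboundary lam A ∈ coboundaries lam ⊥ 2 := by
  refine ⟨(oneCoboundary_mem lam A).1, oneForm A,
    relCochains_bot.2 (superalternating_one _), fun p S hS => ?_⟩
  rw [coboundary_deg_one, ← oneCoboundary_apply lam A (hS 0) (hS 1)]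
  congr 1
  funext i; fin_cases i <;> rfl

/-! ### Cup products -/

theorem cup_apply (b : ZMod 2) (A B : contact →ₗ[ℂ] SPoly) {p q : ZMod 2} {S T : contact}
    (hS : HasParity p S) (hT : HasParity q T) :
    cup b A B ![S, T] = sgn (p * b) • (A S * B T) - sgn (q * (p + b)) • (A T * B S) := by
  simp only [cup, MultilinearMap.coe_mk, Matrix.cons_val_zero, Matrix.cons_val_one,
    part_of_hasParity hS, part_of_hasParity hT]
  rw [Finset.sum_eq_single p, Finset.sum_eq_single q]
  · simp
  · intro r _ hr
    simp [hr]
  · simp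
  · intro r _ hr
    simp [hr]
  · simp

theorem superalternating_cup (b : ZMod 2) (A B : contact →ₗ[ℂ] SPoly) :
    IsSuperalternating (cup b A B) := by
  refine superalternating_two.2 fun p q S T hS hT => ?_
  rw [cup_apply b A B hS hT, cup_apply b A B hT hS]
  obtain rfl | rfl := parity_cases p <;> obtain rfl | rfl := parity_cases q <;>
    obtain rfl | rfl := parity_cases b <;> simp [one_add_one_parity]
  all_goals abel

theorem density_mul (lam mu : ℂ) {p : ZMod 2} {S : contact} (hS : HasParity p S) (F G : SPoly) :
    density (lam + mu) S (F * G) =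
      density lam S F * G + parPow p F * density mu S G := by
  obtain rfl | rfl := parity_cases p <;>
    first
      | obtain ⟨f, rfl⟩ := exists_evenField hS
      | obtain ⟨f, rfl⟩ := exists_oddField hS
  all_goals
    refine SPoly.ext ?_ ?_ <;>
    simp only [SPoly.fst_mul, SPoly.snd_mul, SPoly.fst_add, SPoly.snd_add, parPow_zero,
      parPow_one, par_fst, par_snd, density_even_fst, density_even_snd, density_odd_fst,
      density_odd_snd, derivative_mul, mul_add, map_add] <;>
    ring

/-! ### Bol operators as cocycles -/

theorem bolMap_succ (k : ℕ) (S : contact) : bolMap (k + 1) S = Dbar (bolMap k S) := by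
  obtain ⟨F, rfl⟩ := hamEquiv.surjective S
  rw [bolMap_hamEquiv, bolMap_hamEquiv, pow_succ', Module.End.mul_apply]

theorem bolMap_zero_even (f : ℂ[X]) : bolMap 0 (evenField f) = SPoly.mk (2 * f) 0 := by
  rw [evenField_eq, bolMap_hamEquiv, pow_zero, Module.End.one_apply]

theorem bolMap_zero_odd (f : ℂ[X]) : bolMap 0 (oddField f) = SPoly.mk 0 (2 * f) := by
  rw [oddField_eq, bolMap_hamEquiv, pow_zero, Module.End.one_apply]

theorem Dbar_mk (f g : ℂ[X]) : Dbar (SPoly.mk f g) = SPoly.mk g (-derivative f) := by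
  refine SPoly.ext ?_ ?_ <;> simp [Dbar_fst, Dbar_snd]

theorem bolMap_two_mul_even (m : ℕ) (f : ℂ[X]) :
    bolMap (2 * m) (evenField f) = SPoly.mk ((-1) ^ m * (2 * derivative^[m] f)) 0 := by
  induction m with
  | zero => simpa using bolMap_zero_even f
  | succ m ih =>
    rw [Nat.mul_succ, bolMap_succ, bolMap_succ, ih, Dbar_mk, Dbar_mk, derivative_zero, neg_zero,
      Function.iterate_succ_apply']
    congr 1
    have h : ((-1) ^ m : ℂ[X]) = C ((-1) ^ m) := by simp
    rw [pow_succ, h, derivative_C_mul, derivative_mul, derivative_ofNat]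
    ring

theorem bolMap_two_mul_odd (m : ℕ) (f : ℂ[X]) :
    bolMap (2 * m) (oddField f) = SPoly.mk 0 ((-1) ^ m * (2 * derivative^[m] f)) := by
  induction m with
  | zero => simpa using bolMap_zero_odd f
  | succ m ih =>
    rw [Nat.mul_succ, bolMap_succ, bolMap_succ, ih, Dbar_mk, Dbar_mk, derivative_zero, neg_zero,
      Function.iterate_succ_apply']
    congr 1
    have h : ((-1) ^ m : ℂ[X]) = C ((-1) ^ m) := by simp
    rw [pow_succ, h, derivative_C_mul, derivative_mul, derivative_ofNat]
    ring

theorem bolMap_two_mul_add_one_even (m : ℕ) (f : ℂ[X]) : bolMap (2 * m + 1) (evenField f) =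
    SPoly.mk 0 ((-1) ^ (m + 1) * (2 * derivative^[m + 1] f)) := by
  rw [bolMap_succ, bolMap_two_mul_even, Dbar_mk, Function.iterate_succ_apply']
  congr 1
  have h : ((-1) ^ m : ℂ[X]) = C ((-1) ^ m) := by simp
  rw [pow_succ, h, derivative_C_mul, derivative_mul, derivative_ofNat]
  ring

theorem bolMap_two_mul_add_one_odd (m : ℕ) (f : ℂ[X]) : bolMap (2 * m + 1) (oddField f) =
    SPoly.mk ((-1) ^ m * (2 * derivative^[m] f)) 0 := by
  rw [bolMap_succ, bolMap_two_mul_odd, Dbar_mk, derivative_zero, neg_zero]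

theorem hasParity_Dbar {k : ℕ} {p : ZMod 2} {F : SPoly} (h : HasParity (k + p) F) :
    HasParity ((k + 1 : ℕ) + p) (Dbar F) := by
  have h1 : ((k + 1 : ℕ) + p : ZMod 2) = (k + p) + 1 := by push_cast; ring
  rw [h1]
  generalize (k + p : ZMod 2) = q at h
  rw [HasParity] at h ⊢
  rw [sgn_add, sgn_one]
  have e1 := congrArg SPoly.fst h
  have e2 := congrArg SPoly.snd h
  simp only [par_fst, par_snd, SPoly.fst_smul, SPoly.snd_smul] at e1 e2
  refine SPoly.ext ?_ ?_
  · simp only [par_fst, Dbar_fst, SPoly.fst_smul, map_mul, map_neg, map_one]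
    linear_combination -e2
  · simp only [par_snd, Dbar_snd, SPoly.snd_smul, map_mul, map_neg, map_one]
    have e3 := congrArg derivative e1
    rw [derivative_C_mul] at e3
    linear_combination e3

theorem hasParity_bolMap (k : ℕ) {p : ZMod 2} {S : contact} (hS : HasParity p S) :
    HasParity (k + p) (bolMap k S) := by
  induction k with
  | zero =>
    obtain rfl | rfl := parity_cases p
    · obtain ⟨f, rfl⟩ := exists_evenField hS
      rw [bolMap_zero_even, Nat.cast_zero, add_zero, HasParity]
      refine SPoly.ext ?_ ?_ <;> simp
    · obtain ⟨f, rfl⟩ := exists_oddField hS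
      rw [bolMap_zero_odd, Nat.cast_zero, zero_add, HasParity]
      refine SPoly.ext ?_ ?_ <;> simp
  | succ k ih =>
    rw [bolMap_succ]
    exact hasParity_Dbar ih

theorem cochainParity_bolMap (k : ℕ) : CochainParity k (oneForm (bolMap k)) := by
  intro p S hS
  rw [Fin.sum_univ_one, oneForm_apply]
  exact hasParity_bolMap k (hS 0)

theorem parPow_mul (p : ZMod 2) (F G : SPoly) :
    parPow p (F * G) = parPow p F * parPow p G := by
  obtain rfl | rfl := parity_cases p
  · simp only [parPow_zero]
  · simp only [parPow_one]
    refine SPoly.ext ?_ ?_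
    · simp
    · simp
      ring

/-- Fields act on products of densities by the super Leibniz rule `density_mul`. Once the cocycle
identities replace the values on brackets, every term is a product of one factor with an action and
one without, and these cancel in each parity case. -/
theorem cup_mem_cocycles {lam mu : ℂ} {a b : ZMod 2} {A B : contact →ₗ[ℂ] SPoly}
    (hA : oneForm A ∈ cocycles lam ⊥ 1) (hB : oneForm B ∈ cocycles mu ⊥ 1)
    (pA : CochainParity a (oneForm A)) (pB : CochainParity b (oneForm B)) :
    cup b A B ∈ cocycles (lam + mu) ⊥ 2 := by
  refine mem_cocycles_two.2 ⟨superalternating_cup b A B, fun p q r S T U hS hT hU => ?_⟩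
  have kA : ∀ {p q : ZMod 2} {S : contact}, HasParity p S →
      parPow q (A S) = sgn (q * (a + p)) • A S := fun {p q S} hS =>
    parPow_eq (by simpa using pA (fun _ => p) (fun _ => S) fun _ => hS) q
  have kB : ∀ {p q : ZMod 2} {S : contact}, HasParity p S →
      parPow q (B S) = sgn (q * (b + p)) • B S := fun {p q S} hS =>
    parPow_eq (by simpa using pB (fun _ => p) (fun _ => S) fun _ => hS) q
  have eA : ∀ {p q : ZMod 2} {S T : contact}, HasParity p S → HasParity q T → A (br S T) =
      sgn (p * q) • density lam S (parPow p (A T)) - density lam T (parPow q (A S)) :=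
    fun hS hT => (sub_eq_zero.1 (mem_cocycles_one.1 hA _ _ _ _ hS hT)).symm
  have eB : ∀ {p q : ZMod 2} {S T : contact}, HasParity p S → HasParity q T → B (br S T) =
      sgn (p * q) • density mu S (parPow p (B T)) - density mu T (parPow q (B S)) :=
    fun hS hT => (sub_eq_zero.1 (mem_cocycles_one.1 hB _ _ _ _ hS hT)).symm
  rw [cup_apply b A B hS hT, cup_apply b A B hS hU, cup_apply b A B hT hU,
    cup_apply b A B (hasParity_br hS hT) hU, cup_apply b A B hT (hasParity_br hS hU),
    cup_apply b A B hS (hasParity_br hT hU), eA hS hT, eA hS hU, eA hT hU, eB hS hT, eB hS hU,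
    eB hT hU]
  simp only [map_sub, map_smul, parPow_mul, density_mul lam mu hS, density_mul lam mu hT,
    density_mul lam mu hU, kA hS, kA hT, kA hU, kB hS, kB hT, kB hU]
  obtain rfl | rfl := parity_cases p <;> obtain rfl | rfl := parity_cases q <;>
    obtain rfl | rfl := parity_cases r <;> obtain rfl | rfl := parity_cases a <;>
    obtain rfl | rfl := parity_cases b <;>
    simp only [one_add_one_parity, mul_zero, mul_one, add_zero, zero_add, sgn_zero, sgn_one,
      neg_smul, one_smul] <;> ring

theorem bolMap_mem_cocycles {k : ℕ} {lam : ℂ} (hk : k = 2 ∧ lam = 0 ∨ k = 3 ∧ lam = 1 / 2 ∨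
    k = 5 ∧ lam = 3 / 2) : oneForm (bolMap k) ∈ cocycles lam ⊥ 1 := by
  have e2 : bolMap 2 = bolMap (2 * 1) := rfl
  have e3 : bolMap 3 = bolMap (2 * 1 + 1) := rfl
  have e5 : bolMap 5 = bolMap (2 * 2 + 1) := rfl
  refine mem_cocycles_one.2 fun p q S T hS hT => ?_
  have c0 : (C (2 * 0 : ℂ) : ℂ[X]) = 0 := by simp
  have c1 : (C (2 * (1 / 2) : ℂ) : ℂ[X]) = 1 := by norm_num
  have c3 : (C (2 * (3 / 2) : ℂ) : ℂ[X]) = 3 := by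
    rw [mul_div_cancel₀ _ two_ne_zero]; exact map_ofNat C 3
  obtain rfl | rfl := parity_cases p <;> obtain rfl | rfl := parity_cases q <;>
    first
      | obtain ⟨f, rfl⟩ := exists_evenField hS
      | obtain ⟨f, rfl⟩ := exists_oddField hS
  all_goals
    first
      | obtain ⟨g, rfl⟩ := exists_evenField hT
      | obtain ⟨g, rfl⟩ := exists_oddField hT
  all_goals
    obtain ⟨rfl, rfl⟩ | ⟨rfl, rfl⟩ | ⟨rfl, rfl⟩ := hk
  all_goals
    simp only [br_even_even, br_even_odd, br_odd_even, br_odd_odd, e2, e3, e5,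
      bolMap_two_mul_even, bolMap_two_mul_odd, bolMap_two_mul_add_one_even,
      bolMap_two_mul_add_one_odd, parPow_zero, parPow_one, Function.iterate_succ_apply',
      Function.iterate_zero_apply, mul_zero, mul_one, sgn_zero, sgn_one, neg_smul, one_smul]
    refine SPoly.ext ?_ ?_
  all_goals
    simp only [SPoly.fst_sub, SPoly.snd_sub, SPoly.fst_neg, SPoly.snd_neg, par_fst, par_snd,
      SPoly.fst_mk, SPoly.snd_mk, SPoly.fst_zero, SPoly.snd_zero,
      density_even_fst, density_even_snd, density_odd_fst, density_odd_snd, c0, c1, c3,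
      derivative_mul, derivative_sub, derivative_add, derivative_neg, derivative_ofNat,
      derivative_zero, derivative_one, pow_succ, pow_zero]
    ring

/-! ### The cocycle of weight five -/

/-- The conformally relative cocycle with values in `𝔽(5)`, the composition of the affine super
Bol operator from `𝔽(-1)` to `𝔽(3/2)` with a supertransvectant. -/
def weightFive : Cochain 2 :=
  (4 : ℂ) • cup 1 (bolMap 7) (bolMap 7) - (3 : ℂ) • cup 1 (bolMap 5) (bolMap 9)
    - (2 : ℂ) • cup 0 (bolMap 6) (bolMap 8)

theorem weightFive_apply {p q : ZMod 2} {S T : contact} (hS : HasParity p S)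
    (hT : HasParity q T) : weightFive ![S, T] =
      (4 : ℂ) • (sgn p • (bolMap 7 S * bolMap 7 T)
        - sgn (q * (p + 1)) • (bolMap 7 T * bolMap 7 S))
      - (3 : ℂ) • (sgn p • (bolMap 5 S * bolMap 9 T)
        - sgn (q * (p + 1)) • (bolMap 5 T * bolMap 9 S))
      - (2 : ℂ) • (bolMap 6 S * bolMap 8 T - sgn (q * p) • (bolMap 6 T * bolMap 8 S)) := by
  rw [weightFive, sub_apply, sub_apply, smul_apply, smul_apply, smul_apply, cup_apply _ _ _ hS hT,
    cup_apply _ _ _ hS hT, cup_apply _ _ _ hS hT, mul_one, mul_zero, add_zero, sgn_zero,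
    one_smul]

theorem superalternating_weightFive : IsSuperalternating weightFive := by
  -- The weight 0 is arbitrary, since absolute cochains do not depend on it; only closure under
  -- linear combinations is wanted.
  have h : weightFive ∈ relCochains 0 ⊥ 2 :=
    sub_mem (sub_mem
      (Submodule.smul_mem _ _ (relCochains_bot.2 (superalternating_cup _ _ _)))
      (Submodule.smul_mem _ _ (relCochains_bot.2 (superalternating_cup _ _ _))))
      (Submodule.smul_mem _ _ (relCochains_bot.2 (superalternating_cup _ _ _)))
  exact h.1

theorem C_three : (C (3 : ℂ) : ℂ[X]) = 3 := map_ofNat C 3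

theorem C_four : (C (4 : ℂ) : ℂ[X]) = 4 := map_ofNat C 4

theorem bolMap_five_to_nine_even (f : ℂ[X]) :
    bolMap 5 (evenField f) = SPoly.mk 0 (-(2 * derivative^[3] f)) ∧
    bolMap 6 (evenField f) = SPoly.mk (-(2 * derivative^[3] f)) 0 ∧
    bolMap 7 (evenField f) = SPoly.mk 0 (2 * derivative^[4] f) ∧
    bolMap 8 (evenField f) = SPoly.mk (2 * derivative^[4] f) 0 ∧
    bolMap 9 (evenField f) = SPoly.mk 0 (-(2 * derivative^[5] f)) := by
  rw [bolMap_two_mul_add_one_even 2, bolMap_two_mul_even 3, bolMap_two_mul_add_one_even 3,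
    bolMap_two_mul_even 4, bolMap_two_mul_add_one_even 4]
  refine ⟨?_, ?_, ?_, ?_, ?_⟩ <;> congr 1 <;> ring

theorem bolMap_five_to_nine_odd (f : ℂ[X]) :
    bolMap 5 (oddField f) = SPoly.mk (2 * derivative^[2] f) 0 ∧
    bolMap 6 (oddField f) = SPoly.mk 0 (-(2 * derivative^[3] f)) ∧
    bolMap 7 (oddField f) = SPoly.mk (-(2 * derivative^[3] f)) 0 ∧
    bolMap 8 (oddField f) = SPoly.mk 0 (2 * derivative^[4] f) ∧
    bolMap 9 (oddField f) = SPoly.mk (2 * derivative^[4] f) 0 := by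
  rw [bolMap_two_mul_add_one_odd 2, bolMap_two_mul_odd 3, bolMap_two_mul_add_one_odd 3,
    bolMap_two_mul_odd 4, bolMap_two_mul_add_one_odd 4]
  refine ⟨?_, ?_, ?_, ?_, ?_⟩ <;> congr 1 <;> ring

theorem weightFive_even_even (f g : ℂ[X]) : weightFive ![evenField f, evenField g] =
    SPoly.mk (8 * (derivative^[3] f * derivative^[4] g - derivative^[4] f * derivative^[3] g))
      0 := by
  obtain ⟨f5, f6, f7, f8, f9⟩ := bolMap_five_to_nine_even f
  obtain ⟨g5, g6, g7, g8, g9⟩ := bolMap_five_to_nine_even g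
  rw [weightFive_apply (hasParity_evenField f) (hasParity_evenField g), f5, f6, f7, f8, f9, g5,
    g6, g7, g8, g9]
  refine SPoly.ext ?_ ?_ <;> simp [-Function.iterate_succ, C_two, C_three, C_four]
  ring

theorem weightFive_even_odd (f g : ℂ[X]) : weightFive ![evenField f, oddField g] =
    SPoly.mk 0 (20 * (derivative^[3] f * derivative^[4] g)
      - 40 * (derivative^[4] f * derivative^[3] g)
      + 12 * (derivative^[5] f * derivative^[2] g)) := by
  obtain ⟨f5, f6, f7, f8, f9⟩ := bolMap_five_to_nine_even f
  obtain ⟨g5, g6, g7, g8, g9⟩ := bolMap_five_to_nine_odd g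
  rw [weightFive_apply (hasParity_evenField f) (hasParity_oddField g), f5, f6, f7, f8, f9, g5,
    g6, g7, g8, g9]
  refine SPoly.ext ?_ ?_ <;> simp [-Function.iterate_succ, C_two, C_three, C_four]
  ring

theorem weightFive_odd_even (f g : ℂ[X]) : weightFive ![oddField f, evenField g] =
    SPoly.mk 0 (-(20 * (derivative^[3] g * derivative^[4] f)
      - 40 * (derivative^[4] g * derivative^[3] f)
      + 12 * (derivative^[5] g * derivative^[2] f))) := by
  rw [superalternating_two.1 superalternating_weightFive _ _ _ _ (hasParity_evenField g)
    (hasParity_oddField f), weightFive_even_odd]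
  refine SPoly.ext ?_ ?_ <;> simp [-Function.iterate_succ]

theorem weightFive_odd_odd (f g : ℂ[X]) : weightFive ![oddField f, oddField g] =
    SPoly.mk (12 * (derivative^[2] f * derivative^[4] g + derivative^[4] f * derivative^[2] g)
      - 32 * (derivative^[3] f * derivative^[3] g)) 0 := by
  obtain ⟨f5, f6, f7, f8, f9⟩ := bolMap_five_to_nine_odd f
  obtain ⟨g5, g6, g7, g8, g9⟩ := bolMap_five_to_nine_odd g
  rw [weightFive_apply (hasParity_oddField f) (hasParity_oddField g), f5, f6, f7, f8, f9, g5,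
    g6, g7, g8, g9, one_add_one_parity]
  refine SPoly.ext ?_ ?_ <;> simp [-Function.iterate_succ, C_two, C_three, C_four]
  ring

-- The coefficients 4, -3, -2 are forced up to scale: a conformally relative cocycle must obey
-- `conformal_step`, which fixes its origin values on (7,7), (6,8), (5,9) in the ratio -2 : 2 : 1.
-- The cocycle identity itself is an identity between products of derivatives in each parity case.
set_option maxHeartbeats 2000000 in
theorem weightFive_mem_cocycles : weightFive ∈ cocycles 5 ⊥ 2 := by
  refine mem_cocycles_two.2 ⟨superalternating_weightFive, fun p q r S T U hS hT hU => ?_⟩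
  have hC : (C (2 * 5 : ℂ) : ℂ[X]) = 10 := by
    rw [show (2 * 5 : ℂ) = 10 by norm_num]; exact map_ofNat C 10
  obtain rfl | rfl := parity_cases p <;> obtain rfl | rfl := parity_cases q <;>
    obtain rfl | rfl := parity_cases r <;>
    first
      | obtain ⟨f, rfl⟩ := exists_evenField hS
      | obtain ⟨f, rfl⟩ := exists_oddField hS
  all_goals
    first
      | obtain ⟨g, rfl⟩ := exists_evenField hT
      | obtain ⟨g, rfl⟩ := exists_oddField hT
  all_goals
    first
      | obtain ⟨h, rfl⟩ := exists_evenField hU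
      | obtain ⟨h, rfl⟩ := exists_oddField hU
  all_goals
    simp only [br_even_even, br_even_odd, br_odd_even, br_odd_odd, weightFive_even_even,
      weightFive_even_odd, weightFive_odd_even, weightFive_odd_odd,
      parPow_zero, parPow_one, Function.iterate_succ_apply', one_add_one_parity, add_zero,
      zero_add, Function.iterate_zero_apply, mul_zero, mul_one, sgn_zero, sgn_one, neg_smul,
      one_smul]
    refine SPoly.ext ?_ ?_
  all_goals
    simp only [SPoly.fst_sub, SPoly.snd_sub, SPoly.fst_neg, SPoly.snd_neg, SPoly.fst_add,
      SPoly.snd_add, par_fst, par_snd, SPoly.fst_mk, SPoly.snd_mk, SPoly.fst_zero,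
      SPoly.snd_zero, density_even_fst, density_even_snd, density_odd_fst, density_odd_snd, hC,
      derivative_mul, derivative_sub, derivative_add, derivative_neg, derivative_ofNat,
      derivative_zero]
    ring

/-! ### The homogeneous basis -/

/-- The homogeneous basis `𝕏(2)`, `𝕏(2 ξ)`, `𝕏(2 x)`, `𝕏(2 ξ x)`, … of the contact fields. -/
def fieldBasis : Module.Basis ℕ ℂ contact :=
  (((basisMonomials ℂ).prod (basisMonomials ℂ)).reindex Equiv.natSumNatEquivNat).map fieldEquiv

theorem fieldBasis_even (a : ℕ) : fieldBasis (2 * a) = evenField (X ^ a) := by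
  have h : Equiv.natSumNatEquivNat.symm (2 * a) = Sum.inl a := by
    rw [Equiv.symm_apply_eq]; simp
  simp [fieldBasis, h, evenField, monomial_one_right_eq_X_pow]

theorem fieldBasis_odd (a : ℕ) : fieldBasis (2 * a + 1) = oddField (X ^ a) := by
  have h : Equiv.natSumNatEquivNat.symm (2 * a + 1) = Sum.inr a := by
    rw [Equiv.symm_apply_eq]; simp
  simp [fieldBasis, h, oddField, monomial_one_right_eq_X_pow]

theorem cast_even_parity (a : ℕ) : ((2 * a : ℕ) : ZMod 2) = 0 := by
  rw [Nat.cast_mul, show ((2 : ℕ) : ZMod 2) = 0 from rfl, zero_mul]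

theorem cast_odd_parity (a : ℕ) : ((2 * a + 1 : ℕ) : ZMod 2) = 1 := by
  rw [Nat.cast_add, cast_even_parity, Nat.cast_one, zero_add]

theorem hasParity_fieldBasis (n : ℕ) : HasParity (n : ZMod 2) (fieldBasis n) := by
  obtain ⟨a, rfl | rfl⟩ := Nat.even_or_odd' n
  · rw [cast_even_parity, fieldBasis_even]
    exact hasParity_evenField _
  · rw [cast_odd_parity, fieldBasis_odd]
    exact hasParity_oddField _

/-- The structure constants of the contact bracket. -/
def brCoeff (n k : ℕ) : ℂ :=
  if Even n then (if Even k then (k : ℂ) - n else k - 1 - n / 2)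
  else (if Even k then (k : ℂ) / 2 - (n - 1) else 1)

theorem X_pow_mul_derivative (a b : ℕ) :
    (X ^ a * derivative (X ^ b) : ℂ[X]) = (b : ℂ) • X ^ (a + b - 1) := by
  cases b with
  | zero => simp
  | succ b =>
    rw [derivative_X_pow, smul_eq_C_mul, Nat.add_sub_cancel, ← add_assoc, Nat.add_sub_cancel,
      pow_add]
    ring

theorem br_fieldBasis (n k : ℕ) :
    br (fieldBasis n) (fieldBasis k) = brCoeff n k • fieldBasis (n + k - 2) := by
  have h : ∀ m, Even (2 * m) := fun m => ⟨m, by ring⟩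
  have h' : ∀ m, ¬ Even (2 * m + 1) := fun m => by simp
  have key : ∀ a b : ℕ, (derivative (X ^ a) * X ^ b : ℂ[X]) = (a : ℂ) • X ^ (a + b - 1) :=
    fun a b => by rw [mul_comm, X_pow_mul_derivative, add_comm]
  have two : ∀ f : ℂ[X], 2 * f = (2 : ℂ) • f := fun f => by rw [smul_eq_C_mul, C_two]
  obtain ⟨a, rfl | rfl⟩ := Nat.even_or_odd' n <;> obtain ⟨b, rfl | rfl⟩ := Nat.even_or_odd' k
  · rw [fieldBasis_even, fieldBasis_even, br_even_even, X_pow_mul_derivative, key, brCoeff,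
      if_pos (h a), if_pos (h b), show 2 * a + 2 * b - 2 = 2 * (a + b - 1) by omega,
      fieldBasis_even, ← map_smul, two]
    congr 1
    push_cast
    module
  · have e : brCoeff (2 * a) (2 * b + 1) = 2 * b - a := by
      rw [brCoeff, if_pos (h a), if_neg (h' b)]; push_cast; ring
    rw [fieldBasis_even, fieldBasis_odd, br_even_odd, X_pow_mul_derivative, key, e, two,
      smul_smul, ← sub_smul, map_smul]
    rcases Nat.eq_zero_or_pos (a + b) with h0 | h0
    · obtain ⟨rfl, rfl⟩ : a = 0 ∧ b = 0 := by omega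
      simp
    · rw [show 2 * a + (2 * b + 1) - 2 = 2 * (a + b - 1) + 1 by omega, fieldBasis_odd]
  · have e : brCoeff (2 * a + 1) (2 * b) = b - 2 * a := by
      rw [brCoeff, if_neg (h' a), if_pos (h b)]; push_cast; ring
    rw [fieldBasis_even, fieldBasis_odd, br_odd_even, X_pow_mul_derivative, key, e, two,
      smul_smul, ← sub_smul, map_smul]
    rcases Nat.eq_zero_or_pos (a + b) with h0 | h0
    · obtain ⟨rfl, rfl⟩ : a = 0 ∧ b = 0 := by omega
      simp
    · rw [show 2 * a + 1 + 2 * b - 2 = 2 * (a + b - 1) + 1 by omega, fieldBasis_odd]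
  · rw [fieldBasis_odd, fieldBasis_odd, br_odd_odd, brCoeff, if_neg (h' a), if_neg (h' b),
      one_smul, show 2 * a + 1 + (2 * b + 1) - 2 = 2 * (a + b) by omega, fieldBasis_even,
      ← pow_add]

/-! ### Evaluation at the origin -/

/-- The value of `f + ξ g` at the origin, `f(0)`. -/
def evalOrigin : SPoly →ₗ[ℂ] ℂ where
  toFun G := G.fst.eval 0
  map_add' F G := by simp
  map_smul' c G := by simp

theorem evalOrigin_apply (G : SPoly) : evalOrigin G = G.fst.eval 0 := rfl

theorem evalOrigin_parPow (p : ZMod 2) (G : SPoly) : evalOrigin (parPow p G) = evalOrigin G := by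
  obtain rfl | rfl := parity_cases p
  · rw [parPow_zero]
  · rw [parPow_one, evalOrigin_apply, par_fst, evalOrigin_apply]

theorem evalOrigin_density_two (lam : ℂ) (G : SPoly) :
    evalOrigin (density lam (fieldBasis 2) G) = 2 * lam * evalOrigin G := by
  rw [show 2 = 2 * 1 from rfl, fieldBasis_even, evalOrigin_apply, density_even_fst,
    evalOrigin_apply]
  simp

/-- From index 3 on, neither the vector field nor the derivative of its Hamiltonian contributes to
the body at x = 0. For n = 3 that derivative is a multiple of ξ, so it has no body. -/
theorem evalOrigin_density (lam : ℂ) {n : ℕ} (hn : 3 ≤ n) (G : SPoly) :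
    evalOrigin (density lam (fieldBasis n) G) = 0 := by
  obtain ⟨a, rfl | rfl⟩ := Nat.even_or_odd' n
  · rw [fieldBasis_even, evalOrigin_apply, density_even_fst]
    obtain ⟨b, rfl⟩ : ∃ b, a = b + 2 := ⟨a - 2, by omega⟩
    simp
  · rw [fieldBasis_odd, evalOrigin_apply, density_odd_fst]
    obtain ⟨b, rfl⟩ : ∃ b, a = b + 1 := ⟨a - 1, by omega⟩
    simp

/-- The Hamiltonian 2ξ has zero x-derivative, so the weight plays no role. This is what makes the
reduction to the origin uniform in λ. -/
theorem density_fieldBasis_one (lam : ℂ) (G : SPoly) : density lam (fieldBasis 1) G = D G := by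
  rw [show 1 = 2 * 0 + 1 from rfl, fieldBasis_odd]
  refine SPoly.ext ?_ ?_
  · rw [density_odd_fst, D_fst, pow_zero, one_mul]
  · rw [density_odd_snd, D_snd, pow_zero, derivative_one, one_mul, zero_mul, mul_zero, add_zero]

theorem exists_derivative_eq (f : ℂ[X]) : ∃ g : ℂ[X], derivative g = f := by
  induction f using Polynomial.induction_on' with
  | add p q hp hq =>
    obtain ⟨g, rfl⟩ := hp
    obtain ⟨h, rfl⟩ := hq
    exact ⟨g + h, derivative_add⟩
  | monomial n a =>
    refine ⟨monomial (n + 1) (a / (n + 1)), ?_⟩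
    rw [derivative_monomial, Nat.add_sub_cancel]
    push_cast
    rw [div_mul_cancel₀ _ (Nat.cast_add_one_ne_zero n)]

/-- Since `D` sends f + ξg to g + ξf', solving the equation takes one integration, and `b` is its
constant. The parity twist matches the sign in the coboundary. -/
theorem exists_D_eq (G : SPoly) (b : ℂ) :
    ∃ F, D (Superspace.par F) = G ∧ evalOrigin F = b := by
  obtain ⟨g, hg⟩ := exists_derivative_eq G.snd
  refine ⟨SPoly.mk (g - C (g.eval 0) + C b) (-G.fst), SPoly.ext ?_ ?_, ?_⟩
  · simp [D_fst]
  · simp [D_snd, hg]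
  · simp [evalOrigin_apply]

theorem eq_zero_of_D_eq_zero {G : SPoly} (h : D G = 0) (h0 : evalOrigin G = 0) : G = 0 := by
  have h1 := congrArg SPoly.fst h
  have h2 := congrArg SPoly.snd h
  rw [D_fst, SPoly.fst_zero] at h1
  rw [D_snd, SPoly.snd_zero] at h2
  have h3 := eq_C_of_natDegree_eq_zero (derivative_eq_zero.1 h2)
  rw [evalOrigin_apply, h3, eval_C] at h0
  rw [h0, C_0] at h3
  exact SPoly.ext h3 h1

theorem cochain_two_eq_zero {φ : Cochain 2}
    (h : ∀ n k, φ ![fieldBasis n, fieldBasis k] = 0) : φ = 0 := by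
  refine Module.Basis.ext_multilinear (fun _ => fieldBasis) fun v => ?_
  rw [zero_apply, ← h (v 0) (v 1)]
  congr 1
  funext i; fin_cases i <;> rfl

theorem sgn_mul_self (p : ZMod 2) : sgn p * sgn p = 1 := by
  obtain rfl | rfl := parity_cases p <;> simp

theorem sgn_ne_zero (p : ZMod 2) : sgn p ≠ 0 := by
  obtain rfl | rfl := parity_cases p <;> simp

theorem brCoeff_two (k : ℕ) : brCoeff 2 k = k - 2 := by
  by_cases h : Even k <;> simp [brCoeff, h]
  ring

/-! ### Values of cochains at the origin -/

/-- The value at the origin of `φ` on a pair of basis fields. -/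
def originValue (φ : Cochain 2) (n k : ℕ) : ℂ := evalOrigin (φ ![fieldBasis n, fieldBasis k])

theorem originValue_apply (φ : Cochain 2) (n k : ℕ) :
    originValue φ n k = evalOrigin (φ ![fieldBasis n, fieldBasis k]) := rfl

theorem originValue_sub (φ ψ : Cochain 2) (n k : ℕ) :
    originValue (φ - ψ) n k = originValue φ n k - originValue ψ n k := by
  simp [originValue]

theorem originValue_smul (c : ℂ) (φ : Cochain 2) (n k : ℕ) :
    originValue (c • φ) n k = c * originValue φ n k := by
  simp [originValue]

theorem update_left (S S' T : contact) : Function.update ![S, T] 0 S' = ![S', T] := by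
  funext i; fin_cases i <;> rfl

theorem update_right (S T T' : contact) : Function.update ![S, T] 1 T' = ![S, T'] := by
  funext i; fin_cases i <;> rfl

theorem map_smul_left (φ : Cochain 2) (c : ℂ) (S T : contact) :
    φ ![c • S, T] = c • φ ![S, T] := by
  have h := φ.map_update_smul ![S, T] 0 c S
  rwa [update_left, update_left] at h

theorem map_smul_right (φ : Cochain 2) (c : ℂ) (S T : contact) :
    φ ![S, c • T] = c • φ ![S, T] := by
  have h := φ.map_update_smul ![S, T] 1 c T
  rwa [update_right, update_right] at h

section cocycle

variable {lam : ℂ} {φ : Cochain 2}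

theorem swap_fieldBasis (hφ : φ ∈ cocycles lam ⊥ 2) (n k : ℕ) :
    φ ![fieldBasis k, fieldBasis n] =
      -sgn ((n : ZMod 2) * k) • φ ![fieldBasis n, fieldBasis k] :=
  superalternating_two.1 hφ.1.1 _ _ _ _ (hasParity_fieldBasis n) (hasParity_fieldBasis k)

theorem originValue_swap (hφ : φ ∈ cocycles lam ⊥ 2) (n k : ℕ) :
    originValue φ k n = -sgn ((n : ZMod 2) * k) * originValue φ n k := by
  rw [originValue, swap_fieldBasis hφ n k, map_smul, smul_eq_mul, originValue]

theorem originValue_swap_eq_zero (hφ : φ ∈ cocycles lam ⊥ 2) {n k : ℕ}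
    (h : originValue φ n k = 0) : originValue φ k n = 0 := by
  rw [originValue_swap hφ n k, h, mul_zero]

theorem originValue_even_self (hφ : φ ∈ cocycles lam ⊥ 2) (a : ℕ) :
    originValue φ (2 * a) (2 * a) = 0 := by
  have h := originValue_swap hφ (2 * a) (2 * a)
  rw [cast_even_parity, mul_zero, sgn_zero, neg_one_mul] at h
  exact self_eq_neg.1 h

theorem cocycle_fieldBasis (hφ : φ ∈ cocycles lam ⊥ 2) (n k l : ℕ) :
    sgn ((n : ZMod 2) * (k + l)) •
        density lam (fieldBasis n) (parPow n (φ ![fieldBasis k, fieldBasis l]))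
      - sgn ((k : ZMod 2) * l) •
        density lam (fieldBasis k) (parPow k (φ ![fieldBasis n, fieldBasis l]))
      + density lam (fieldBasis l) (parPow l (φ ![fieldBasis n, fieldBasis k]))
      - brCoeff n k • φ ![fieldBasis (n + k - 2), fieldBasis l]
      - sgn ((n : ZMod 2) * k) • brCoeff n l • φ ![fieldBasis k, fieldBasis (n + l - 2)]
      + brCoeff k l • φ ![fieldBasis n, fieldBasis (k + l - 2)] = 0 := by
  have h := cocycle_two hφ (hasParity_fieldBasis n) (hasParity_fieldBasis k)
    (hasParity_fieldBasis l)
  simpa only [br_fieldBasis, map_smul_left, map_smul_right] using h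

/-- All three action terms vanish at the origin, leaving the cocycle equation with trivial
coefficients. -/
theorem originValue_cocycle (hφ : φ ∈ cocycles lam ⊥ 2) {n k l : ℕ} (hn : 3 ≤ n) (hk : 3 ≤ k)
    (hl : 3 ≤ l) : brCoeff n k * originValue φ (n + k - 2) l
      + sgn ((n : ZMod 2) * k) * (brCoeff n l * originValue φ k (n + l - 2))
      - brCoeff k l * originValue φ n (k + l - 2) = 0 := by
  have h := congrArg evalOrigin (cocycle_fieldBasis hφ n k l)
  simp only [map_add, map_sub, map_smul, evalOrigin_density lam hn, evalOrigin_density lam hk,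
    evalOrigin_density lam hl, map_zero, smul_eq_mul, mul_zero, ← originValue_apply] at h
  linear_combination -h

/-- The cocycle identity with the Euler field as first argument: the factor compares the weight of
the pair with that of the coefficients. -/
theorem originValue_euler (hφ : φ ∈ cocycles lam ⊥ 2) {k l : ℕ} (hk : 3 ≤ k) (hl : 3 ≤ l) :
    (2 * lam + 4 - (k + l : ℕ)) * originValue φ k l
      + brCoeff k l * originValue φ 2 (k + l - 2) = 0 := by
  have h := congrArg evalOrigin (cocycle_fieldBasis hφ 2 k l)
  simp only [map_add, map_sub, map_smul, evalOrigin_density lam hk, evalOrigin_density_two,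
    evalOrigin_density lam hl, map_zero, smul_eq_mul, mul_zero, ← originValue_apply, brCoeff_two,
    evalOrigin_parPow, Nat.cast_ofNat, show (2 : ZMod 2) = 0 from rfl, zero_mul, sgn_zero,
    one_mul, Nat.add_sub_cancel_left] at h
  push_cast
  linear_combination h

/-- The field 0 is the bracket of the field 1 with itself, so the identity at (1, 1, n) applies. -/
theorem contraction_zero_eq_zero (hφ : φ ∈ cocycles lam ⊥ 2)
    (h1 : ∀ n, φ ![fieldBasis 1, fieldBasis n] = 0) (n : ℕ) :
    φ ![fieldBasis 0, fieldBasis n] = 0 := by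
  have h := cocycle_fieldBasis hφ 1 1 n
  simpa [h1, brCoeff] using h

/-- Induction on n + k. In the identity at (1, n, k), bracketing with the field 1 lowers the index
sum by one, so only `D` of the value on (n, k) survives. That value is therefore constant, hence
given by its value at the origin. -/
theorem cocycle_two_eq_zero (hφ : φ ∈ cocycles lam ⊥ 2)
    (h1 : ∀ n, φ ![fieldBasis 1, fieldBasis n] = 0)
    (h0 : ∀ n k, 2 ≤ n → 2 ≤ k → originValue φ n k = 0) : φ = 0 := by
  have key : ∀ m n k, n + k = m → φ ![fieldBasis n, fieldBasis k] = 0 := by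
    intro m
    induction m using Nat.strong_induction_on with
    | _ m ih =>
      intro n k hm
      have small : ∀ n < 2, ∀ k, φ ![fieldBasis n, fieldBasis k] = 0 := by
        intro n hn k
        obtain rfl | rfl : n = 0 ∨ n = 1 := by omega
        · exact contraction_zero_eq_zero hφ h1 k
        · exact h1 k
      by_cases hn : n < 2
      · exact small n hn k
      by_cases hk : k < 2
      · rw [swap_fieldBasis hφ k n, small k hk n, smul_zero]
      have h := cocycle_fieldBasis hφ 1 n k
      rw [ih (1 + n - 2 + k) (by omega) _ _ rfl, ih (n + (1 + k - 2)) (by omega) _ _ rfl, h1, h1,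
        h1] at h
      simp only [map_zero, smul_zero, sub_zero, add_zero, density_fieldBasis_one] at h
      have h2 := eq_zero_of_D_eq_zero ((smul_eq_zero.1 h).resolve_left (sgn_ne_zero _))
        (by rw [evalOrigin_parPow]; exact h0 n k (by omega) (by omega))
      rw [← parPow_parPow ((1 : ℕ) : ZMod 2) (φ _), h2, map_zero]
  exact cochain_two_eq_zero fun n k => key _ n k rfl

end cocycle

theorem originValue_oneCoboundary (lam : ℂ) (A : contact →ₗ[ℂ] SPoly) {n k : ℕ} (hn : 3 ≤ n)
    (hk : 3 ≤ k) : originValue (oneCoboundary lam A) n k =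
      -(brCoeff n k * evalOrigin (A (fieldBasis (n + k - 2)))) := by
  rw [originValue, oneCoboundary_apply lam A (hasParity_fieldBasis n) (hasParity_fieldBasis k),
    br_fieldBasis]
  simp [evalOrigin_density lam hn, evalOrigin_density lam hk]

theorem originValue_oneCoboundary_two (lam : ℂ) (A : contact →ₗ[ℂ] SPoly) {k : ℕ}
    (hk : 3 ≤ k) : originValue (oneCoboundary lam A) 2 k =
      (2 * lam + 2 - k) * evalOrigin (A (fieldBasis k)) := by
  rw [originValue, oneCoboundary_apply lam A (hasParity_fieldBasis 2) (hasParity_fieldBasis k),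
    br_fieldBasis]
  simp [evalOrigin_density lam hk, evalOrigin_density_two, brCoeff_two, evalOrigin_parPow,
    show (2 : ZMod 2) = 0 from rfl]
  ring

/-- The values of `A` on the basis are built recursively: making the contraction vanish on the field
n + 1 is a `D`-equation for the value there, with the value on the field n as data. Its constant of
integration is the prescribed `b`. -/
theorem exists_oneCoboundary_contraction {lam : ℂ} {φ : Cochain 2}
    (hφ : φ ∈ cocycles lam ⊥ 2) (b : ℕ → ℂ) : ∃ A : contact →ₗ[ℂ] SPoly,
      (∀ n, (φ - oneCoboundary lam A) ![fieldBasis 1, fieldBasis n] = 0) ∧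
      ∀ n, 2 ≤ n → evalOrigin (A (fieldBasis n)) = b n := by
  -- On the pair (1, 1) both action terms equal minus the same `D`-value, whence the factor -1/2.
  obtain ⟨g₁, hg₁, -⟩ := exists_D_eq (-(1 / 2 : ℂ) • φ ![fieldBasis 1, fieldBasis 1]) 0
  have step : ∀ (n : ℕ) (G : SPoly), ∃ F, D (Superspace.par F) =
      sgn (n + 1 : ℕ) • (φ ![fieldBasis 1, fieldBasis (n + 1)]
        + density lam (fieldBasis (n + 1)) (parPow (n + 1 : ℕ) g₁) + brCoeff 1 (n + 1) • G) ∧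
      evalOrigin F = b (n + 1) := fun n G => exists_D_eq _ _
  choose s hs hsb using step
  -- The value on the field 0 may be taken to be zero: the contraction vanishes there automatically,
  -- because the identity at (1, 1, 1) yields three times the value on (1, 0).
  let g : ℕ → SPoly := Nat.rec 0 fun n G => if n = 0 then g₁ else s n G
  have g0 : g 0 = 0 := rfl
  have g1 : g 1 = g₁ := rfl
  have gs : ∀ n, n ≠ 0 → g (n + 1) = s n (g n) := fun n hn => if_neg hn
  let A : contact →ₗ[ℂ] SPoly := fieldBasis.constr ℂ g
  have hA : ∀ n, A (fieldBasis n) = g n := fun n => fieldBasis.constr_basis ℂ g n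
  refine ⟨A, ?_, fun n hn => ?_⟩
  · set ψ := φ - oneCoboundary lam A with hψ
    have hψc : ψ ∈ cocycles lam ⊥ 2 := sub_mem hφ (oneCoboundary_mem lam A)
    have val : ∀ n, ψ ![fieldBasis 1, fieldBasis n] = φ ![fieldBasis 1, fieldBasis n]
        - (sgn n • D (Superspace.par (g n)) - density lam (fieldBasis n) (parPow n g₁)
          - brCoeff 1 n • g (1 + n - 2)) := by
      intro n
      rw [hψ, sub_apply, oneCoboundary_apply lam A (hasParity_fieldBasis 1)
        (hasParity_fieldBasis n), br_fieldBasis, map_smul, hA, hA, hA, g1, Nat.cast_one, one_mul,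
        parPow_one, density_fieldBasis_one]
    have v1 : ψ ![fieldBasis 1, fieldBasis 1] = 0 := by
      rw [val, g1, g0, Nat.cast_one, parPow_one, density_fieldBasis_one, hg₁, sgn_one]
      module
    intro n
    match n with
    | 0 =>
      have h := cocycle_fieldBasis hψc 1 1 1
      have h2 := swap_fieldBasis hψc 1 0
      simp only [show 1 + 1 - 2 = 0 from rfl, v1, h2] at h
      generalize ψ ![fieldBasis 1, fieldBasis 0] = v at h ⊢
      simp [brCoeff] at h
      have h3 : (3 : ℂ) • v = 0 := by
        refine Eq.trans ?_ h
        module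
      exact (smul_eq_zero.1 h3).resolve_left three_ne_zero
    | 1 => exact v1
    | n + 2 =>
      rw [val, gs (n + 1) n.succ_ne_zero, hs, smul_smul, sgn_mul_self, one_smul,
        show 1 + (n + 2) - 2 = n + 1 by omega]
      abel
  · obtain ⟨m, rfl⟩ : ∃ m, n = m + 1 := ⟨n - 1, by omega⟩
    rw [hA, gs m (by omega), hsb]

/-- A `2`-cocycle is cohomologous to one which is relative to the nilradical and whose values
at the origin vanish except in the weight of the coefficients. -/
theorem exists_normalized {lam : ℂ} {φ : Cochain 2} (hφ : φ ∈ cocycles lam ⊥ 2) :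
    ∃ ψ ∈ cocycles lam ⊥ 2, φ - ψ ∈ coboundaries lam ⊥ 2 ∧
      (∀ n, ψ ![fieldBasis 1, fieldBasis n] = 0) ∧
      (∀ m : ℕ, 3 ≤ m → (m : ℂ) ≠ 2 * lam + 2 → originValue ψ 2 m = 0) ∧
      (∀ m : ℕ, 3 ≤ m → (m : ℂ) + 1 = 2 * lam + 2 → m ≠ 4 → originValue ψ 3 m = 0) := by
  -- Off the weight, the constant cancels the value on (2, n), on which the coboundary acts by 2λ +
  -- 2 - n. At n = 2λ + 2 that factor vanishes, so the constant is spent on the pair (3, n - 1)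
  -- instead.
  obtain ⟨A, h1, hb⟩ := exists_oneCoboundary_contraction hφ fun n =>
    if (n : ℂ) = 2 * lam + 2 then -(originValue φ 3 (n - 1) / brCoeff 3 (n - 1))
    else originValue φ 2 n / (2 * lam + 2 - n)
  refine ⟨φ - oneCoboundary lam A, sub_mem hφ (oneCoboundary_mem lam A), ?_, h1,
    fun m hm hne => ?_, fun m hm he hne => ?_⟩
  · rw [sub_sub_cancel]
    exact oneCoboundary_mem_coboundaries lam A
  · rw [originValue_sub, originValue_oneCoboundary_two lam A hm, hb m (by omega), if_neg hne,
      mul_div_cancel₀ _ (sub_ne_zero.2 hne.symm), sub_self]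
  -- The fields 3 and 4 commute, which is why m = 4 is left out.
  · have hc : brCoeff 3 m ≠ 0 := by
      obtain ⟨a, rfl | rfl⟩ := Nat.even_or_odd' m
      · simp [brCoeff, show ¬ Even 3 by decide]
        intro h
        refine hne ?_
        have h2 : (a : ℂ) = 2 := by linear_combination h
        have h3 : a = 2 := by exact_mod_cast h2
        omega
      · simp [brCoeff, show ¬ Even 3 by decide]
    have hb' := hb (m + 1) (by omega)
    rw [if_pos (by push_cast; exact he), Nat.add_sub_cancel] at hb'
    rw [originValue_sub, originValue_oneCoboundary lam A le_rfl hm,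
      show 3 + m - 2 = m + 1 by omega, hb']
    field_simp
    ring

/-! ### Degree one -/

section cocycleOne

variable {lam : ℂ} {A : contact →ₗ[ℂ] SPoly}

theorem cocycleOne_fieldBasis (hA : oneForm A ∈ cocycles lam ⊥ 1) (n k : ℕ) :
    sgn ((n : ZMod 2) * k) • density lam (fieldBasis n) (parPow n (A (fieldBasis k)))
      - density lam (fieldBasis k) (parPow k (A (fieldBasis n)))
      - brCoeff n k • A (fieldBasis (n + k - 2)) = 0 := by
  have h := mem_cocycles_one.1 hA _ _ _ _ (hasParity_fieldBasis n) (hasParity_fieldBasis k)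
  rwa [br_fieldBasis, map_smul] at h

theorem cocycle_one_eq_zero (hA : oneForm A ∈ cocycles lam ⊥ 1) (h1 : A (fieldBasis 1) = 0)
    (h0 : ∀ n, 2 ≤ n → evalOrigin (A (fieldBasis n)) = 0) : A = 0 := by
  refine fieldBasis.ext fun n => ?_
  rw [LinearMap.zero_apply]
  induction n using Nat.strong_induction_on with
  | _ n ih =>
    match n with
    | 0 =>
      have h := cocycleOne_fieldBasis hA 1 1
      simpa [h1, brCoeff] using h
    | 1 => exact h1
    | n + 2 =>
      have h := cocycleOne_fieldBasis hA 1 (n + 2)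
      rw [show 1 + (n + 2) - 2 = n + 1 by omega, ih (n + 1) (by omega), h1, map_zero, map_zero,
        smul_zero, sub_zero, sub_zero, density_fieldBasis_one] at h
      have h2 := eq_zero_of_D_eq_zero ((smul_eq_zero.1 h).resolve_left (sgn_ne_zero _))
        (by rw [evalOrigin_parPow]; exact h0 (n + 2) (by omega))
      rw [← parPow_parPow ((1 : ℕ) : ZMod 2) (A _), h2, map_zero]

/-- A nonzero origin value on a field n ≥ 3 forces n = 2λ + 2 by the Euler field, and forbids the
field n from being a bracket of two fields of index at least 3. Only 3 and 5 escape. -/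
theorem exists_normalized_one (hA : oneForm A ∈ cocycles lam ⊥ 1) :
    ∃ B, oneForm B ∈ cocycles lam ⊥ 1 ∧ oneForm A - oneForm B ∈ coboundaries lam ⊥ 1 ∧
      B (fieldBasis 1) = 0 ∧ ∀ n, 2 ≤ n → evalOrigin (B (fieldBasis n)) ≠ 0 →
        n = 2 ∧ lam = 0 ∨ n = 3 ∧ lam = 1 / 2 ∨ n = 5 ∧ lam = 3 / 2 := by
  -- The constant kills the origin value on the Euler field. For λ = 0 the quotient is the default
  -- value 0, which is harmless since that case is retained in the conclusion.
  obtain ⟨f, hf, hfb⟩ := exists_D_eq (A (fieldBasis 1)) (evalOrigin (A (fieldBasis 2)) / (2 * lam))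
  set B := A - zeroCoboundary lam f with hB
  have e : oneForm B = oneForm A - oneForm (zeroCoboundary lam f) := rfl
  have hBc : oneForm B ∈ cocycles lam ⊥ 1 := by
    rw [e]
    exact sub_mem hA (zeroCoboundary_mem lam f)
  have h1 : B (fieldBasis 1) = 0 := by
    rw [hB, LinearMap.sub_apply, zeroCoboundary_apply lam f (hasParity_fieldBasis 1),
      Nat.cast_one, parPow_one, density_fieldBasis_one, hf, sub_self]
  refine ⟨B, hBc, ?_, h1, fun n hn hne => ?_⟩
  · rw [e, sub_sub_cancel]
    exact zeroCoboundary_mem_coboundaries lam f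
  · have hbr : ∀ k l, 3 ≤ k → 3 ≤ l → k + l - 2 = n → brCoeff k l = 0 := by
      intro k l hk hl hkl
      have h := congrArg evalOrigin (cocycleOne_fieldBasis hBc k l)
      simp only [map_sub, map_smul, evalOrigin_density lam hk, evalOrigin_density lam hl,
        map_zero, smul_eq_mul, mul_zero, sub_zero, zero_sub, neg_eq_zero, hkl] at h
      exact (mul_eq_zero.1 h).resolve_right hne
    have heu : 3 ≤ n → (n : ℂ) = 2 * lam + 2 := by
      intro hn3
      have h := congrArg evalOrigin (cocycleOne_fieldBasis hBc 2 n)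
      simp only [map_sub, map_smul, evalOrigin_density lam hn3, evalOrigin_density_two,
        evalOrigin_parPow, brCoeff_two, Nat.add_sub_cancel_left, map_zero, smul_eq_mul,
        Nat.cast_ofNat, show (2 : ZMod 2) = 0 from rfl, zero_mul, sgn_zero, one_mul,
        sub_zero] at h
      have h2 : (2 * lam - (n - 2)) * evalOrigin (B (fieldBasis n)) = 0 := by
        linear_combination h
      linear_combination -((mul_eq_zero.1 h2).resolve_right hne)
    obtain rfl | rfl | rfl | rfl | h6 : n = 2 ∨ n = 3 ∨ n = 4 ∨ n = 5 ∨ 6 ≤ n := by omega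
    · refine Or.inl ⟨rfl, by_contra fun h0 => hne ?_⟩
      rw [hB, LinearMap.sub_apply, zeroCoboundary_apply lam f (hasParity_fieldBasis 2), map_sub,
        evalOrigin_density_two, evalOrigin_parPow, hfb]
      field_simp
      ring
    · refine Or.inr (Or.inl ⟨rfl, ?_⟩)
      have h := heu le_rfl
      push_cast at h
      linear_combination -h / 2
    · have h := hbr 3 3 le_rfl le_rfl rfl
      simp [brCoeff, show ¬ Even 3 by decide] at h
    · refine Or.inr (Or.inr ⟨rfl, ?_⟩)
      have h := heu (by omega)
      push_cast at h
      linear_combination -h / 2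
    · exfalso
      -- An even n is the index of a bracket of two odd fields, with coefficient 1. For an odd n the
      -- field 4 serves, with a coefficient that vanishes only at n = 5.
      obtain ⟨a, rfl | rfl⟩ := Nat.even_or_odd' n
      · have h := hbr 3 (2 * (a - 1) + 1) le_rfl (by omega) (by omega)
        simp [brCoeff, show ¬ Even 3 by decide] at h
      · have h := hbr 4 (2 * (a - 1) + 1) (by omega) (by omega) (by omega)
        obtain ⟨b, rfl⟩ : ∃ b, a = b + 3 := ⟨a - 3, by omega⟩
        simp [brCoeff, show Even 4 by decide] at h
        have h2 : (2 * (b + 3 - 1 : ℕ) : ℂ) = (2 : ℕ) := by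
          push_cast at h ⊢
          linear_combination h
        have h3 : 2 * (b + 3 - 1) = 2 := by exact_mod_cast h2
        omega

end cocycleOne

/-! ### The Bol cochains -/

/-- The value at the origin of the Bol operator of order `k` on the `k`-th basis field. -/
def bolConst (k : ℕ) : ℂ := (-1) ^ (k / 2) * (2 * (k / 2).factorial)

theorem bolConst_ne_zero (k : ℕ) : bolConst k ≠ 0 := by
  simp [bolConst, Nat.factorial_ne_zero]

theorem eval_iterate_derivative_X_pow (m a : ℕ) :
    (derivative^[m] (X ^ a : ℂ[X])).eval 0 = if a = m then (m.factorial : ℂ) else 0 := by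
  rw [iterate_derivative_X_pow_eq_natCast_mul]
  split_ifs with h
  · subst h
    simp [Nat.descFactorial_self]
  · rcases lt_or_gt_of_ne h with h | h
    · simp [Nat.descFactorial_of_lt h]
    · simp [show a - m ≠ 0 by omega]

/-- At the origin the Bol maps form, up to nonzero constants, the basis dual to the fields. The
origin values of cup products thus become Kronecker deltas. -/
theorem evalOrigin_bolMap (k n : ℕ) :
    evalOrigin (bolMap k (fieldBasis n)) = if n = k then bolConst k else 0 := by
  have e0 : ∀ m, 2 * m / 2 = m := fun m => by omega
  have e1 : ∀ m, (2 * m + 1) / 2 = m := fun m => by omega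
  obtain ⟨m, rfl | rfl⟩ := Nat.even_or_odd' k <;> obtain ⟨a, rfl | rfl⟩ := Nat.even_or_odd' n
  · rw [fieldBasis_even, bolMap_two_mul_even, evalOrigin_apply, SPoly.fst_mk, bolConst, e0]
    simp only [eval_mul, eval_pow, eval_neg, eval_one, eval_ofNat, eval_iterate_derivative_X_pow,
      mul_ite, mul_zero, Nat.mul_right_inj two_ne_zero]
  · rw [fieldBasis_odd, bolMap_two_mul_odd, evalOrigin_apply, SPoly.fst_mk, eval_zero,
      if_neg (by omega)]
  · rw [fieldBasis_even, bolMap_two_mul_add_one_even, evalOrigin_apply, SPoly.fst_mk, eval_zero,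
      if_neg (by omega)]
  · rw [fieldBasis_odd, bolMap_two_mul_add_one_odd, evalOrigin_apply, SPoly.fst_mk, bolConst, e1]
    simp only [eval_mul, eval_pow, eval_neg, eval_one, eval_ofNat, eval_iterate_derivative_X_pow,
      mul_ite, mul_zero, Nat.mul_right_inj two_ne_zero, Nat.add_right_cancel_iff]

/-- Each application of `Dbar` lowers the index by one, and it kills the constants. Hence order 3
annihilates the affine subalgebra and order 5 the conformal one. -/
theorem bolMap_fieldBasis_eq_zero {k n : ℕ} (h : n < k) : bolMap k (fieldBasis n) = 0 := by
  induction k with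
  | zero => omega
  | succ k ih =>
    rcases Nat.lt_succ_iff_lt_or_eq.1 h with h | rfl
    · rw [bolMap_succ, ih h, map_zero]
    · have e : ∀ a, derivative^[a + 1] (X ^ a : ℂ[X]) = 0 := fun a =>
        iterate_derivative_eq_zero (by simp)
      obtain ⟨a, rfl | rfl⟩ := Nat.even_or_odd' n
      · rw [fieldBasis_even, bolMap_two_mul_add_one_even, e, mul_zero, mul_zero]
        exact SPoly.ext (by simp) (by simp)
      · rw [fieldBasis_odd, show 2 * a + 1 + 1 = 2 * (a + 1) by ring, bolMap_two_mul_odd, e,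
          mul_zero, mul_zero]
        exact SPoly.ext (by simp) (by simp)

theorem evalOrigin_mul (F G : SPoly) : evalOrigin (F * G) = evalOrigin F * evalOrigin G := by
  simp [evalOrigin_apply]

theorem originValue_cup (b : ZMod 2) (i j n k : ℕ) :
    originValue (cup b (bolMap i) (bolMap j)) n k =
      sgn (n * b) * ((if n = i then bolConst i else 0) * (if k = j then bolConst j else 0))
      - sgn (k * (n + b)) *
        ((if k = i then bolConst i else 0) * (if n = j then bolConst j else 0)) := by
  rw [originValue, cup_apply _ _ _ (hasParity_fieldBasis n) (hasParity_fieldBasis k)]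
  simp only [map_sub, map_smul, smul_eq_mul, evalOrigin_mul, evalOrigin_bolMap]

theorem cup_fieldBasis_eq_zero (b : ZMod 2) {i j n : ℕ} (hi : n < i) (hj : n < j) (k : ℕ) :
    cup b (bolMap i) (bolMap j) ![fieldBasis n, fieldBasis k] = 0 := by
  rw [cup_apply _ _ _ (hasParity_fieldBasis n) (hasParity_fieldBasis k),
    bolMap_fieldBasis_eq_zero hi, bolMap_fieldBasis_eq_zero hj]
  simp

/-! ### Coboundaries at the origin -/

theorem coboundaries_one {lam : ℂ} {φ : Cochain 1} (hφ : φ ∈ coboundaries lam ⊥ 1) :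
    ∃ f, φ = oneForm (zeroCoboundary lam f) := by
  obtain ⟨A, rfl⟩ := eq_oneForm φ
  obtain ⟨-, χ, -, h⟩ := hφ
  refine ⟨χ ![], congrArg oneForm (fieldBasis.ext fun n => ?_)⟩
  rw [zeroCoboundary_apply lam _ (hasParity_fieldBasis n)]
  have h1 := h (fun _ => n) (fun _ => fieldBasis n) fun _ => hasParity_fieldBasis n
  rwa [coboundary_deg_zero] at h1

theorem coboundaries_two {lam : ℂ} {φ : Cochain 2} (hφ : φ ∈ coboundaries lam ⊥ 2) :
    ∃ A, φ = oneCoboundary lam A := by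
  obtain ⟨-, χ, -, h⟩ := hφ
  obtain ⟨A, rfl⟩ := eq_oneForm χ
  refine ⟨A, sub_eq_zero.1 (cochain_two_eq_zero fun n k => ?_)⟩
  have h1 := h ![n, k] ![fieldBasis n, fieldBasis k] (by
    intro i
    fin_cases i
    · exact hasParity_fieldBasis n
    · exact hasParity_fieldBasis k)
  rw [coboundary_deg_one] at h1
  rw [sub_apply, h1, oneCoboundary_apply lam A (hasParity_fieldBasis n) (hasParity_fieldBasis k)]
  exact sub_self _

/-! ### Relative cochains -/

theorem x_pow (n : ℕ) : x ^ n = SPoly.mk (X ^ n) 0 := by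
  induction n with
  | zero => exact SPoly.ext (by simp) (by simp)
  | succ n ih =>
    rw [pow_succ, ih, x]
    exact SPoly.ext (by simp [pow_succ]) (by simp)

theorem eEven_eq (n : ℕ) : eEven n = (2⁻¹ : ℂ) • fieldBasis (2 * n) := by
  rw [fieldBasis_even, evenField_eq, ← map_smul, eEven, x_pow]
  congr 1
  refine SPoly.ext ?_ ?_
  · simp [C_half_mul]
  · simp

theorem eOdd_eq (n : ℕ) : eOdd n = fieldBasis (2 * n + 1) := by
  rw [fieldBasis_odd, oddField_eq, eOdd, ← map_smul, x_pow]
  congr 1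
  refine SPoly.ext ?_ ?_ <;> simp [ξ, C_two]

theorem eEven_mem {h : Submodule ℂ contact} {n : ℕ} (hn : fieldBasis (2 * n) ∈ h) :
    eEven n ∈ h := by
  rw [eEven_eq]
  exact h.smul_mem _ hn

theorem fieldBasis_even_mem {h : Submodule ℂ contact} {n : ℕ} (hn : eEven n ∈ h) :
    fieldBasis (2 * n) ∈ h := by
  rw [eEven_eq] at hn
  exact (h.smul_mem_iff (inv_ne_zero two_ne_zero)).1 hn

theorem nilradical_le {h : Submodule ℂ contact} (hh : ∀ n < 2, fieldBasis n ∈ h) :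
    nilradical ≤ h := by
  refine Submodule.span_le.2 ?_
  rintro _ (rfl | rfl)
  · exact eEven_mem (hh 0 (by omega))
  · rw [eOdd_eq]; exact hh 1 (by omega)

theorem affine_le {h : Submodule ℂ contact} (hh : ∀ n < 3, fieldBasis n ∈ h) : affine ≤ h := by
  refine Submodule.span_le.2 ?_
  rintro _ (rfl | rfl | rfl)
  · exact eEven_mem (hh 0 (by omega))
  · rw [eOdd_eq]; exact hh 1 (by omega)
  · exact eEven_mem (hh 2 (by omega))

theorem conformal_le {h : Submodule ℂ contact} (hh : ∀ n < 5, fieldBasis n ∈ h) :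
    conformal ≤ h := by
  refine Submodule.span_le.2 ?_
  rintro _ (rfl | rfl | rfl | rfl | rfl)
  · exact eEven_mem (hh 0 (by omega))
  · rw [eOdd_eq]; exact hh 1 (by omega)
  · exact eEven_mem (hh 2 (by omega))
  · rw [eOdd_eq]; exact hh 3 (by omega)
  · exact eEven_mem (hh 4 (by omega))

theorem fieldBasis_two_mem_affine : fieldBasis 2 ∈ affine :=
  fieldBasis_even_mem (n := 1) (Submodule.subset_span (by simp))

theorem fieldBasis_mem_conformal {n : ℕ} (hn : n < 5) : fieldBasis n ∈ conformal := by
  interval_cases n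
  · exact fieldBasis_even_mem (n := 0) (Submodule.subset_span (by simp))
  · rw [← eOdd_eq 0]; exact Submodule.subset_span (by simp)
  · exact fieldBasis_even_mem (n := 1) (Submodule.subset_span (by simp))
  · rw [← eOdd_eq 1]; exact Submodule.subset_span (by simp)
  · exact fieldBasis_even_mem (n := 2) (Submodule.subset_span (by simp))

/-- Needed because `cup` splits its arguments into homogeneous parts. -/
theorem part_mem_conformal (p : ZMod 2) {S : contact} (hS : S ∈ conformal) :
    part p S ∈ conformal := by
  have h : conformal ≤ conformal.comap (part p) := conformal_le fun n hn => by
    rw [Submodule.mem_comap, part_of_hasParity (hasParity_fieldBasis n)]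
    split_ifs
    · exact fieldBasis_mem_conformal hn
    · exact zero_mem _
  exact h hS

/-- With one argument in `h`, the cocycle identity is the invariance condition up to the action of
the other argument on the value at the first. Asking only that this action vanish, not the value, is
what lets θ through. -/
theorem invariant_one {lam : ℂ} {h : Submodule ℂ contact} {A : contact →ₗ[ℂ] SPoly}
    (hA : oneForm A ∈ cocycles lam ⊥ 1)
    (h0 : ∀ T ∈ h, ∀ p q S, HasParity p S → density lam S (parPow q (A T)) = 0) :
    IsInvariant lam h (oneForm A) := by
  intro p S hS q T hT hq
  have h1 := mem_cocycles_one.1 hA _ _ _ _ hq (hS 0)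
  rw [h0 T hT _ _ _ (hS 0), sub_zero] at h1
  have i0 : Finset.Iio (0 : Fin 1) = ∅ := by decide
  simpa [i0] using sub_eq_zero.1 h1

theorem relCochains_one {lam : ℂ} {h : Submodule ℂ contact} {A : contact →ₗ[ℂ] SPoly}
    (hA : oneForm A ∈ cocycles lam ⊥ 1) (h0 : h ≤ LinearMap.ker A) :
    oneForm A ∈ relCochains lam h 1 := by
  have h1 : ∀ T ∈ h, A T = 0 := fun T hT => LinearMap.mem_ker.1 (h0 hT)
  refine ⟨superalternating_one _, fun S i hi => ?_, invariant_one hA fun T hT p q S _ => ?_⟩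
  · obtain rfl : i = 0 := Subsingleton.elim _ _
    exact h1 _ hi
  · rw [h1 T hT, map_zero, map_zero]

/-- Cartan's formula: for a cocycle, vanishing contractions with `h` already imply invariance. -/
theorem relative_cocycles_two {lam : ℂ} {h : Submodule ℂ contact} {φ : Cochain 2}
    (hφ : φ ∈ cocycles lam ⊥ 2) (h0 : ∀ S i, S i ∈ h → φ S = 0) : φ ∈ cocycles lam h 2 := by
  refine ⟨⟨hφ.1.1, h0, fun p S hS q T hT hq => ?_⟩, hφ.2⟩
  have h1 := cocycle_two hφ hq (hS 0) (hS 1)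
  have v : ∀ U, φ ![T, U] = 0 := fun U => h0 _ 0 hT
  have e : ![S 0, S 1] = S := by funext i; fin_cases i <;> rfl
  have e0 : Function.update S 0 (br T (S 0)) = ![br T (S 0), S 1] := by
    funext i; fin_cases i <;> rfl
  have e1 : Function.update S 1 (br T (S 1)) = ![S 0, br T (S 1)] := by
    funext i; fin_cases i <;> rfl
  have i0 : Finset.Iio (0 : Fin 2) = ∅ := by decide
  have i1 : Finset.Iio (1 : Fin 2) = {0} := by decide
  rw [v, v, v, e] at h1
  rw [Fin.sum_univ_two, Fin.sum_univ_two, e0, e1, i0, i1, Finset.sum_empty,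
    Finset.sum_singleton, mul_zero, sgn_zero, one_smul, ← sub_eq_zero, ← h1]
  simp only [map_zero, smul_zero]
  abel

theorem cup_conformal_eq_zero (b : ZMod 2) {i j : ℕ} (hi : 5 ≤ i) (hj : 5 ≤ j)
    (S : Fin 2 → contact) (k : Fin 2) (hk : S k ∈ conformal) :
    cup b (bolMap i) (bolMap j) S = 0 := by
  have v : ∀ {m : ℕ}, 5 ≤ m → ∀ p, bolMap m (part p (S k)) = 0 := fun {m} hm p =>
    LinearMap.mem_ker.1 (conformal_le (h := LinearMap.ker (bolMap m))
      (fun n hn => bolMap_fieldBasis_eq_zero (by omega)) (part_mem_conformal p hk))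
  simp only [cup, MultilinearMap.coe_mk]
  refine Finset.sum_eq_zero fun p _ => Finset.sum_eq_zero fun q _ => ?_
  fin_cases k
  · have h1 := v hi p
    have h2 := v hj p
    simp only [Fin.zero_eta] at h1 h2
    simp [h1, h2]
  · have h1 := v hi q
    have h2 := v hj q
    simp only [Fin.mk_one] at h1 h2
    simp [h1, h2]

/-! ### Classes -/

theorem cls_eq_zero_iff {lam : ℂ} {h : Submodule ℂ contact} {n : ℕ} {φ : Cochain n}
    (hφ : φ ∈ cocycles lam h n) : cls hφ = 0 ↔ φ ∈ coboundaries lam h n := by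
  rw [cls, Submodule.Quotient.mk_eq_zero]
  rfl

theorem span_cls_eq_top {lam : ℂ} {h : Submodule ℂ contact} {n : ℕ} {φ : Cochain n}
    (hφ : φ ∈ cocycles lam h n)
    (H : ∀ ψ ∈ cocycles lam h n, ∃ c : ℂ, ψ - c • φ ∈ coboundaries lam h n) :
    Submodule.span ℂ {cls hφ} = ⊤ := by
  refine Submodule.eq_top_iff'.2 fun w => ?_
  obtain ⟨⟨ψ, hψ⟩, rfl⟩ := Submodule.Quotient.mk_surjective _ w
  obtain ⟨c, hc⟩ := H ψ hψ
  refine Submodule.mem_span_singleton.2 ⟨c, ?_⟩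
  rw [cls, ← Submodule.Quotient.mk_smul, eq_comm, Submodule.Quotient.eq]
  exact hc

theorem subsingleton_cohomology {lam : ℂ} {h : Submodule ℂ contact} {n : ℕ}
    (H : ∀ ψ ∈ cocycles lam h n, ψ ∈ coboundaries lam h n) :
    Subsingleton (Cohomology lam h n) := by
  refine subsingleton_of_forall_eq 0 fun w => ?_
  obtain ⟨⟨ψ, hψ⟩, rfl⟩ := Submodule.Quotient.mk_surjective _ w
  exact (cls_eq_zero_iff hψ).2 (H ψ hψ)

/-! ### Degree two -/

theorem normalized_eq_zero {lam : ℂ} {ψ : Cochain 2} (hψ : ψ ∈ cocycles lam ⊥ 2)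
    (h1 : ∀ n, ψ ![fieldBasis 1, fieldBasis n] = 0)
    (h2 : ∀ m, 3 ≤ m → originValue ψ 2 m = 0)
    (h3 : ∀ k l, 3 ≤ k → 3 ≤ l → originValue ψ k l = 0) : ψ = 0 := by
  refine cocycle_two_eq_zero hψ h1 fun n k hn hk => ?_
  rcases hn.eq_or_lt with rfl | hn
  · rcases hk.eq_or_lt with rfl | hk
    · exact originValue_even_self hψ 1
    · exact h2 k hk
  · rcases hk.eq_or_lt with rfl | hk
    · exact originValue_swap_eq_zero hψ (h2 n hn)
    · exact h3 n k hn hk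

section normalized

variable {lam : ℂ} {ψ : Cochain 2}

theorem originValue_eq_zero_of_weight (hψ : ψ ∈ cocycles lam ⊥ 2)
    (h2 : ∀ m : ℕ, 3 ≤ m → (m : ℂ) ≠ 2 * lam + 2 → originValue ψ 2 m = 0) {k l : ℕ}
    (hk : 3 ≤ k) (hl : 3 ≤ l) (hkl : ((k + l : ℕ) : ℂ) ≠ 2 * lam + 4) :
    originValue ψ k l = 0 := by
  have h := originValue_euler hψ hk hl
  rw [h2 (k + l - 2) (by omega) (by
    rw [Nat.cast_sub (by omega)]
    intro h
    apply hkl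
    push_cast at h ⊢
    linear_combination h), mul_zero, add_zero] at h
  exact (mul_eq_zero.1 h).resolve_left (sub_ne_zero.2 hkl.symm)

/-- By the bound on the sum, the smaller index is 3, 4 or 5. Pairs (3, m) with m ≠ 4 are normalized
away; the identity at (3,3,3) gives three times the value on (3,4); the identities at (3,3,5) and
(3,3,6) express (4,5) and (4,6) through (3,6) and (3,7); and (4,4) vanishes by skew-symmetry. -/
theorem originValue_eq_zero_of_le (hψ : ψ ∈ cocycles lam ⊥ 2)
    (h3 : ∀ m : ℕ, 3 ≤ m → (m : ℂ) + 1 = 2 * lam + 2 → m ≠ 4 → originValue ψ 3 m = 0) {k l : ℕ}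
    (hk : 3 ≤ k) (hl : 3 ≤ l) (hkl : ((k + l : ℕ) : ℂ) = 2 * lam + 4) (h10 : k + l ≤ 10)
    (h55 : ¬ (k = 5 ∧ l = 5)) : originValue ψ k l = 0 := by
  have o3 : ¬ Even 3 := by decide
  have e4 : Even 4 := by decide
  have o5 : ¬ Even 5 := by decide
  have e6 : Even 6 := by decide
  have three : ∀ m, 3 ≤ m → m ≠ 4 → m + 3 = k + l → originValue ψ 3 m = 0 := by
    intro m hm h4 he
    refine h3 m hm ?_ h4
    rw [← he] at hkl
    push_cast at hkl
    linear_combination hkl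
  have v34 : 7 = k + l → originValue ψ 3 4 = 0 := by
    intro he
    have h := originValue_cocycle hψ (le_refl 3) (le_refl 3) (le_refl 3)
    have hs := originValue_swap hψ 3 4
    simp [brCoeff, o3, show (3 : ZMod 2) = 1 from rfl, show (4 : ZMod 2) = 0 from rfl] at h hs
    rw [hs] at h
    linear_combination -h / 3
  have v45 : 9 = k + l → originValue ψ 4 5 = 0 := by
    intro he
    have h := originValue_cocycle hψ (le_refl 3) (le_refl 3) (show 3 ≤ 5 by omega)
    simpa [brCoeff, o3, o5, three 6 (by omega) (by omega) (by omega)] using h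
  have v46 : 10 = k + l → originValue ψ 4 6 = 0 := by
    intro he
    have h := originValue_cocycle hψ (le_refl 3) (le_refl 3) (show 3 ≤ 6 by omega)
    simpa [brCoeff, o3, e6, three 7 (by omega) (by omega) (by omega)] using h
  have main : ∀ i j, 3 ≤ i → i ≤ j → i + j = k + l → ¬ (i = 5 ∧ j = 5) →
      originValue ψ i j = 0 := by
    intro i j hi hij he hne
    obtain rfl | rfl | rfl : i = 3 ∨ i = 4 ∨ i = 5 := by omega
    · by_cases hj : j = 4
      · subst hj
        exact v34 he
      · exact three j (by omega) hj (by omega)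
    · obtain rfl | rfl | rfl : j = 4 ∨ j = 5 ∨ j = 6 := by omega
      · exact originValue_even_self hψ 2
      · exact v45 he
      · exact v46 he
    · omega
  rcases le_total k l with h | h
  · exact main k l hk h rfl h55
  · exact originValue_swap_eq_zero hψ (main l k hl h (add_comm _ _) fun h => h55 h.symm)

/-- At the critical weight the Euler identity reduces to the coefficient of [k, l] times the value
on (2, k + l - 2). No pair of indices at least 3 reaches m = 3, and for m = 5 the only pair, 3 and
4, commutes. -/
theorem originValue_two_eq_zero (hψ : ψ ∈ cocycles lam ⊥ 2) {m : ℕ} (hm : 3 ≤ m)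
    (h8 : m ≤ 8) (h : (m : ℂ) = 2 * lam + 2) (hm3 : m ≠ 3) (hm5 : m ≠ 5) :
    originValue ψ 2 m = 0 := by
  have key : ∀ k l, 3 ≤ k → 3 ≤ l → k + l - 2 = m → brCoeff k l ≠ 0 → originValue ψ 2 m = 0 := by
    intro k l hk hl he hne
    have h1 := originValue_euler hψ hk hl
    rw [he, show ((k + l : ℕ) : ℂ) = 2 * lam + 4 by
      rw [show k + l = m + 2 by omega]
      push_cast
      linear_combination h, sub_self, zero_mul, zero_add] at h1
    exact (mul_eq_zero.1 h1).resolve_left hne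
  obtain rfl | rfl | rfl | rfl : m = 4 ∨ m = 6 ∨ m = 7 ∨ m = 8 := by omega
  · exact key 3 3 le_rfl le_rfl rfl (by simp [brCoeff, show ¬ Even 3 by decide])
  · exact key 3 5 le_rfl (by omega) rfl
      (by simp [brCoeff, show ¬ Even 3 by decide, show ¬ Even 5 by decide])
  · exact key 4 5 (by omega) (by omega) rfl
      (by simp [brCoeff, show Even 4 by decide, show ¬ Even 5 by decide]; norm_num)
  · exact key 5 5 (by omega) (by omega) rfl (by simp [brCoeff, show ¬ Even 5 by decide])

end normalized

/-- The last exclusion keeps the critical index sum 2λ + 4 at most 10 whenever it is a natural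
number. The three other excluded weights are those of the pairs (2,3), (2,5) and (5,5). -/
theorem mem_coboundaries_two {lam : ℂ} (h1 : lam ≠ 1 / 2) (h2 : lam ≠ 3 / 2) (h3 : lam ≠ 3)
    (h7 : ∀ m : ℕ, 2 * lam ≠ 7 + m) {φ : Cochain 2} (hφ : φ ∈ cocycles lam ⊥ 2) :
    φ ∈ coboundaries lam ⊥ 2 := by
  obtain ⟨ψ, hψ, hd, k1, k2, k3⟩ := exists_normalized hφ
  have small : ∀ N : ℕ, (N : ℂ) = 2 * lam + 4 → N ≤ 10 := by
    intro N hN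
    by_contra hlt
    obtain ⟨m, rfl⟩ : ∃ m, N = m + 11 := ⟨N - 11, by omega⟩
    refine h7 m ?_
    push_cast at hN
    linear_combination -hN
  have h0 : ψ = 0 := by
    refine normalized_eq_zero hψ k1 (fun m hm => ?_) fun k l hk hl => ?_
    · by_cases he : (m : ℂ) = 2 * lam + 2
      · have h8 := small (m + 2) (by push_cast; linear_combination he)
        refine originValue_two_eq_zero hψ hm (by omega) he ?_ ?_
        · rintro rfl
          push_cast at he
          exact h1 (by linear_combination -he / 2)
        · rintro rfl
          push_cast at he
          exact h2 (by linear_combination -he / 2)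
      · exact k2 m hm he
    · by_cases he : ((k + l : ℕ) : ℂ) = 2 * lam + 4
      · refine originValue_eq_zero_of_le hψ k3 hk hl he (small _ he) ?_
        rintro ⟨rfl, rfl⟩
        push_cast at he
        exact h3 (by linear_combination -he / 2)
      · exact originValue_eq_zero_of_weight hψ k2 hk hl he
  rwa [h0, sub_zero] at hd

/-- Spanning reduces to proportionality of origin values, since a cocycle killed by the contraction
with the field 1 is determined by them. -/
theorem exists_sub_smul_mem_coboundaries_two {lam : ℂ} {χ : Cochain 2}
    (hχ : χ ∈ cocycles lam ⊥ 2) (c1 : ∀ n, χ ![fieldBasis 1, fieldBasis n] = 0)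
    (H : ∀ ψ ∈ cocycles lam ⊥ 2,
      (∀ m : ℕ, 3 ≤ m → (m : ℂ) ≠ 2 * lam + 2 → originValue ψ 2 m = 0) →
      (∀ m : ℕ, 3 ≤ m → (m : ℂ) + 1 = 2 * lam + 2 → m ≠ 4 → originValue ψ 3 m = 0) →
      ∃ c : ℂ, (∀ m, 3 ≤ m → originValue ψ 2 m = c * originValue χ 2 m) ∧
        ∀ k l, 3 ≤ k → 3 ≤ l → originValue ψ k l = c * originValue χ k l) :
    ∀ φ ∈ cocycles lam ⊥ 2, ∃ c : ℂ, φ - c • χ ∈ coboundaries lam ⊥ 2 := by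
  intro φ hφ
  obtain ⟨ψ, hψ, hd, k1, k2, k3⟩ := exists_normalized hφ
  obtain ⟨c, hc2, hc3⟩ := H ψ hψ k2 k3
  refine ⟨c, ?_⟩
  have h0 : ψ - c • χ = 0 := by
    refine normalized_eq_zero (sub_mem hψ (Submodule.smul_mem _ c hχ)) (fun n => ?_)
      (fun m hm => ?_) fun k l hk hl => ?_
    · rw [sub_apply, smul_apply, k1, c1, smul_zero, sub_zero]
    · rw [originValue_sub, originValue_smul, hc2 m hm, sub_self]
    · rw [originValue_sub, originValue_smul, hc3 k l hk hl, sub_self]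
  rwa [← sub_eq_zero.1 h0]

/-- The cup products `θ ∪ α` and `θ ∪ β` span the second cohomology. -/
theorem span_theta_cup {lam : ℂ} {j : ℕ} (hj : j = 3 ∨ j = 5) (hlam : (j : ℂ) = 2 * lam + 2)
    (hχ : cup 1 (bolMap 2) (bolMap j) ∈ cocycles lam ⊥ 2) :
    ∀ φ ∈ cocycles lam ⊥ 2,
      ∃ c : ℂ, φ - c • cup 1 (bolMap 2) (bolMap j) ∈ coboundaries lam ⊥ 2 := by
  refine exists_sub_smul_mem_coboundaries_two hχ
    (cup_fieldBasis_eq_zero 1 (by omega) (by omega)) fun ψ hψ k2 k3 => ?_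
  have hv : originValue (cup 1 (bolMap 2) (bolMap j)) 2 j = bolConst 2 * bolConst j := by
    rw [originValue_cup]
    simp [show (2 : ZMod 2) = 0 from rfl, show j ≠ 2 by omega]
  -- The pair (2, j) is the only one with first index 2 at the critical weight. The pairs with both
  -- indices at least 3 have sum at most 7, below (5,5).
  refine ⟨originValue ψ 2 j / (bolConst 2 * bolConst j), fun m hm => ?_, fun k l hk hl => ?_⟩
  · by_cases hmj : m = j
    · rw [hmj, hv, div_mul_cancel₀ _ (mul_ne_zero (bolConst_ne_zero _) (bolConst_ne_zero _))]
    · rw [k2 m hm (by rw [← hlam]; exact_mod_cast hmj), originValue_cup]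
      simp [hmj, show m ≠ 2 by omega]
  · rw [originValue_cup, if_neg (show k ≠ 2 by omega), if_neg (show l ≠ 2 by omega)]
    simp only [zero_mul, mul_zero, sub_zero]
    by_cases he : ((k + l : ℕ) : ℂ) = 2 * lam + 4
    · have h5 : k + l = j + 2 := by
        have h : ((k + l : ℕ) : ℂ) = (j + 2 : ℕ) := by
          push_cast at he ⊢
          linear_combination he - hlam
        exact_mod_cast h
      exact originValue_eq_zero_of_le hψ k3 hk hl he (by omega) (by omega)
    · exact originValue_eq_zero_of_weight hψ k2 hk hl he

theorem span_beta_cup_beta (hχ : cup 1 (bolMap 5) (bolMap 5) ∈ cocycles 3 ⊥ 2) :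
    ∀ φ ∈ cocycles 3 ⊥ 2,
      ∃ c : ℂ, φ - c • cup 1 (bolMap 5) (bolMap 5) ∈ coboundaries 3 ⊥ 2 := by
  refine exists_sub_smul_mem_coboundaries_two hχ
    (cup_fieldBasis_eq_zero 1 (by omega) (by omega)) fun ψ hψ k2 k3 => ?_
  have hv : originValue (cup 1 (bolMap 5) (bolMap 5)) 5 5 ≠ 0 := by
    rw [originValue_cup]
    simp [show (5 : ZMod 2) = 1 from rfl, one_add_one_parity, bolConst]
    norm_num
  refine ⟨originValue ψ 5 5 / originValue (cup 1 (bolMap 5) (bolMap 5)) 5 5, fun m hm => ?_,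
    fun k l hk hl => ?_⟩
  · have h0 : originValue (cup 1 (bolMap 5) (bolMap 5)) 2 m = 0 := by
      rw [originValue_cup]
      simp
    rw [h0, mul_zero]
    by_cases he : (m : ℂ) = 2 * 3 + 2
    · have h8 : m = 8 := by
        have h : (m : ℂ) = (8 : ℕ) := by rw [he]; norm_num
        exact_mod_cast h
      subst h8
      exact originValue_two_eq_zero hψ hm le_rfl he (by omega) (by omega)
    · exact k2 m hm he
  · by_cases h55 : k = 5 ∧ l = 5
    · obtain ⟨rfl, rfl⟩ := h55
      rw [div_mul_cancel₀ _ hv]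
    · have h0 : originValue (cup 1 (bolMap 5) (bolMap 5)) k l = 0 := by
        rw [originValue_cup]
        by_cases hk5 : k = 5
        · simp [hk5, show l ≠ 5 from fun h => h55 ⟨hk5, h⟩]
        · simp [hk5]
      rw [h0, mul_zero]
      by_cases he : ((k + l : ℕ) : ℂ) = 2 * 3 + 4
      · have h10 : k + l = 10 := by
          have h : ((k + l : ℕ) : ℂ) = (10 : ℕ) := by rw [he]; norm_num
          exact_mod_cast h
        exact originValue_eq_zero_of_le hψ k3 hk hl he h10.le h55
      · exact originValue_eq_zero_of_weight hψ k2 hk hl he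

/-! ### Non-trivial classes -/

/-- On the field k every coboundary vanishes at the origin, and so does a relative cocycle, whereas
the Bol map of order k does not. -/
theorem not_isRelativeClass_bolMap {lam : ℂ} {h : Submodule ℂ contact} {k : ℕ}
    (hk : 3 ≤ k ∨ k = 2 ∧ lam = 0) (hmem : fieldBasis k ∈ h) :
    ¬ IsRelativeClass lam h (oneForm (bolMap k)) := by
  rintro ⟨ψ, hψ, hd⟩
  obtain ⟨f, hf⟩ := coboundaries_one hd
  have h1 := congrArg (fun χ : Cochain 1 => evalOrigin (χ fun _ => fieldBasis k)) hf
  simp only [sub_apply, oneForm_apply, hψ.1.2.1 (fun _ => fieldBasis k) 0 hmem, sub_zero,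
    zeroCoboundary_apply lam f (hasParity_fieldBasis k), evalOrigin_bolMap, if_true] at h1
  refine bolConst_ne_zero k (h1.trans ?_)
  rcases hk with hk | ⟨rfl, rfl⟩
  · exact evalOrigin_density lam hk _
  · rw [evalOrigin_density_two, mul_zero, zero_mul]

theorem bolMap_notMem_coboundaries {lam : ℂ} {k : ℕ} (hk : 3 ≤ k ∨ k = 2 ∧ lam = 0) :
    oneForm (bolMap k) ∉ coboundaries lam ⊥ 1 := fun h =>
  -- A trivial class is relative to everything, since it contains 0.
  not_isRelativeClass_bolMap (h := ⊤) hk trivial ⟨0, zero_mem _, by rwa [sub_zero]⟩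

/-- The pair (2, j) with j = 2λ + 2 separates: coboundaries and affine-relative cocycles both vanish
there at the origin. -/
theorem not_isRelativeClass_theta_cup {lam : ℂ} {j : ℕ} (hj : 3 ≤ j)
    (hlam : (j : ℂ) = 2 * lam + 2) :
    ¬ IsRelativeClass lam affine (cup 1 (bolMap 2) (bolMap j)) := by
  rintro ⟨ψ, hψ, hd⟩
  obtain ⟨A, hA⟩ := coboundaries_two hd
  have h1 := congrArg (fun χ => originValue χ 2 j) hA
  have h2 : originValue ψ 2 j = 0 := by
    rw [originValue, hψ.1.2.1 _ 0 fieldBasis_two_mem_affine, map_zero]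
  simp only [originValue_sub, h2, sub_zero, originValue_oneCoboundary_two lam A hj, ← hlam,
    sub_self, zero_mul, originValue_cup] at h1
  simp [show (2 : ZMod 2) = 0 from rfl, show j ≠ 2 by omega, bolConst_ne_zero] at h1

/-- Both pairs consist of odd fields with bracket exactly the field 4a, so a coboundary takes the
same origin value on them. -/
theorem notMem_coboundaries_two {lam : ℂ} {χ : Cochain 2} {a : ℕ} (ha : 2 ≤ a)
    (h1 : originValue χ (2 * a + 1) (2 * a + 1) ≠ 0)
    (h2 : originValue χ 3 (2 * (2 * a - 2) + 3) = 0) : χ ∉ coboundaries lam ⊥ 2 := by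
  intro h
  obtain ⟨A, rfl⟩ := coboundaries_two h
  rw [originValue_oneCoboundary lam A (by omega) (by omega),
    show 2 * a + 1 + (2 * a + 1) - 2 = 4 * a by omega] at h1
  rw [originValue_oneCoboundary lam A le_rfl (by omega),
    show 3 + (2 * (2 * a - 2) + 3) - 2 = 4 * a by omega] at h2
  have o3 : ¬ Even 3 := by decide
  have o : ¬ Even (2 * (2 * a - 2) + 3) := by
    rw [Nat.not_even_iff_odd]
    exact ⟨2 * a - 2 + 1, by ring⟩
  simp [brCoeff, o3, o] at h1 h2
  exact h1 h2

/-! ### Conformally relative cohomology -/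

section conformal

variable {lam : ℂ} {ψ : Cochain 2}

theorem originValue_conformal_left (hψ : ψ ∈ cocycles lam conformal 2) {n : ℕ} (hn : n < 5)
    (k : ℕ) : originValue ψ n k = 0 := by
  rw [originValue, hψ.1.2.1 _ 0 (fieldBasis_mem_conformal hn), map_zero]

theorem originValue_conformal_right (hψ : ψ ∈ cocycles lam conformal 2) {n : ℕ} (hn : n < 5)
    (k : ℕ) : originValue ψ k n = 0 := by
  rw [originValue, hψ.1.2.1 _ 1 (fieldBasis_mem_conformal hn), map_zero]

theorem conformal_eq_zero (hψ : ψ ∈ cocycles lam conformal 2)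
    (h : ∀ k l, 5 ≤ k → 5 ≤ l → ((k + l : ℕ) : ℂ) = 2 * lam + 4 → originValue ψ k l = 0) :
    ψ = 0 := by
  have hψ' := cocycles_le_bot _ _ _ hψ
  refine normalized_eq_zero hψ' (fun n => hψ.1.2.1 _ 0 (fieldBasis_mem_conformal (by omega)))
    (fun m _ => originValue_conformal_left hψ (by omega) m) fun k l hk hl => ?_
  by_cases hk5 : k < 5
  · exact originValue_conformal_left hψ hk5 l
  by_cases hl5 : l < 5
  · exact originValue_conformal_right hψ hl5 k
  by_cases he : ((k + l : ℕ) : ℂ) = 2 * lam + 4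
  · exact h k l (by omega) (by omega) he
  · exact originValue_eq_zero_of_weight hψ'
      (fun m _ _ => originValue_conformal_left hψ (by omega) m) hk hl he

theorem brCoeff_three_ne_zero {k : ℕ} (hk : 5 ≤ k) : brCoeff 3 k ≠ 0 := by
  obtain ⟨a, rfl | rfl⟩ := Nat.even_or_odd' k
  · simp [brCoeff, show ¬ Even 3 by decide]
    intro h
    have h2 : (a : ℂ) = (2 : ℕ) := by push_cast; linear_combination h
    have h3 : a = 2 := by exact_mod_cast h2
    omega
  · simp [brCoeff, show ¬ Even 3 by decide]

/-- The field 3 lies in the conformal subalgebra, so one of the three terms of the cocycle equation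
drops out. The coefficients left are nonzero from index 5 on, so one vanishing origin value forces
all those with the same index sum to vanish (`conformal_propagate`). -/
theorem conformal_step (hψ : ψ ∈ cocycles lam conformal 2) {k l : ℕ} (hk : 5 ≤ k) (hl : 5 ≤ l) :
    brCoeff 3 k * originValue ψ (k + 1) l
      + sgn k * (brCoeff 3 l * originValue ψ k (l + 1)) = 0 := by
  have h := originValue_cocycle (cocycles_le_bot _ _ _ hψ) (le_refl 3)
    (show 3 ≤ k by omega) (show 3 ≤ l by omega)
  rw [originValue_conformal_left hψ (show 3 < 5 by omega), show 3 + k - 2 = k + 1 by omega,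
    show 3 + l - 2 = l + 1 by omega, mul_zero, sub_zero, show ((3 : ℕ) : ZMod 2) = 1 from rfl,
    one_mul] at h
  exact h

theorem conformal_shift (hψ : ψ ∈ cocycles lam conformal 2) (d : ℕ) :
    ∀ {k l : ℕ}, 5 ≤ k → 5 ≤ l →
      (originValue ψ (k + d) l = 0 ↔ originValue ψ k (l + d) = 0) := by
  induction d with
  | zero => intros; rfl
  | succ d ih =>
    intro k l hk hl
    have h := conformal_step hψ (show 5 ≤ k + d by omega) hl
    have h1 := brCoeff_three_ne_zero (show 5 ≤ k + d by omega)
    have h2 := brCoeff_three_ne_zero hl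
    have h3 := sgn_ne_zero ((k + d : ℕ) : ZMod 2)
    generalize sgn ((k + d : ℕ) : ZMod 2) = s at h h3
    rw [show l + (d + 1) = l + 1 + d by ring, ← ih hk (show 5 ≤ l + 1 by omega), ← add_assoc]
    constructor <;> intro h0 <;> simpa [h0, h1, h2, h3] using h

theorem conformal_propagate (hψ : ψ ∈ cocycles lam conformal 2) {i j k l : ℕ} (hi : 5 ≤ i)
    (hj : 5 ≤ j) (hk : 5 ≤ k) (hl : 5 ≤ l) (hs : i + j = k + l)
    (h : originValue ψ i j = 0) : originValue ψ k l = 0 := by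
  rcases le_total i k with hik | hik
  · obtain ⟨d, rfl⟩ := Nat.exists_eq_add_of_le hik
    obtain rfl : j = l + d := by omega
    exact (conformal_shift hψ d hi hl).2 h
  · obtain ⟨d, rfl⟩ := Nat.exists_eq_add_of_le hik
    obtain rfl : l = j + d := by omega
    exact (conformal_shift hψ d hk hj).1 h

theorem conformal_cocycle_eq_zero (h3 : lam ≠ 3) (h5 : lam ≠ 5)
    (h13 : ∀ m : ℕ, lam ≠ 13 / 2 + 2 * m) (h7 : ∀ m : ℕ, lam ≠ 7 + 2 * m)
    (hψ : ψ ∈ cocycles lam conformal 2) : ψ = 0 := by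
  have hψ' := cocycles_le_bot _ _ _ hψ
  refine conformal_eq_zero hψ fun k l hk hl he => ?_
  have hlam : lam = ((k + l : ℕ) - 4) / 2 := by linear_combination -he / 2
  obtain ⟨j, hj⟩ : ∃ j, k + l = 4 * j ∨ k + l = 4 * j + 1 ∨ k + l = 4 * j + 2 ∨
    k + l = 4 * j + 3 := ⟨(k + l) / 4, by omega⟩
  rcases hj with hj | hj | hj | hj
  -- An index sum 4j contains the pair (2j, 2j) of equal even fields, which skew-symmetry kills.
  · exact conformal_propagate hψ (show 5 ≤ 2 * j by omega) (show 5 ≤ 2 * j by omega) hk hl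
      (by omega) (originValue_even_self hψ' j)
  · obtain rfl | ⟨m, rfl⟩ : j = 3 ∨ ∃ m, j = m + 4 := by
      by_cases h : j = 3
      · exact Or.inl h
      · exact Or.inr ⟨j - 4, by omega⟩
    · refine conformal_propagate hψ (show 5 ≤ 5 by omega) (show 5 ≤ 8 by omega) hk hl
        (by omega) ?_
      -- At index sum 13, that is λ = 9/2, the recursion alone gives nothing; the identity at
      -- (5,5,5) yields three times the value on (5,8).
      have h := originValue_cocycle hψ' (show 3 ≤ 5 by omega) (show 3 ≤ 5 by omega)
        (show 3 ≤ 5 by omega)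
      have hs := originValue_swap hψ' 5 8
      simp [brCoeff, show ¬ Even 5 by decide, show (5 : ZMod 2) = 1 from rfl,
        show (8 : ZMod 2) = 0 from rfl] at h hs
      rw [hs] at h
      linear_combination -h / 3
    · refine absurd ?_ (h13 m)
      rw [hlam, hj]
      push_cast
      ring
  · obtain rfl | rfl | ⟨m, rfl⟩ : j = 2 ∨ j = 3 ∨ ∃ m, j = m + 4 := by
      by_cases h : j < 4
      · omega
      · exact Or.inr (Or.inr ⟨j - 4, by omega⟩)
    · refine absurd ?_ h3
      rw [hlam, hj]
      push_cast
      norm_num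
    · refine absurd ?_ h5
      rw [hlam, hj]
      push_cast
      norm_num
    · refine absurd ?_ (h7 m)
      rw [hlam, hj]
      push_cast
      ring
  · refine conformal_propagate hψ (show 5 ≤ 2 * j + 1 by omega) (show 5 ≤ 2 * j + 2 by omega) hk
      hl (by omega) ?_
    -- At index sum 4j + 3 the recursion makes the value symmetric under exchanging 2j + 1 and 2j +
    -- 2, while skew-symmetry makes it antisymmetric.
    have h := conformal_step hψ (show 5 ≤ 2 * j + 1 by omega) (show 5 ≤ 2 * j + 1 by omega)
    have hs := originValue_swap hψ' (2 * j + 1) (2 * j + 1 + 1)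
    rw [cast_odd_parity, show 2 * j + 1 + 1 = 2 * (j + 1) by ring, cast_even_parity, mul_zero,
      sgn_zero] at hs
    rw [cast_odd_parity, sgn_one, show 2 * j + 1 + 1 = 2 * (j + 1) by ring, hs] at h
    simp [brCoeff, show ¬ Even 3 by decide] at h
    exact h

theorem conformal_exists_eq_smul {χ : Cochain 2} (hχ : χ ∈ cocycles lam conformal 2) {i : ℕ}
    (hi : 5 ≤ i) (hlam : ((i + i : ℕ) : ℂ) = 2 * lam + 4) (h0 : originValue χ i i ≠ 0) :
    ∀ φ ∈ cocycles lam conformal 2, ∃ c : ℂ, φ - c • χ ∈ coboundaries lam conformal 2 := by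
  intro φ hφ
  refine ⟨originValue φ i i / originValue χ i i, ?_⟩
  have hd := sub_mem hφ (Submodule.smul_mem _ (originValue φ i i / originValue χ i i) hχ)
  rw [conformal_eq_zero hd fun k l hk hl he => ?_]
  · exact zero_mem _
  · refine conformal_propagate hd hi hi hk hl ?_ ?_
    · rw [← hlam] at he
      exact_mod_cast he.symm
    · rw [originValue_sub, originValue_smul, div_mul_cancel₀ _ h0, sub_self]

theorem finrank_conformal_eq_one {χ : Cochain 2} (hχ : χ ∈ cocycles lam conformal 2)
    (h0 : χ ∉ coboundaries lam ⊥ 2)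
    (H : ∀ φ ∈ cocycles lam conformal 2, ∃ c : ℂ, φ - c • χ ∈ coboundaries lam conformal 2) :
    Module.finrank ℂ (Cohomology lam conformal 2) = 1 := by
  have hne : cls hχ ≠ 0 := fun h =>
    h0 (coboundaries_le_bot lam conformal 2 ((cls_eq_zero_iff hχ).1 h))
  exact (finrank_eq_one_iff_of_nonzero _ hne).2 (span_cls_eq_top hχ H)

end conformal

theorem weightFive_mem_conformal : weightFive ∈ cocycles 5 conformal 2 := by
  refine relative_cocycles_two weightFive_mem_cocycles fun S k hk => ?_
  rw [weightFive, sub_apply, sub_apply, smul_apply, smul_apply, smul_apply,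
    cup_conformal_eq_zero 1 (by omega) (by omega) S k hk,
    cup_conformal_eq_zero 1 (by omega) (by omega) S k hk,
    cup_conformal_eq_zero 0 (by omega) (by omega) S k hk]
  simp

theorem originValue_weightFive : originValue weightFive 7 7 ≠ 0 := by
  simp only [weightFive, originValue_sub, originValue_smul, originValue_cup]
  simp [show (7 : ZMod 2) = 1 from rfl, one_add_one_parity, bolConst, Nat.factorial]
  norm_num

theorem weightFive_notMem_coboundaries : weightFive ∉ coboundaries 5 ⊥ 2 :=
  notMem_coboundaries_two (a := 3) (by omega) originValue_weightFive
    (originValue_conformal_left weightFive_mem_conformal (by omega) _)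

theorem originValue_beta_cup_beta : originValue (cup 1 betaMap betaMap) 5 5 ≠ 0 := by
  rw [betaMap, originValue_cup]
  simp [show (5 : ZMod 2) = 1 from rfl, one_add_one_parity, bolConst]
  norm_num

theorem beta_cup_beta_notMem_coboundaries : cup 1 betaMap betaMap ∉ coboundaries 3 ⊥ 2 := by
  refine notMem_coboundaries_two (a := 2) le_rfl originValue_beta_cup_beta ?_
  rw [betaMap, originValue_cup]
  simp

/-! ### Degrees zero and one -/

theorem mem_coboundaries_one {lam : ℂ} (h0 : lam ≠ 0) (h1 : lam ≠ 1 / 2) (h3 : lam ≠ 3 / 2)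
    {φ : Cochain 1} (hφ : φ ∈ cocycles lam ⊥ 1) : φ ∈ coboundaries lam ⊥ 1 := by
  obtain ⟨A, rfl⟩ := eq_oneForm φ
  obtain ⟨B, hB, hd, hB1, hv⟩ := exists_normalized_one hφ
  have hB0 : B = 0 := cocycle_one_eq_zero hB hB1 fun n hn => by
    by_contra hne
    rcases hv n hn hne with h | h | h
    exacts [h0 h.2, h1 h.2, h3 h.2]
  have hz : oneForm B = 0 := by rw [hB0]; rfl
  rwa [hz, sub_zero] at hd

theorem exists_sub_smul_mem_coboundaries_one {lam : ℂ} {k : ℕ}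
    (hk : k = 2 ∧ lam = 0 ∨ k = 3 ∧ lam = 1 / 2 ∨ k = 5 ∧ lam = 3 / 2) :
    ∀ φ ∈ cocycles lam ⊥ 1, ∃ c : ℂ, φ - c • oneForm (bolMap k) ∈ coboundaries lam ⊥ 1 := by
  intro φ hφ
  obtain ⟨A, rfl⟩ := eq_oneForm φ
  obtain ⟨B, hB, hd, hB1, hv⟩ := exists_normalized_one hφ
  have h13 : (1 / 2 : ℂ) ≠ 3 / 2 := by norm_num
  have h10 : (1 / 2 : ℂ) ≠ 0 := by norm_num
  have h30 : (3 / 2 : ℂ) ≠ 0 := by norm_num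
  have hvk : ∀ n, 2 ≤ n → n ≠ k → evalOrigin (B (fieldBasis n)) = 0 := by
    intro n hn hne
    by_contra h
    rcases hv n hn h with h | h | h <;> rcases hk with k1 | k1 | k1 <;>
      first
        | exact hne (h.1.trans k1.1.symm)
        | exact h10 (h.2.symm.trans k1.2)
        | exact h10 (k1.2.symm.trans h.2)
        | exact h30 (h.2.symm.trans k1.2)
        | exact h30 (k1.2.symm.trans h.2)
        | exact h13 (h.2.symm.trans k1.2)
        | exact h13 (k1.2.symm.trans h.2)
  set c := evalOrigin (B (fieldBasis k)) / bolConst k with hc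
  refine ⟨c, ?_⟩
  have hk2 : 2 ≤ k := by omega
  have hz : B - c • bolMap k = 0 := by
    have hm := sub_mem hB (Submodule.smul_mem _ c (bolMap_mem_cocycles hk))
    have e : oneForm B - c • oneForm (bolMap k) = oneForm (B - c • bolMap k) := rfl
    rw [e] at hm
    refine cocycle_one_eq_zero hm ?_ fun n hn => ?_
    · rw [LinearMap.sub_apply, LinearMap.smul_apply, hB1,
        bolMap_fieldBasis_eq_zero (by omega), smul_zero, sub_zero]
    · rw [LinearMap.sub_apply, LinearMap.smul_apply, map_sub, map_smul, evalOrigin_bolMap,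
        smul_eq_mul]
      split_ifs with h
      · rw [h, hc, div_mul_cancel₀ _ (bolConst_ne_zero k), sub_self]
      · rw [hvk n hn h, mul_zero, sub_zero]
  have e : oneForm (c • bolMap k) = c • oneForm (bolMap k) := rfl
  rwa [sub_eq_zero.1 hz, e] at hd

/-- An invariant is killed by `D`, hence constant, and the Euler field multiplies it by 2λ. -/
theorem eq_smul_one_of_cocycle {lam : ℂ} {φ : Cochain 0} (hφ : φ ∈ cocycles lam ⊥ 0) :
    (∃ c : ℂ, φ = c • oneCochain) ∧ (lam ≠ 0 → φ = 0) := by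
  have h1 := mem_cocycles_zero.1 hφ _ _ (hasParity_fieldBasis 1)
  have h2 := congrArg evalOrigin (mem_cocycles_zero.1 hφ _ _ (hasParity_fieldBasis 2))
  rw [density_fieldBasis_one] at h1
  rw [evalOrigin_density_two, evalOrigin_parPow, map_zero] at h2
  set c := evalOrigin (φ ![]) with hc
  have hD : D (1 : SPoly) = 0 := by
    refine SPoly.ext ?_ ?_ <;> simp [D_fst, D_snd]
  have hp : parPow ((1 : ℕ) : ZMod 2) (1 : SPoly) = 1 := by
    rw [Nat.cast_one, parPow_one]
    refine SPoly.ext ?_ ?_ <;> simp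
  have h3 : φ ![] = c • 1 := by
    have h4 := eq_zero_of_D_eq_zero (G := parPow ((1 : ℕ) : ZMod 2) (φ ![] - c • 1))
      (by rw [map_sub, map_sub, map_smul, map_smul, hp, hD, h1, smul_zero, sub_zero])
      (by rw [evalOrigin_parPow, map_sub, map_smul, ← hc]; simp [evalOrigin_apply])
    rw [← sub_eq_zero, ← parPow_parPow ((1 : ℕ) : ZMod 2) (φ ![] - c • 1), h4, map_zero]
  have h5 : φ = c • oneCochain := by
    ext v : 1
    rw [Subsingleton.elim v ![], h3]
    rfl
  refine ⟨⟨c, h5⟩, fun hl => ?_⟩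
  have h6 : c = 0 := by simpa [hl] using h2
  rw [h5, h6, zero_smul]

theorem oneCochain_mem_cocycles : oneCochain ∈ cocycles 0 ⊥ 0 := by
  refine mem_cocycles_zero.2 fun p S hS => ?_
  have h1 : oneCochain ![] = 1 := rfl
  rw [h1]
  obtain rfl | rfl := parity_cases p
  · obtain ⟨f, rfl⟩ := exists_evenField hS
    refine SPoly.ext ?_ ?_ <;> simp [parPow_zero, density_even_fst, density_even_snd]
  · obtain ⟨f, rfl⟩ := exists_oddField hS
    refine SPoly.ext ?_ ?_ <;> simp [parPow_one, density_odd_fst, density_odd_snd]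

/-- On the affine subalgebra θ takes constant values, nonzero only through the Euler field, and
constants are invariant at weight 0. -/
theorem theta_invariant : IsInvariant 0 affine theta := by
  refine invariant_one (bolMap_mem_cocycles (by simp)) fun T hT p q S hS => ?_
  have hle : affine ≤ (Submodule.span ℂ {(1 : SPoly)}).comap (bolMap 2) := by
    refine affine_le fun n hn => ?_
    rw [Submodule.mem_comap]
    rcases Nat.lt_succ_iff_lt_or_eq.1 hn with h | rfl
    · rw [bolMap_fieldBasis_eq_zero h]
      exact zero_mem _
    · refine Submodule.mem_span_singleton.2 ⟨-2, ?_⟩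
      rw [show bolMap 2 = bolMap (2 * 1) from rfl, show fieldBasis 2 = fieldBasis (2 * 1) from rfl,
        fieldBasis_even, bolMap_two_mul_even]
      refine SPoly.ext ?_ ?_ <;> simp [C_two]
  obtain ⟨c, hc⟩ := Submodule.mem_span_singleton.1 (hle hT)
  have h1 : parPow q (1 : SPoly) = parPow p 1 := by
    have h : ∀ q, parPow q (1 : SPoly) = 1 := by
      intro q
      obtain rfl | rfl := parity_cases q
      · rw [parPow_zero]
      · rw [parPow_one]
        refine SPoly.ext ?_ ?_ <;> simp
    rw [h, h]
  rw [thetaMap, ← hc, map_smul, map_smul, h1]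
  have h2 := mem_cocycles_zero.1 oneCochain_mem_cocycles p S hS
  rw [show oneCochain ![] = 1 from rfl] at h2
  rw [h2, smul_zero]

end ContactSuperline

/-! ### Assembly of the proposition -/

open ContactSuperline in
theorem proposition3 :
    open ContactSuperline in
    -- (a) the 0-cohomology
    ((∃ h1 : oneCochain ∈ cocycles 0 ⊥ 0, cls h1 ≠ 0 ∧ Submodule.span ℂ {cls h1} = ⊤) ∧
      ∀ lam : ℂ, lam ≠ 0 → Subsingleton (Cohomology lam ⊥ 0)) ∧
    -- `θ`, `α`, `β` and the listed cup products are cocycles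
    ∃ (hθ : theta ∈ cocycles 0 ⊥ 1)
      (hα : alpha ∈ cocycles (1 / 2) ⊥ 1)
      (hβ : beta ∈ cocycles (3 / 2) ⊥ 1)
      (hθα : cup 1 thetaMap alphaMap ∈ cocycles (1 / 2) ⊥ 2)
      (hθβ : cup 1 thetaMap betaMap ∈ cocycles (3 / 2) ⊥ 2)
      (hββ : cup 1 betaMap betaMap ∈ cocycles 3 ⊥ 2)
      (hθθ : cup 0 thetaMap thetaMap ∈ cocycles 0 ⊥ 2)
      (hαα : cup 1 alphaMap alphaMap ∈ cocycles 1 ⊥ 2)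
      (hαβ : cup 1 alphaMap betaMap ∈ cocycles 2 ⊥ 2)
      (hββs : cup 1 betaMap betaMap ∈ cocycles 3 conformal 2),
    -- (b) non-triviality, parity and relativity of `θ`, `α`, `β`
    (cls hθ ≠ 0 ∧ cls hα ≠ 0 ∧ cls hβ ≠ 0 ∧
      CochainParity 0 theta ∧ theta ∈ relCochains 0 nilradical 1 ∧ IsInvariant 0 affine theta ∧
      CochainParity 1 alpha ∧ alpha ∈ relCochains (1 / 2) affine 1 ∧
      CochainParity 1 beta ∧ beta ∈ relCochains (3 / 2) conformal 1 ∧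
      ¬ IsRelativeClass 0 affine theta ∧
      ¬ IsRelativeClass (1 / 2) conformal alpha) ∧
    -- (c) the 1-cohomology
    (Submodule.span ℂ {cls hθ} = ⊤ ∧
      Submodule.span ℂ {cls hα} = ⊤ ∧
      Submodule.span ℂ {cls hβ} = ⊤ ∧
      ∀ lam : ℂ, lam ≠ 0 → lam ≠ 1 / 2 → lam ≠ 3 / 2 → Subsingleton (Cohomology lam ⊥ 1)) ∧
    -- (d) the cup products
    (cls hθα ≠ 0 ∧ cls hθβ ≠ 0 ∧ cls hββ ≠ 0 ∧
      cls hθθ = 0 ∧ cls hαα = 0 ∧ cls hαβ = 0 ∧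
      ¬ IsRelativeClass (1 / 2) affine (cup 1 thetaMap alphaMap) ∧
      ¬ IsRelativeClass (3 / 2) affine (cup 1 thetaMap betaMap)) ∧
    -- (e) the 2-cohomology
    (Submodule.span ℂ {cls hθα} = ⊤ ∧
      Submodule.span ℂ {cls hθβ} = ⊤ ∧
      Submodule.span ℂ {cls hββ} = ⊤ ∧
      Nontrivial (Cohomology 5 ⊥ 2) ∧
      ∀ lam : ℂ, lam ≠ 1 / 2 → lam ≠ 3 / 2 → lam ≠ 3 → (∀ m : ℕ, 2 * lam ≠ 7 + m) →
        Subsingleton (Cohomology lam ⊥ 2)) ∧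
    -- (f) the 2-cohomology relative to the conformal subalgebra
    (Module.finrank ℂ (Cohomology 3 conformal 2) = 1 ∧
      Submodule.span ℂ {cls hββs} = ⊤ ∧
      Module.finrank ℂ (Cohomology 5 conformal 2) = 1 ∧
      ∀ lam : ℂ, lam ≠ 3 → lam ≠ 5 →
        (∀ m : ℕ, lam ≠ 13 / 2 + 2 * m) → (∀ m : ℕ, lam ≠ 7 + 2 * m) →
        Subsingleton (Cohomology lam conformal 2)) := by
  have hθ : theta ∈ cocycles 0 ⊥ 1 := bolMap_mem_cocycles (by simp)
  have hα : alpha ∈ cocycles (1 / 2) ⊥ 1 := bolMap_mem_cocycles (by simp)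
  have hβ : beta ∈ cocycles (3 / 2) ⊥ 1 := bolMap_mem_cocycles (by simp)
  have pθ : CochainParity 0 theta := cochainParity_bolMap 2
  have pα : CochainParity 1 alpha := cochainParity_bolMap 3
  have pβ : CochainParity 1 beta := cochainParity_bolMap 5
  have hθα : cup 1 thetaMap alphaMap ∈ cocycles (1 / 2) ⊥ 2 := by
    have h := cup_mem_cocycles hθ hα pθ pα
    rwa [zero_add] at h
  have hθβ : cup 1 thetaMap betaMap ∈ cocycles (3 / 2) ⊥ 2 := by
    have h := cup_mem_cocycles hθ hβ pθ pβ
    rwa [zero_add] at h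
  have hββ : cup 1 betaMap betaMap ∈ cocycles 3 ⊥ 2 := by
    have h := cup_mem_cocycles hβ hβ pβ pβ
    rwa [show (3 / 2 + 3 / 2 : ℂ) = 3 by norm_num] at h
  have hθθ : cup 0 thetaMap thetaMap ∈ cocycles 0 ⊥ 2 := by
    have h := cup_mem_cocycles hθ hθ pθ pθ
    rwa [zero_add] at h
  have hαα : cup 1 alphaMap alphaMap ∈ cocycles 1 ⊥ 2 := by
    have h := cup_mem_cocycles hα hα pα pα
    rwa [show (1 / 2 + 1 / 2 : ℂ) = 1 by norm_num] at h
  have hαβ : cup 1 alphaMap betaMap ∈ cocycles 2 ⊥ 2 := by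
    have h := cup_mem_cocycles hα hβ pα pβ
    rwa [show (1 / 2 + 3 / 2 : ℂ) = 2 by norm_num] at h
  have hββs : cup 1 betaMap betaMap ∈ cocycles 3 conformal 2 :=
    relative_cocycles_two hββ (cup_conformal_eq_zero 1 le_rfl le_rfl)
  have nθα : ¬ IsRelativeClass (1 / 2) affine (cup 1 thetaMap alphaMap) :=
    not_isRelativeClass_theta_cup le_rfl (by norm_num)
  have nθβ : ¬ IsRelativeClass (3 / 2) affine (cup 1 thetaMap betaMap) :=
    not_isRelativeClass_theta_cup (by omega) (by norm_num)
  -- Non-triviality of θ∪α and θ∪β will follow from their classes not being affine-relative.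
  have relative {lam : ℂ} {χ : Cochain 2} (h : χ ∈ coboundaries lam ⊥ 2) :
      IsRelativeClass lam affine χ := ⟨0, zero_mem _, by rwa [sub_zero]⟩
  have ker {k n : ℕ} (h : n < k) : fieldBasis n ∈ LinearMap.ker (bolMap k) :=
    bolMap_fieldBasis_eq_zero h
  have nat_ne {N : ℕ} (hN : N < 7) (m : ℕ) : (N : ℂ) ≠ 7 + m := by
    intro h
    have h' : N = 7 + m := by exact_mod_cast h
    omega
  have Hββ : ∀ φ ∈ cocycles 3 conformal 2,
      ∃ c : ℂ, φ - c • cup 1 betaMap betaMap ∈ coboundaries 3 conformal 2 :=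
    conformal_exists_eq_smul hββs (le_refl 5) (by norm_num) originValue_beta_cup_beta
  refine ⟨⟨⟨oneCochain_mem_cocycles, ?_, ?_⟩, fun lam hl => ?_⟩, hθ, hα, hβ, hθα, hθβ, hββ, hθθ,
    hαα, hαβ, hββs, ⟨?_, ?_, ?_, pθ, ?_, theta_invariant, pα, ?_, pβ, ?_, ?_, ?_⟩,
    ⟨?_, ?_, ?_, fun lam h0 h1 h3 => ?_⟩, ⟨?_, ?_, ?_, ?_, ?_, ?_, nθα, nθβ⟩,
    ⟨?_, ?_, ?_, ?_, fun lam h1 h2 h3 h7 => ?_⟩, ⟨?_, ?_, ?_, fun lam h3 h5 h13 h7 => ?_⟩⟩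
  · rw [Ne, cls_eq_zero_iff]
    intro h
    have h1 : (oneCochain : Cochain 0) ![] = 0 := by rw [(Submodule.mem_bot ℂ).1 h]; rfl
    have h2 := congrArg evalOrigin (show (1 : SPoly) = 0 from h1)
    simp [evalOrigin_apply] at h2
  · refine span_cls_eq_top _ fun ψ hψ => ?_
    obtain ⟨⟨c, rfl⟩, -⟩ := eq_smul_one_of_cocycle hψ
    exact ⟨c, by rw [sub_self]; exact zero_mem _⟩
  · refine subsingleton_cohomology fun ψ hψ => ?_
    rw [(eq_smul_one_of_cocycle hψ).2 hl]
    exact zero_mem _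
  · rw [Ne, cls_eq_zero_iff]
    exact bolMap_notMem_coboundaries (by simp)
  · rw [Ne, cls_eq_zero_iff]
    exact bolMap_notMem_coboundaries (by simp)
  · rw [Ne, cls_eq_zero_iff]
    exact bolMap_notMem_coboundaries (by simp)
  · exact relCochains_one hθ (nilradical_le fun n hn => ker hn)
  · exact relCochains_one hα (affine_le fun n hn => ker hn)
  · exact relCochains_one hβ (conformal_le fun n hn => ker hn)
  · exact not_isRelativeClass_bolMap (by simp) fieldBasis_two_mem_affine
  · exact not_isRelativeClass_bolMap (by simp) (fieldBasis_mem_conformal (by omega))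
  · exact span_cls_eq_top _ (exists_sub_smul_mem_coboundaries_one (by simp))
  · exact span_cls_eq_top _ (exists_sub_smul_mem_coboundaries_one (by simp))
  · exact span_cls_eq_top _ (exists_sub_smul_mem_coboundaries_one (by simp))
  · exact subsingleton_cohomology fun ψ hψ => mem_coboundaries_one h0 h1 h3 hψ
  · rw [Ne, cls_eq_zero_iff]
    exact fun h => nθα (relative h)
  · rw [Ne, cls_eq_zero_iff]
    exact fun h => nθβ (relative h)
  · rw [Ne, cls_eq_zero_iff]
    exact beta_cup_beta_notMem_coboundaries
  · rw [cls_eq_zero_iff]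
    -- No primitive is exhibited for the three trivial cup products: their weights 0, 1 and 2 are
    -- not exceptional.
    refine mem_coboundaries_two (by norm_num) (by norm_num) (by norm_num) (fun m => ?_) hθθ
    rw [mul_zero]
    exact_mod_cast nat_ne (N := 0) (by omega) m
  · rw [cls_eq_zero_iff]
    refine mem_coboundaries_two (by norm_num) (by norm_num) (by norm_num) (fun m => ?_) hαα
    rw [mul_one]
    exact_mod_cast nat_ne (N := 2) (by omega) m
  · rw [cls_eq_zero_iff]
    refine mem_coboundaries_two (by norm_num) (by norm_num) (by norm_num) (fun m => ?_) hαβ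
    rw [show (2 * 2 : ℂ) = (4 : ℕ) by norm_num]
    exact nat_ne (N := 4) (by omega) m
  · exact span_cls_eq_top _ (span_theta_cup (Or.inl rfl) (by norm_num) hθα)
  · exact span_cls_eq_top _ (span_theta_cup (Or.inr rfl) (by norm_num) hθβ)
  · exact span_cls_eq_top _ (span_beta_cup_beta hββ)
  · refine ⟨cls weightFive_mem_cocycles, 0, ?_⟩
    rw [Ne, cls_eq_zero_iff]
    exact weightFive_notMem_coboundaries
  · exact subsingleton_cohomology fun ψ hψ => mem_coboundaries_two h1 h2 h3 h7 hψ
  · exact finrank_conformal_eq_one hββs beta_cup_beta_notMem_coboundaries Hββ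
  · exact span_cls_eq_top _ Hββ
  · exact finrank_conformal_eq_one weightFive_mem_conformal weightFive_notMem_coboundaries
      (conformal_exists_eq_smul weightFive_mem_conformal (show 5 ≤ 7 by omega) (by norm_num)
        originValue_weightFive)
  · refine subsingleton_cohomology fun ψ hψ => ?_
    rw [conformal_cocycle_eq_zero h3 h5 h13 h7 hψ]
    exact zero_mem _
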